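/- Fix an integer $r>0$; all vector spaces are over $\mathbb C$. **The web superalgebra $W=W(r)$.** Let $\mathsf A(r)$ be the set of tuples of positive integers with sum $r$. Webs are read from bottom to top, and in a product $w_1w_2$ the web $w_1$ is on top. $W$ is the locally unital superalgebra with distinguished idempotents $a\in\mathsf A(r)$ (the *identities*: vertical strands labelled $a_1,\dots,a_m$), so that $\sum_{a}a=1$, generated by the identities and by the following local webs, with vertical identity strands $L$ to the left and $R$ to the right such that the lower and the upper boundary lie in $\mathsf A(r)$: *merges* $m_{k,l}$ (lower boundary $L,k,l,R$, upper boundary $L,k+l,R$), *splits* $s_{k,l}$ (lower boundary $L,k+l,R$, upper boundary $L,k,l,R$), which are even, and *dots* $d$ on a strand $k$ (both boundaries $L,k,R$), which are odd. A product of two webs is $0$ if the lower boundary of the upper one differs from the upper boundary of the lower one, and the identities act as identities. Strands labelled $0$ without dots are erased (so $m_{k,0},m_{0,k},s_{k,0},s_{0,k}$ are identities), and a web with a dot on a $0$-strand is $0$. Write $d_i$ for a dot on the $i$-th of the displayed strands. Two generators with disjoint supports commute if at least one of them is even and anticommute if both are dots. The other relations are local (identity strands are added to the left and to the right), for all $h,k,l>0$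 subject to total thickness $r$: 1. $m_{h+k,l}\,(m_{h,k}|l)=m_{h,k+l}\,(h|m_{k,l})$ and $(h|s_{k,l})\,s_{h,k+l}=(s_{h,k}|l)\,s_{h+k,l}$; 2. $m_{k,l}s_{k,l}=\binom{k+l}{l}$ (times the identity of the strand $k+l$); 3. $d^2=k$ (times the identity) on a strand $k$; 4. $d\,m_{1,k}=m_{1,k}d_1+m_{1,k}d_2$, $\ s_{1,k}d=d_1s_{1,k}+d_2s_{1,k}$, and the same with $(k,1)$ in place of $(1,k)$; 5. $s_{1,1}m_{1,1}-d_1d_2\,s_{1,1}m_{1,1}\,d_1d_2=2$ (times the identity); 6. on adjacent strands let $E$ be the ladder $(k,l)\to(k+1,l-1)$ that splits $l$ into $1,l-1$ and then merges $k,1$, let $F$ be the ladder $(k,l)\to(k-1,l+1)$ that splits $k$ into $k-1,1$ and then merges $1,l$, and let $\bar E,\bar F$ be the same ladders with a dot on the rung labelled $1$. On the strands $k,l$: $EF-FE=k-l$ (times the identity) and $\bar EF-F\bar E=d_1-d_2=E\bar F-\bar FE$; 7. on the strands $h,k,l$, with $E_1,F_1,\dots$ acting on the first two and $E_2,F_2,\dots$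 on the last two of the strands: $E_1E_2-E_2E_1=\bar E_1\bar E_2+\bar E_2\bar E_1$, $\ E_1\bar E_2-\bar E_2E_1=\bar E_1E_2-E_2\bar E_1$, $\ F_2F_1-F_1F_2=\bar F_2\bar F_1+\bar F_1\bar F_2$, $\ \bar F_2F_1-F_1\bar F_2=F_2\bar F_1-\bar F_1F_2$. **Sergeev diagrams.** Let $a_\omega=(1,\dots,1)\in\mathsf A(r)$. The crossing $s_i\in a_\omega Wa_\omega$ ($1\le i\le r-1$) is $s_{1,1}m_{1,1}$ on the $i$-th and $(i+1)$-st strands minus $a_\omega$, and $c_j$ is the dot on the $j$-th strand of $a_\omega$. The crossings satisfy the Coxeter relations of $\mathfrak S_r$, so every $\sigma\in\mathfrak S_r$ gives an element $\sigma\in a_\omega Wa_\omega$ (a product of crossings, whose strand starting at $p$ ends at $\sigma(p)$). The elements $c_1^{\epsilon_1}\cdots c_r^{\epsilon_r}\sigma$ with $\epsilon_j\in\{0,1\}$ are the Sergeev diagrams. **Supertabloids.** Let $\Lambda'(r)$ be the set of $\lambda=(\lambda_1,\dots,\lambda_r)$ of nonnegative integers with sum $r$ whose only zeros are trailing, and let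 $a_\lambda\in\mathsf A(r)$ be the tuple of the nonzero entries of $\lambda$. For $\lambda,\mu\in\Lambda'(r)$, a $\lambda$-supertabloid of type $\mu$ is an arrangement of $r$ elements of $\{1'<1<2'<2<\dots<r'<r\}$ into $r$ rows, up to permutations within the rows, such that row $i$ has $\lambda_i$ entries and exactly $\mu_j$ of all the entries lie in $\{j,j'\}$. Let $\mathscr T_*(\lambda,\mu)$ be the set of those in which, for all $i,j$, the letter $j'$ occurs at most once in row $i$. **The webs $\theta_T$.** Given such a $T$, sort each row increasingly and read the entries from left to right and from top to bottom; the $p$-th entry belongs to the strand starting at position $p$. The upper positions $1,\dots,r$ are divided into consecutive groupings of sizes $\mu_1,\mu_2,\dots$. In the order of reading, the strand of an entry $j$ or $j'$ is connected to the leftmost upper position of the $j$-th grouping that is still free. This gives a permutation $\sigma_T$; let $w_T=c_1^{\epsilon_1}\cdots c_r^{\epsilon_r}\sigma_T$, where $\epsilon_q=1$ if and only if the strand ending at $q$ belongs to a primed entry. Let $\theta_T\in a_\mu Wa_\lambda$ be the product, from bottom to top, of the complete splits of each strand $\lambda_i$ into $\lambda_i$ strands labelled $1$, of $w_T$, and of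 the complete merges of the strands of the $j$-th grouping into one strand $\mu_j$, for all $j$ (by 1 these do not depend on the order of the splits and merges). **Theorem.** For all $\lambda,\mu\in\Lambda'(r)$ the webs $\theta_T$, $T\in\mathscr T_*(\lambda,\mu)$, form a basis of $a_\mu Wa_\lambda$ (in particular they are pairwise distinct). -/

import Mathlib

/-! # The web superalgebra of type Q and the webs attached to supertabloids

A boundary of a web is a list of strand labels (thicknesses), read from left to right.
Webs are read from bottom to top, so in a product `w₁ * w₂` the web `w₁` is on top. -/

/-- `a` is a tuple of positive integers with sum `r`. -/
def IsStrands (r : ℕ) (a : List ℕ) : Prop :=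
  (∀ x ∈ a, 0 < x) ∧ a.sum = r

/-- The three elementary local webs: a merge of adjacent strands `k`, `l` into a strand `k + l`,
a split of a strand `k + l` into strands `k`, `l`, and a dot on a strand `k`. -/
inductive Piece : Type
  | merge (k l : ℕ)
  | split (k l : ℕ)
  | dot (k : ℕ)

namespace Piece

/-- Labels of the lower boundary. -/
def bot : Piece → List ℕ
  | merge k l => [k, l]
  | split k l => [k + l]
  | dot k => [k]

/-- Labels of the upper boundary. -/
def top : Piece → List ℕ
  | merge k l => [k + l]
  | split k l => [k, l]
  | dot k => [k]

/-- Parity: dots are odd, merges and splits are even. -/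
def parity : Piece → ℕ
  | merge _ _ => 0
  | split _ _ => 0
  | dot _ => 1

end Piece

/-- The generators of the web superalgebra of total thickness `r`: for each tuple `a` of positive
integers with sum `r` the identity `a`, and the merges, splits and dots `x` with identity strands
`L` to the left and `R` to the right. -/
inductive WebGen (r : ℕ) : Type
  | ident (a : List ℕ) (h : IsStrands r a)
  | piece (L : List ℕ) (x : Piece) (R : List ℕ)
      (hbot : IsStrands r (L ++ x.bot ++ R)) (htop : IsStrands r (L ++ x.top ++ R))

namespace WebGen

variable {r : ℕ}

/-- The lower boundary of a generator. -/
def bot : WebGen r → List ℕ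
  | ident a _ => a
  | piece L x R _ _ => L ++ x.bot ++ R

/-- The upper boundary of a generator. -/
def top : WebGen r → List ℕ
  | ident a _ => a
  | piece L x R _ _ => L ++ x.top ++ R

end WebGen

namespace FreeWeb

/-! ### Drawing webs in the free algebra on the generators

The labels of the webs drawn below may be `0`: a `0`-strand without a dot is erased, and a web with
a dot on a `0`-strand is zero. -/

/-- Erase all `0`-strands. -/
def erase (a : List ℕ) : List ℕ := a.filter (fun k => decide (0 < k))

open Classical in
/-- The identity web on the strands `a`, after erasing its `0`-strands. -/
noncomputable def ident (r : ℕ) (a : List ℕ) : FreeAlgebra ℂ (WebGen r) :=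
  if h : IsStrands r (erase a) then FreeAlgebra.ι ℂ (WebGen.ident (erase a) h) else 0

open Classical in
/-- The local web `x` with identity strands `L` to its left and `R` to its right. The value is `0`
if this is not one of the generators. -/
noncomputable def piece (r : ℕ) (L : List ℕ) (x : Piece) (R : List ℕ) :
    FreeAlgebra ℂ (WebGen r) :=
  if h : IsStrands r (erase L ++ x.bot ++ erase R) ∧ IsStrands r (erase L ++ x.top ++ erase R) then
    FreeAlgebra.ι ℂ (WebGen.piece (erase L) x (erase R) h.1 h.2)
  else 0

/-- Merge of adjacent strands `k`, `l`. It is an identity if `k` or `l` is `0`. -/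
noncomputable def merge (r : ℕ) (L : List ℕ) (k l : ℕ) (R : List ℕ) : FreeAlgebra ℂ (WebGen r) :=
  if k = 0 ∨ l = 0 then ident r (L ++ [k, l] ++ R) else piece r L (.merge k l) R

/-- Split of a strand `k + l` into `k`, `l`. It is an identity if `k` or `l` is `0`. -/
noncomputable def split (r : ℕ) (L : List ℕ) (k l : ℕ) (R : List ℕ) : FreeAlgebra ℂ (WebGen r) :=
  if k = 0 ∨ l = 0 then ident r (L ++ [k, l] ++ R) else piece r L (.split k l) R

/-- Dot on the strand `k`; the value is `0` if `k = 0`. -/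
noncomputable def dot (r : ℕ) (L : List ℕ) (k : ℕ) (R : List ℕ) : FreeAlgebra ℂ (WebGen r) :=
  piece r L (.dot k) R

/-- Two horizontally adjacent dots on strands `k`, `l`: the left one is the higher one. -/
noncomputable def dots (r : ℕ) (L : List ℕ) (k l : ℕ) (R : List ℕ) : FreeAlgebra ℂ (WebGen r) :=
  dot r L k (l :: R) * dot r (L ++ [k]) l R

/-- Ladder from `(k, l + 1)` to `(k + 1, l)` with one leftward rung labelled `1`. -/
noncomputable def rungL (r : ℕ) (L : List ℕ) (k l : ℕ) (R : List ℕ) : FreeAlgebra ℂ (WebGen r) :=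
  merge r L k 1 (l :: R) * split r (L ++ [k]) 1 l R

/-- As `rungL`, with a dot on the rung. -/
noncomputable def rungLDot (r : ℕ) (L : List ℕ) (k l : ℕ) (R : List ℕ) :
    FreeAlgebra ℂ (WebGen r) :=
  merge r L k 1 (l :: R) * dot r (L ++ [k]) 1 (l :: R) * split r (L ++ [k]) 1 l R

/-- Ladder from `(k + 1, l)` to `(k, l + 1)` with one rightward rung labelled `1`. -/
noncomputable def rungR (r : ℕ) (L : List ℕ) (k l : ℕ) (R : List ℕ) : FreeAlgebra ℂ (WebGen r) :=
  merge r (L ++ [k]) 1 l R * split r L k 1 (l :: R)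

/-- As `rungR`, with a dot on the rung. -/
noncomputable def rungRDot (r : ℕ) (L : List ℕ) (k l : ℕ) (R : List ℕ) :
    FreeAlgebra ℂ (WebGen r) :=
  merge r (L ++ [k]) 1 l R * dot r (L ++ [k]) 1 (l :: R) * split r L k 1 (l :: R)

end FreeWeb

open FreeWeb in
/-- The defining relations of the web superalgebra. In the local relations, `L` and `R` are the
identity strands to the left and to the right, and all labels of the lower (or upper) boundary
named in the hypothesis are positive with sum `r`. -/
inductive WebRel (r : ℕ) : FreeAlgebra ℂ (WebGen r) → FreeAlgebra ℂ (WebGen r) → Prop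
  /-- Webs whose boundaries do not match have product zero. -/
  | compat (g g' : WebGen r) (h : g.bot ≠ g'.top) :
      WebRel r (FreeAlgebra.ι ℂ g * FreeAlgebra.ι ℂ g') 0
  | ident_mul (g : WebGen r) :
      WebRel r (ident r g.top * FreeAlgebra.ι ℂ g) (FreeAlgebra.ι ℂ g)
  | mul_ident (g : WebGen r) :
      WebRel r (FreeAlgebra.ι ℂ g * ident r g.bot) (FreeAlgebra.ι ℂ g)
  /-- The (finitely many) identities add up to the unit. -/
  | sum_ident : WebRel r (∑ a : Composition r, ident r a.blocks) 1
  | superinterchange (L : List ℕ) (x : Piece) (M : List ℕ) (y : Piece) (R : List ℕ)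
      (h : IsStrands r (L ++ x.bot ++ M ++ y.bot ++ R)) :
      WebRel r
        (piece r (L ++ x.top ++ M) y R * piece r L x (M ++ y.bot ++ R))
        ((-1 : ℂ) ^ (x.parity * y.parity) •
          (piece r L x (M ++ y.top ++ R) * piece r (L ++ x.bot ++ M) y R))
  | assoc_merge (L : List ℕ) (h k l : ℕ) (R : List ℕ) (hv : IsStrands r (L ++ [h, k, l] ++ R)) :
      WebRel r
        (merge r L (h + k) l R * merge r L h k (l :: R))
        (merge r L h (k + l) R * merge r (L ++ [h]) k l R)
  | assoc_split (L : List ℕ) (h k l : ℕ) (R : List ℕ) (hv : IsStrands r (L ++ [h, k, l] ++ R)) :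
      WebRel r
        (split r (L ++ [h]) k l R * split r L h (k + l) R)
        (split r L h k (l :: R) * split r L (h + k) l R)
  | digon (L : List ℕ) (k l : ℕ) (R : List ℕ) (hv : IsStrands r (L ++ [k, l] ++ R)) :
      WebRel r
        (merge r L k l R * split r L k l R)
        (((k + l).choose l : ℂ) • ident r (L ++ [k + l] ++ R))
  | dot_collision (L : List ℕ) (k : ℕ) (R : List ℕ) (hv : IsStrands r (L ++ [k] ++ R)) :
      WebRel r (dot r L k R * dot r L k R) ((k : ℂ) • ident r (L ++ [k] ++ R))
  | dot_merge (L : List ℕ) (k : ℕ) (R : List ℕ) (hv : IsStrands r (L ++ [1, k] ++ R)) :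
      WebRel r
        (dot r L (1 + k) R * merge r L 1 k R)
        (merge r L 1 k R * dot r L 1 (k :: R) + merge r L 1 k R * dot r (L ++ [1]) k R)
  | dot_merge_reflected (L : List ℕ) (k : ℕ) (R : List ℕ) (hv : IsStrands r (L ++ [k, 1] ++ R)) :
      WebRel r
        (dot r L (k + 1) R * merge r L k 1 R)
        (merge r L k 1 R * dot r L k (1 :: R) + merge r L k 1 R * dot r (L ++ [k]) 1 R)
  | split_dot (L : List ℕ) (k : ℕ) (R : List ℕ) (hv : IsStrands r (L ++ [1, k] ++ R)) :
      WebRel r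
        (split r L 1 k R * dot r L (1 + k) R)
        (dot r L 1 (k :: R) * split r L 1 k R + dot r (L ++ [1]) k R * split r L 1 k R)
  | split_dot_reflected (L : List ℕ) (k : ℕ) (R : List ℕ) (hv : IsStrands r (L ++ [k, 1] ++ R)) :
      WebRel r
        (split r L k 1 R * dot r L (k + 1) R)
        (dot r L k (1 :: R) * split r L k 1 R + dot r (L ++ [k]) 1 R * split r L k 1 R)
  | dumbbell (L R : List ℕ) (hv : IsStrands r (L ++ [1, 1] ++ R)) :
      WebRel r
        (split r L 1 1 R * merge r L 1 1 R -
          dots r L 1 1 R * split r L 1 1 R * merge r L 1 1 R * dots r L 1 1 R)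
        ((2 : ℂ) • ident r (L ++ [1, 1] ++ R))
  | square_switch (L : List ℕ) (k l : ℕ) (R : List ℕ)
      (hv : IsStrands r (L ++ [k + 1, l + 1] ++ R)) :
      WebRel r
        (rungL r L k (l + 1) R * rungR r L k (l + 1) R -
          rungR r L (k + 1) l R * rungL r L (k + 1) l R)
        (((k : ℂ) - (l : ℂ)) • ident r (L ++ [k + 1, l + 1] ++ R))
  | square_switch_dot_top (L : List ℕ) (k l : ℕ) (R : List ℕ)
      (hv : IsStrands r (L ++ [k + 1, l + 1] ++ R)) :
      WebRel r
        (rungLDot r L k (l + 1) R * rungR r L k (l + 1) R -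
          rungR r L (k + 1) l R * rungLDot r L (k + 1) l R)
        (dot r L (k + 1) ((l + 1) :: R) - dot r (L ++ [k + 1]) (l + 1) R)
  | square_switch_dot_bot (L : List ℕ) (k l : ℕ) (R : List ℕ)
      (hv : IsStrands r (L ++ [k + 1, l + 1] ++ R)) :
      WebRel r
        (rungL r L k (l + 1) R * rungRDot r L k (l + 1) R -
          rungRDot r L (k + 1) l R * rungL r L (k + 1) l R)
        (dot r L (k + 1) ((l + 1) :: R) - dot r (L ++ [k + 1]) (l + 1) R)
  | double_rungs (L : List ℕ) (h k l : ℕ) (R : List ℕ)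
      (hv : IsStrands r (L ++ [h + 1, k + 1, l + 1] ++ R)) :
      WebRel r
        (rungL r L (h + 1) (k + 1) (l :: R) * rungL r (L ++ [h + 1]) (k + 1) l R -
          rungL r (L ++ [h + 2]) k l R * rungL r L (h + 1) k ((l + 1) :: R))
        (rungLDot r L (h + 1) (k + 1) (l :: R) * rungLDot r (L ++ [h + 1]) (k + 1) l R +
          rungLDot r (L ++ [h + 2]) k l R * rungLDot r L (h + 1) k ((l + 1) :: R))
  | double_rungs_dot (L : List ℕ) (h k l : ℕ) (R : List ℕ)
      (hv : IsStrands r (L ++ [h + 1, k + 1, l + 1] ++ R)) :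
      WebRel r
        (rungL r L (h + 1) (k + 1) (l :: R) * rungLDot r (L ++ [h + 1]) (k + 1) l R -
          rungLDot r (L ++ [h + 2]) k l R * rungL r L (h + 1) k ((l + 1) :: R))
        (rungLDot r L (h + 1) (k + 1) (l :: R) * rungL r (L ++ [h + 1]) (k + 1) l R -
          rungL r (L ++ [h + 2]) k l R * rungLDot r L (h + 1) k ((l + 1) :: R))
  | double_rungs_reversed (L : List ℕ) (h k l : ℕ) (R : List ℕ)
      (hv : IsStrands r (L ++ [h + 1, k + 1, l + 1] ++ R)) :
      WebRel r
        (rungR r (L ++ [h]) (k + 1) (l + 1) R * rungR r L h (k + 1) ((l + 1) :: R) -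
          rungR r L h k ((l + 2) :: R) * rungR r (L ++ [h + 1]) k (l + 1) R)
        (rungRDot r (L ++ [h]) (k + 1) (l + 1) R * rungRDot r L h (k + 1) ((l + 1) :: R) +
          rungRDot r L h k ((l + 2) :: R) * rungRDot r (L ++ [h + 1]) k (l + 1) R)
  | double_rungs_dot_reversed (L : List ℕ) (h k l : ℕ) (R : List ℕ)
      (hv : IsStrands r (L ++ [h + 1, k + 1, l + 1] ++ R)) :
      WebRel r
        (rungRDot r (L ++ [h]) (k + 1) (l + 1) R * rungR r L h (k + 1) ((l + 1) :: R) -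
          rungR r L h k ((l + 2) :: R) * rungRDot r (L ++ [h + 1]) k (l + 1) R)
        (rungR r (L ++ [h]) (k + 1) (l + 1) R * rungRDot r L h (k + 1) ((l + 1) :: R) -
          rungRDot r L h k ((l + 2) :: R) * rungR r (L ++ [h + 1]) k (l + 1) R)

/-- The web superalgebra of type Q of total thickness `r`. -/
abbrev Web (r : ℕ) : Type := RingQuot (WebRel r)

namespace Web

/-- The class of an element of the free algebra on the generators. -/
noncomputable def mk (r : ℕ) : FreeAlgebra ℂ (WebGen r) →ₐ[ℂ] Web r :=
  RingQuot.mkAlgHom ℂ (WebRel r)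

/-- The identity web on the strands `a`, after erasing its `0`-strands. -/
noncomputable def ident (r : ℕ) (a : List ℕ) : Web r := mk r (FreeWeb.ident r a)

/-- Merge of adjacent strands `k`, `l`. -/
noncomputable def merge (r : ℕ) (L : List ℕ) (k l : ℕ) (R : List ℕ) : Web r :=
  mk r (FreeWeb.merge r L k l R)

/-- Split of a strand `k + l` into strands `k`, `l`. -/
noncomputable def split (r : ℕ) (L : List ℕ) (k l : ℕ) (R : List ℕ) : Web r :=
  mk r (FreeWeb.split r L k l R)

/-- Dot on the strand `k`. -/
noncomputable def dot (r : ℕ) (L : List ℕ) (k : ℕ) (R : List ℕ) : Web r :=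
  mk r (FreeWeb.dot r L k R)

/-- The subspace `e W f` of the web superalgebra `W`. -/
noncomputable def corner (r : ℕ) (e f : Web r) : Submodule ℂ (Web r) :=
  LinearMap.range (LinearMap.mulLeft ℂ e ∘ₗ LinearMap.mulRight ℂ f)

/-! ### Iterated merges and splits -/

/-- Complete split of the strand `k` into `k` separate `1`-strands. -/
noncomputable def splitStrand (r : ℕ) (L : List ℕ) : ℕ → List ℕ → Web r
  | 0, R => ident r (L ++ R)
  | k + 1, R => splitStrand r (L ++ [1]) k R * split r L 1 k R

/-- Complete merge of `k` separate `1`-strands into one strand `k`. -/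
noncomputable def mergeStrand (r : ℕ) (L : List ℕ) : ℕ → List ℕ → Web r
  | 0, R => ident r (L ++ R)
  | k + 1, R => merge r L 1 k R * mergeStrand r (L ++ [1]) k R

/-- All the strands of `a` completely split, from `L ++ a` to `L ++ [1, ..., 1]`. -/
noncomputable def splitAll (r : ℕ) : List ℕ → List ℕ → Web r
  | L, [] => ident r L
  | L, k :: R => splitAll r (L ++ List.replicate k 1) R * splitStrand r L k R

/-- The complete merges from `L ++ [1, ..., 1]` to `L ++ a`. -/
noncomputable def mergeAll (r : ℕ) : List ℕ → List ℕ → Web r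
  | L, [] => ident r L
  | L, k :: R => mergeStrand r L k R * mergeAll r (L ++ List.replicate k 1) R

/-! ### Sergeev diagrams -/

/-- Crossing of the `1`-strands `i` and `i + 1` (counted from `0`) among `r` many: merge followed by
split, minus the identity. -/
noncomputable def crossing (r : ℕ) (i : Fin (r - 1)) : Web r :=
  split r (List.replicate i 1) 1 1 (List.replicate (r - 2 - i) 1) *
      merge r (List.replicate i 1) 1 1 (List.replicate (r - 2 - i) 1) -
    ident r (List.replicate r 1)

/-- Dot on the `j`-th (counted from `0`) of `r` many `1`-strands. -/
noncomputable def strandDot (r : ℕ) (j : Fin r) : Web r :=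
  dot r (List.replicate j 1) 1 (List.replicate (r - 1 - j) 1)

/-- The transposition of `i` and `i + 1`. -/
def simpleSwap (r : ℕ) (i : Fin (r - 1)) : Equiv.Perm (Fin r) :=
  Equiv.swap ⟨i, by omega⟩ ⟨i + 1, by omega⟩

/-- Each permutation is a product of simple transpositions. -/
theorem exists_word (r : ℕ) (σ : Equiv.Perm (Fin r)) :
    ∃ w : List (Fin (r - 1)), (w.map (simpleSwap r)).prod = σ := by
  cases r with
  | zero => exact ⟨[], Subsingleton.elim _ _⟩
  | succ n =>
    have h : σ ∈ Submonoid.closure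
        (Set.range fun i : Fin n => Equiv.swap i.castSucc i.succ) := by
      rw [Equiv.Perm.mclosure_swap_castSucc_succ]
      exact Submonoid.mem_top σ
    induction h using Submonoid.closure_induction with
    | mem x hx =>
      obtain ⟨i, rfl⟩ := hx
      refine ⟨[i], ?_⟩
      simp only [List.map_cons, List.map_nil, List.prod_cons, List.prod_nil, mul_one]
      rfl
    | one => exact ⟨[], rfl⟩
    | mul x y _ _ hx hy =>
      obtain ⟨u, hu⟩ := hx
      obtain ⟨v, hv⟩ := hy
      exact ⟨u ++ v, by rw [List.map_append, List.prod_append, hu, hv]⟩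

/-- A word in the simple transpositions whose product is `σ`. -/
noncomputable def word (r : ℕ) (σ : Equiv.Perm (Fin r)) : List (Fin (r - 1)) :=
  (exists_word r σ).choose

open Classical in
/-- The Sergeev diagram `c₁^{a₁} ⋯ c_r^{a_r} σ`: for each `p` one strand from the lower position `p`
to the upper position `σ p`, drawn with simple crossings along an expression of `σ` by simple
transpositions, and a dot at the top of the strands that end at a position in `a`. By the braid
relations that hold between the crossings, the web does not depend on the expression. -/
noncomputable def sergeev (r : ℕ) (a : Set (Fin r)) (σ : Equiv.Perm (Fin r)) : Web r :=
  ((List.finRange r).map fun j => if j ∈ a then strandDot r j else 1).prod *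
    ident r (List.replicate r 1) * ((word r σ).map (crossing r)).prod

end Web

/-! ### Compositions and supertabloids -/

/-- Compositions of `r` with `r` entries whose only zeros are trailing. -/
structure TrailingComposition (r : ℕ) where
  parts : Fin r → ℕ
  sum_parts : ∑ i, parts i = r
  trailing : ∀ i j, i ≤ j → parts i = 0 → parts j = 0

/-- The alphabet `1' < 1 < 2' < 2 < ⋯ < r' < r`; the letters `(j, false)` are the primed ones. -/
abbrev Letter (r : ℕ) : Type := Fin r ×ₗ Bool

namespace Letter

variable {r : ℕ}

/-- The letter `j'`. -/
def primed (j : Fin r) : Letter r := toLex (j, false)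

/-- The unprimed version of a letter. -/
def index (d : Letter r) : Fin r := (ofLex d).1

/-- The letter is primed. -/
def IsPrimed (d : Letter r) : Prop := (ofLex d).2 = false

end Letter

/-- A supertabloid of shape `lam` and type `mu`: an arrangement of letters in rows, up to
permutations within the rows, where row `i` has `lam i` entries and exactly `mu j` of all the
entries are `j` or `j'`. -/
@[ext]
structure Supertabloid {r : ℕ} (lam mu : TrailingComposition r) where
  row : Fin r → Multiset (Letter r)
  shape : ∀ i, (row i).card = lam.parts i
  type : ∀ j, (∑ i, row i).countP (fun d => d.index = j) = mu.parts j

namespace Supertabloid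

variable {r : ℕ} {lam mu : TrailingComposition r}

/-- Each primed letter occurs at most once in each row. -/
def IsRestricted (T : Supertabloid lam mu) : Prop :=
  ∀ i j, (T.row i).count (Letter.primed j) ≤ 1

/-- The entries, each row in increasing order, read from left to right and from top to bottom. -/
def reading (T : Supertabloid lam mu) : List (Letter r) :=
  (List.finRange r).flatMap fun i => (T.row i).sort (· ≤ ·)

theorem length_reading (T : Supertabloid lam mu) : T.reading.length = r := by
  rw [reading, List.length_flatMap]
  simp only [Multiset.length_sort, T.shape]
  rw [← List.ofFn_eq_map, List.sum_ofFn, lam.sum_parts]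

/-- The entry that corresponds to the strand starting at position `p`. -/
def entry (T : Supertabloid lam mu) (p : Fin r) : Letter r :=
  T.reading.get (p.cast T.length_reading.symm)

/-- The end position of the strand starting at position `p`. For `σ = Tuple.sort f` the sequence
`f ∘ σ` is `f` sorted stably into weakly increasing order. So the inverse of `σ` connects `p` to the
leftmost free position of the `j`-th grouping (of size `mu j`) if the entry of `p` is `j` or `j'`,
the strands being connected in the order of `p`. -/
def strandPerm (T : Supertabloid lam mu) : Equiv.Perm (Fin r) :=
  (Tuple.sort fun p => (T.entry p).index)⁻¹

/-- The end positions are ordered by grouping, and within a grouping by starting position. -/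
theorem strandPerm_lt_iff (T : Supertabloid lam mu) (p q : Fin r) :
    T.strandPerm p < T.strandPerm q ↔
      (T.entry p).index < (T.entry q).index ∨
        ((T.entry p).index = (T.entry q).index ∧ p < q) := by
  have h : StrictMono ((Tuple.sort fun p => (T.entry p).index).trans (Tuple.graphEquiv₁ _)) :=
    Tuple.eq_sort_iff'.1 rfl
  have h2 := h.lt_iff_lt (a := T.strandPerm p) (b := T.strandPerm q)
  rw [← h2]
  have h3 : ∀ x, (Tuple.sort fun p => (T.entry p).index) (T.strandPerm x) = x :=
    fun x => Equiv.apply_symm_apply _ x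
  simp only [Equiv.trans_apply, h3]
  exact Prod.Lex.toLex_lt_toLex (x := ((T.entry p).index, p)) (y := ((T.entry q).index, q))

/-- The end positions of the strands that correspond to primed entries. -/
def dotted (T : Supertabloid lam mu) : Set (Fin r) :=
  {j | (T.entry (T.strandPerm⁻¹ j)).IsPrimed}

/-- The Sergeev diagram `w_T`. -/
noncomputable def diagram (T : Supertabloid lam mu) : Web r :=
  Web.sergeev r T.dotted T.strandPerm

/-- The web `θ_T`: the complete splits of the strands of `lam`, then `w_T`, then the complete merges
into the strands of `mu`. -/
noncomputable def theta (T : Supertabloid lam mu) : Web r :=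
  Web.mergeAll r [] (List.ofFn mu.parts) * T.diagram * Web.splitAll r [] (List.ofFn lam.parts)

end Supertabloid

/-- The identity web on the nonzero entries of the composition. -/
noncomputable def TrailingComposition.idWeb {r : ℕ} (lam : TrailingComposition r) : Web r :=
  Web.ident r (List.ofFn lam.parts)

/-!
# A basis of the morphism spaces of the web superalgebra of type Q

The webs `θ_T` span for a diagrammatic reason and are linearly independent because there is a
representation in which they are visibly so. Both halves are organized around *Sergeev systems*
(`SergeevSystem`): dots `c_i` and permutations `σ` in a ring that satisfy the relations of the
Sergeev superalgebra. The dots and crossings on `1`-strands form one (`Web.sergeevSystem`).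

*Spanning.* Up to a nonzero factor, merging `k` strands completely after splitting one strand
completely is the identity, and the composite in the other order is a polynomial in the crossings
(`Web.bundle_succ_succ`, by the square switch relation). Hence a local web on top of a complete merge
is a complete merge on top of an element of the Sergeev superalgebra, and each web from `a` to `b` is
`merges * y * splits`, with `y` a combination of Sergeev diagrams (`Web.exists_factorization`). The
merges and the splits absorb the Young subgroups of `b` and `a` (`Web.mergeAll_mul_perm`,
`Web.perm_mul_splitAll`), so that up to sign only the double coset of a Sergeev diagram matters.
Each double coset contains the diagram of a supertabloid (`Supertabloid.exists_of_diagram`). If a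
primed letter occurs twice in a row, then two dots can be interchanged by a transposition that is
absorbed on both sides; as dots anticommute, the web is equal to its negative
(`Supertabloid.theta_eq_zero`).

*Linear independence.* Let `S` be a Sergeev system with unit `e = 1` in an algebra `A`, and let `e_a`
be the average of the Young subgroup of `a` in `A`. The web superalgebra is represented by matrices
over `A` indexed by compositions, whose entry at `b`, `a` lies in `e_b A e_a`: a split of `k + l` acts
by the Young average of its lower boundary, a merge by `(k + l).choose l` times the Young average of
its upper boundary, and a dot by the sum of the dots over its block. Rungs labelled `1` then act by
sums of transpositions over coset representatives (`SergeevSystem.transvSum`), and the defining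
relations become short identities between such sums (`SergeevSystem.freeRep_rel`,
`SergeevSystem.webRep`). The web `θ_T` acts by a nonzero multiple of `e_μ w_T e_λ`, the multiple being
independent of `T` (`exists_acts_theta`). For the concrete system `Fock.system`, in which
the Sergeev diagrams are linearly independent, the coefficient of `w_T` in `e_μ w_{T'} e_λ` vanishes
for `T' ≠ T`, as a supertabloid is determined by the double coset of its diagram
(`Supertabloid.eq_of_diagram`). For `T' = T` it is nonzero, because in a restricted supertabloid
a pair of Young permutations that fixes the diagram up to sign fixes each of the dots
(`Supertabloid.IsRestricted.apply_eq`), so that nothing cancels.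
-/


/-! ### Sergeev systems -/

/-- Elements of a ring that satisfy the defining relations of the Sergeev superalgebra, the
wreath product of a Clifford superalgebra with a symmetric group. The unit of the Sergeev
superalgebra is allowed to be an idempotent `e` of the ambient ring; the permutations are instead
units of the ambient ring, so that the element of the Sergeev superalgebra that belongs to `σ` is
`perm σ * e`. -/
structure SergeevSystem (r : ℕ) (A : Type*) [Ring A] where
  e : A
  perm : Equiv.Perm (Fin r) →* A
  dot : Fin r → A
  e_mul_e : e * e = e
  perm_mul_e : ∀ σ, perm σ * e = e * perm σ
  e_mul_dot : ∀ i, e * dot i = dot i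
  dot_mul_e : ∀ i, dot i * e = dot i
  dot_mul_self : ∀ i, dot i * dot i = e
  dot_mul_dot : ∀ i j, i ≠ j → dot i * dot j = -(dot j * dot i)
  perm_mul_dot : ∀ σ i, perm σ * dot i = dot (σ i) * perm σ

namespace SergeevSystem

variable {r : ℕ} {A : Type*} [Ring A] (S : SergeevSystem r A)

/-- The product of the dots at the positions in the list `l`. -/
def dots (l : List (Fin r)) : A := (l.map S.dot).prod

@[simp] lemma dots_nil : S.dots [] = 1 := rfl

@[simp] lemma dots_cons (i : Fin r) (l : List (Fin r)) :
    S.dots (i :: l) = S.dot i * S.dots l := by simp [dots]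

lemma dots_append (l l' : List (Fin r)) : S.dots (l ++ l') = S.dots l * S.dots l' := by
  simp [dots]

lemma perm_mul_dots (σ : Equiv.Perm (Fin r)) (l : List (Fin r)) :
    S.perm σ * S.dots l = S.dots (l.map σ) * S.perm σ := by
  induction l with
  | nil => simp
  | cons i l ih =>
    simp only [dots_cons, List.map_cons]
    rw [← mul_assoc, perm_mul_dot, mul_assoc, ih, mul_assoc]

lemma dots_mul_e (l : List (Fin r)) : S.dots l * S.e = S.e * S.dots l := by
  induction l with
  | nil => simp
  | cons i l ih => rw [dots_cons, mul_assoc, ih, ← mul_assoc, ← mul_assoc, dot_mul_e, e_mul_dot]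

/-- Rearranging distinct dots costs a sign, which depends only on the rearrangement and not on the
positions of the dots. -/
lemma exists_sign_of_perm {l l' : List (Fin r)} (h : l.Perm l') (hl : l.Nodup) :
    ∃ s : ℤˣ, ∀ g : Fin r → Fin r, Function.Injective g →
      S.dots (l.map g) = s • S.dots (l'.map g) := by
  induction h with
  | nil => exact ⟨1, fun g _ => by simp⟩
  | cons x _ ih =>
    obtain ⟨s, hs⟩ := ih (List.nodup_cons.1 hl).2
    exact ⟨s, fun g hg => by simp only [List.map_cons, dots_cons, hs g hg, mul_smul_comm]⟩
  | swap x y l =>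
    refine ⟨-1, fun g hg => ?_⟩
    have hne : g y ≠ g x := fun h => by
      simp [hg h] at hl
    simp only [List.map_cons, dots_cons, ← mul_assoc]
    rw [S.dot_mul_dot _ _ hne]
    simp [Units.smul_def]
  | trans h₁ _ ih₁ ih₂ =>
    obtain ⟨s, hs⟩ := ih₁ hl
    obtain ⟨t, ht⟩ := ih₂ (h₁.nodup_iff.1 hl)
    exact ⟨s * t, fun g hg => by rw [hs g hg, ht g hg, mul_smul]⟩

lemma exists_sign_dots {l l' : List (Fin r)} (h : l.Perm l') (hl : l.Nodup) :
    ∃ s : ℤˣ, S.dots l = s • S.dots l' := by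
  obtain ⟨s, hs⟩ := S.exists_sign_of_perm h hl
  exact ⟨s, by simpa using hs id Function.injective_id⟩

/-- Interchanging the positions of two of the dots in a product changes its sign. -/
lemma dots_map_swap {l : List (Fin r)} (hl : l.Nodup) {p q : Fin r} (hpq : p ≠ q)
    (hp : p ∈ l) (hq : q ∈ l) : S.dots (l.map (Equiv.swap p q)) = -S.dots l := by
  have hq' : q ∈ l.erase p := (hl.mem_erase_iff).2 ⟨hpq.symm, hq⟩
  have hperm : l.Perm (p :: q :: (l.erase p).erase q) :=
    (List.perm_cons_erase hp).trans ((List.perm_cons_erase hq').cons p)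
  obtain ⟨s, hs⟩ := S.exists_sign_of_perm hperm hl
  have h1 := hs id Function.injective_id
  have h2 := hs (Equiv.swap p q) (Equiv.injective _)
  have hfix : ((l.erase p).erase q).map (Equiv.swap p q) = (l.erase p).erase q := by
    conv_rhs => rw [← List.map_id ((l.erase p).erase q)]
    refine List.map_congr_left fun x hx => ?_
    have hx1 : x ∈ l.erase p ∧ x ≠ q := by
      have := ((hl.erase p).mem_erase_iff).1 hx
      exact ⟨this.2, this.1⟩
    have hx2 := (hl.mem_erase_iff).1 hx1.1
    exact Equiv.swap_apply_of_ne_of_ne hx2.1 hx1.2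
  rw [h2, List.map_cons, List.map_cons, hfix, Equiv.swap_apply_left, Equiv.swap_apply_right]
  rw [List.map_id] at h1
  rw [h1, List.map_id]
  simp only [dots_cons, ← mul_assoc]
  rw [S.dot_mul_dot q p hpq.symm]
  simp

/-- Repeated dots cancel. -/
lemma exists_nodup_dots (l : List (Fin r)) :
    ∃ (s : ℤˣ) (l' : List (Fin r)), l'.Nodup ∧ S.dots l * S.e = s • (S.dots l' * S.e) := by
  induction l with
  | nil => exact ⟨1, [], List.nodup_nil, by simp⟩
  | cons i l ih =>
    obtain ⟨s, l', hl', h⟩ := ih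
    by_cases hi : i ∈ l'
    · obtain ⟨t, ht⟩ := S.exists_sign_dots (List.perm_cons_erase hi) hl'
      refine ⟨s * t, l'.erase i, hl'.erase i, ?_⟩
      rw [dots_cons, mul_assoc, h, ht, dots_cons, mul_smul_comm, smul_mul_assoc, mul_smul_comm,
        mul_assoc (S.dot i), ← mul_assoc (S.dot i) (S.dot i), dot_mul_self, ← mul_assoc, ← dots_mul_e,
        mul_assoc, e_mul_e, mul_smul]
    · exact ⟨s, i :: l', List.nodup_cons.2 ⟨hi, hl'⟩, by
        rw [dots_cons, mul_assoc, h, mul_smul_comm, dots_cons, mul_assoc]⟩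

open Classical in
lemma prod_ite_dot (a : Set (Fin r)) (l : List (Fin r)) :
    (l.map fun j => if j ∈ a then S.dot j else 1).prod = S.dots (l.filter (· ∈ a)) := by
  induction l with
  | nil => simp
  | cons i l ih =>
    by_cases h : i ∈ a
    · simp [h, ih]
    · simp [h, ih]

variable [Algebra ℂ A]

/-- The span of the elements `c_{i₁} ⋯ c_{i_m} σ` of a Sergeev system. -/
def span : Submodule ℂ A :=
  Submodule.span ℂ (Set.range fun x : List (Fin r) × Equiv.Perm (Fin r) =>
    S.dots x.1 * S.perm x.2 * S.e)

lemma dots_perm_mem_span (l : List (Fin r)) (σ : Equiv.Perm (Fin r)) :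
    S.dots l * S.perm σ * S.e ∈ S.span := Submodule.subset_span ⟨(l, σ), rfl⟩

lemma e_mem_span : S.e ∈ S.span := by
  simpa using S.dots_perm_mem_span [] 1

lemma perm_mem_span (σ : Equiv.Perm (Fin r)) : S.perm σ * S.e ∈ S.span := by
  simpa using S.dots_perm_mem_span [] σ

lemma dot_mem_span (i : Fin r) : S.dot i ∈ S.span := by
  simpa [dot_mul_e] using S.dots_perm_mem_span [i] 1

lemma mul_mem_span {x y : A} (hx : x ∈ S.span) (hy : y ∈ S.span) : x * y ∈ S.span := by
  induction hx using Submodule.span_induction with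
  | zero => simp
  | add x x' _ _ h h' => rw [add_mul]; exact add_mem h h'
  | smul z x _ h => rw [smul_mul_assoc]; exact Submodule.smul_mem _ _ h
  | mem x hx =>
    obtain ⟨⟨l, σ⟩, rfl⟩ := hx
    induction hy using Submodule.span_induction with
    | zero => simp
    | add x x' _ _ h h' => rw [mul_add]; exact add_mem h h'
    | smul z x _ h => rw [mul_smul_comm]; exact Submodule.smul_mem _ _ h
    | mem y hy =>
      obtain ⟨⟨l', τ⟩, rfl⟩ := hy
      have : S.dots l * S.perm σ * S.e * (S.dots l' * S.perm τ * S.e) =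
          S.dots (l ++ l'.map σ) * S.perm (σ * τ) * S.e := by
        rw [dots_append, map_mul]
        calc _ = S.dots l * S.perm σ * (S.e * S.dots l') * S.perm τ * S.e := by
              simp only [mul_assoc]
          _ = S.dots l * (S.perm σ * S.dots l') * (S.e * S.perm τ) * S.e := by
              rw [← dots_mul_e]; simp only [mul_assoc]
          _ = _ := by
              rw [perm_mul_dots, ← perm_mul_e]; simp only [mul_assoc, e_mul_e]
      rw [show (fun x : List (Fin r) × Equiv.Perm (Fin r) => S.dots x.1 * S.perm x.2 * S.e) (l, σ) =
        S.dots l * S.perm σ * S.e from rfl, this]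
      exact S.dots_perm_mem_span _ _

end SergeevSystem

/-! ### The Coxeter presentation of the symmetric group -/

/-- The relations of the symmetric group on `n + 1` letters between its simple transpositions. -/
structure CoxeterRel {M : Type*} [Monoid M] (n : ℕ) (x : ℕ → M) : Prop where
  sq : ∀ i, i < n → x i * x i = 1
  braid : ∀ i, i + 1 < n → x i * x (i + 1) * x i = x (i + 1) * x i * x (i + 1)
  comm : ∀ i j, i + 1 < j → j < n → x i * x j = x j * x i

namespace CoxeterRel

variable {M : Type*} [Monoid M] {n : ℕ} {x : ℕ → M}

/-- The product `x (j + m - 1) ⋯ x (j + 1) x j`. -/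
def descending (x : ℕ → M) (j : ℕ) : ℕ → M
  | 0 => 1
  | m + 1 => x (j + m) * descending x j m

lemma descending_succ (x : ℕ → M) (j m : ℕ) :
    descending x j (m + 1) = descending x (j + 1) m * x j := by
  induction m with
  | zero => simp [descending]
  | succ m ih =>
    rw [descending, ih, descending, mul_assoc, show j + 1 + m = j + (m + 1) by omega]

lemma descending_add (x : ℕ → M) (j m k : ℕ) :
    descending x j (m + k) = descending x (j + m) k * descending x j m := by
  induction k with
  | zero => simp [descending]
  | succ k ih => rw [← add_assoc, descending, ih, descending, mul_assoc, add_assoc]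

lemma mul_descending (h : CoxeterRel n x) (i j m : ℕ) (hij : i + 1 < j) (hm : j + m ≤ n) :
    x i * descending x j m = descending x j m * x i := by
  induction m with
  | zero => simp [descending]
  | succ m ih =>
    rw [descending, ← mul_assoc, h.comm i (j + m) (by omega) (by omega), mul_assoc, ih (by omega),
      mul_assoc]

lemma mul_descending' (h : CoxeterRel n x) (i j m : ℕ) (hij : j + m < i + 0) (hm : i < n) :
    x i * descending x j m = descending x j m * x i := by
  induction m with
  | zero => simp [descending]
  | succ m ih =>
    rw [descending, ← mul_assoc, ← h.comm (j + m) i (by omega) (by omega), mul_assoc,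
      ih (by omega), mul_assoc]

lemma descending_mul (h : CoxeterRel n x) (i j : ℕ) (hij : j < i) (hi : i < n) :
    descending x j (n - j) * x i = x (i - 1) * descending x j (n - j) := by
  obtain ⟨m, rfl⟩ : ∃ m, i = j + m + 1 := ⟨i - j - 1, by omega⟩
  obtain ⟨k, rfl⟩ : ∃ k, n = j + m + 1 + 1 + k := ⟨n - (j + m + 1 + 1), by omega⟩
  have h1 : descending x j (j + m + 1 + 1 + k - j) =
      descending x (j + m + 1 + 1) k * (x (j + m + 1) * (x (j + m) * descending x j m)) := by
    rw [show j + m + 1 + 1 + k - j = (m + 2) + k by omega, descending_add]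
    rfl
  have h2 := h.mul_descending' (j + m + 1) j m (by omega) (by omega)
  have h3 := h.mul_descending (j + m) (j + m + 1 + 1) k (by omega) (by omega)
  have h4 := h.braid (j + m) (by omega)
  rw [h1, Nat.add_sub_cancel]
  calc _ = descending x (j + m + 1 + 1) k *
        (x (j + m + 1) * (x (j + m) * (descending x j m * x (j + m + 1)))) := by
        simp only [mul_assoc]
    _ = descending x (j + m + 1 + 1) k *
        (x (j + m + 1) * x (j + m) * x (j + m + 1)) * descending x j m := by
        rw [← h2]; simp only [mul_assoc]
    _ = (descending x (j + m + 1 + 1) k * x (j + m)) *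
        (x (j + m + 1) * (x (j + m) * descending x j m)) := by
        rw [← h4]; simp only [mul_assoc]
    _ = _ := by rw [← h3]; simp only [mul_assoc]

/-- Each word in `x 0, …, x n` equals a word in `x 0, …, x (n - 1)` times a descending product. -/
lemma exists_normalForm (h : CoxeterRel (n + 1) x) (w : List ℕ) (hw : ∀ i ∈ w, i < n + 1) :
    ∃ (w' : List ℕ) (j : ℕ), (∀ i ∈ w', i < n) ∧ j ≤ n + 1 ∧
      (w.map x).prod = (w'.map x).prod * descending x j (n + 1 - j) := by
  induction w using List.reverseRecOn with
  | nil => exact ⟨[], n + 1, by simp, le_rfl, by simp [descending]⟩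
  | append_singleton w i ih =>
    obtain ⟨w', j, hw', hj, he⟩ := ih fun i hi => hw i (by simp [hi])
    have hi : i < n + 1 := hw i (by simp)
    rw [List.map_append, List.prod_append, he, List.map_singleton, List.prod_singleton, mul_assoc]
    rcases lt_trichotomy i j with hij | rfl | hij
    · by_cases hij' : i + 1 = j
      · subst hij'
        refine ⟨w', i, hw', by omega, ?_⟩
        rw [show n + 1 - i = (n + 1 - (i + 1)) + 1 by omega, descending_succ]
      · refine ⟨w' ++ [i], j, ?_, hj, ?_⟩
        · intro k hk
          rcases List.mem_append.1 hk with hk | hk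
          · exact hw' k hk
          · rw [List.mem_singleton] at hk; omega
        · rw [← h.mul_descending i j _ (by omega) (by omega)]
          simp [mul_assoc]
    · refine ⟨w', i + 1, hw', by omega, ?_⟩
      rw [show n + 1 - i = (n + 1 - (i + 1)) + 1 by omega, descending_succ, mul_assoc, h.sq i hi,
        mul_one]
    · refine ⟨w' ++ [i - 1], j, ?_, hj, ?_⟩
      · intro k hk
        rcases List.mem_append.1 hk with hk | hk
        · exact hw' k hk
        · rw [List.mem_singleton] at hk; omega
      · rw [h.descending_mul i j hij hi]
        simp [mul_assoc]

lemma mono {m : ℕ} (h : CoxeterRel n x) (hmn : m ≤ n) : CoxeterRel m x where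
  sq i hi := h.sq i (by omega)
  braid i hi := h.braid i (by omega)
  comm i j hij hj := h.comm i j hij (by omega)

lemma swap_rel (n : ℕ) : CoxeterRel n fun i => Equiv.swap i (i + 1) where
  sq i _ := Equiv.swap_mul_self _ _
  braid i _ := by
    ext k
    simp only [Equiv.Perm.mul_apply, Equiv.swap_apply_def]
    split_ifs <;> omega
  comm i j _ _ := by
    ext k
    simp only [Equiv.Perm.mul_apply, Equiv.swap_apply_def]
    split_ifs <;> omega

lemma prod_rel {N : Type*} [Monoid N] {y : ℕ → N} (hx : CoxeterRel n x) (hy : CoxeterRel n y) :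
    CoxeterRel n fun i => (x i, y i) where
  sq i hi := Prod.ext (hx.sq i hi) (hy.sq i hi)
  braid i hi := Prod.ext (hx.braid i hi) (hy.braid i hi)
  comm i j hij hj := Prod.ext (hx.comm i j hij hj) (hy.comm i j hij hj)

lemma descending_pair {N : Type*} [Monoid N] (x : ℕ → M) (y : ℕ → N) (j m : ℕ) :
    descending (fun i => (x i, y i)) j m = (descending x j m, descending y j m) := by
  induction m with
  | zero => rfl
  | succ m ih => simp only [descending, ih]; rfl

lemma prod_pair {N : Type*} [Monoid N] (x : ℕ → M) (y : ℕ → N) (w : List ℕ) :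
    (w.map fun i => (x i, y i)).prod = ((w.map x).prod, (w.map y).prod) := by
  induction w with
  | nil => rfl
  | cons i w ih => simp only [List.map_cons, List.prod_cons, ih]; rfl

lemma descending_swap_apply (j m : ℕ) :
    descending (fun i => Equiv.swap i (i + 1)) j m j = j + m := by
  induction m with
  | zero => rfl
  | succ m ih =>
    rw [descending, Equiv.Perm.mul_apply, ih, Equiv.swap_apply_left, add_assoc]

lemma prod_swap_apply (w : List ℕ) (n : ℕ) (hw : ∀ i ∈ w, i < n) :
    (w.map fun i => Equiv.swap i (i + 1)).prod (n + 1) = n + 1 := by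
  induction w with
  | nil => rfl
  | cons i w ih =>
    have := hw i (by simp)
    rw [List.map_cons, List.prod_cons, Equiv.Perm.mul_apply, ih fun i hi => hw i (by simp [hi]),
      Equiv.swap_apply_of_ne_of_ne (by omega) (by omega)]

/-- Words with the same product of simple transpositions have the same value in each monoid in
which the Coxeter relations hold. -/
lemma prod_eq (h : CoxeterRel n x) (w w' : List ℕ) (hw : ∀ i ∈ w, i < n) (hw' : ∀ i ∈ w', i < n)
    (he : (w.map fun i => Equiv.swap i (i + 1)).prod = (w'.map fun i => Equiv.swap i (i + 1)).prod) :
    (w.map x).prod = (w'.map x).prod := by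
  induction n generalizing w w' with
  | zero =>
    rw [List.eq_nil_iff_forall_not_mem.2 fun i hi => absurd (hw i hi) (by omega),
      List.eq_nil_iff_forall_not_mem.2 fun i hi => absurd (hw' i hi) (by omega)]
  | succ n ih =>
    have hp := h.prod_rel (swap_rel (n + 1))
    obtain ⟨v, j, hv, hj, e⟩ := hp.exists_normalForm w hw
    obtain ⟨v', j', hv', hj', e'⟩ := hp.exists_normalForm w' hw'
    simp only [prod_pair, descending_pair, Prod.mk_mul_mk, Prod.mk.injEq] at e e'
    have key : ∀ (v : List ℕ) (j : ℕ), (∀ i ∈ v, i < n) → j ≤ n + 1 →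
        ((v.map fun i => Equiv.swap i (i + 1)).prod *
          descending (fun i => Equiv.swap i (i + 1)) j (n + 1 - j)) j = n + 1 := by
      intro v j hv hj
      rw [Equiv.Perm.mul_apply, descending_swap_apply, Nat.add_sub_cancel' hj, prod_swap_apply v n hv]
    have hjj : j = j' := by
      have h1 := key v j hv hj
      have h2 := key v' j' hv' hj'
      rw [← e.2, he] at h1
      rw [← e'.2] at h2
      exact (Equiv.injective _) (h1.trans h2.symm)
    subst hjj
    have hvv : (v.map fun i => Equiv.swap i (i + 1)).prod =
        (v'.map fun i => Equiv.swap i (i + 1)).prod := by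
      rw [e.2, e'.2] at he
      exact mul_right_cancel he
    rw [e.1, e'.1, ih (h.mono (Nat.le_succ n)) v v' hv hv' hvv]

/-- Elements that satisfy the Coxeter relations define a homomorphism from the symmetric group. -/
lemma exists_hom {r : ℕ} {x : Fin (r - 1) → M} {y : ℕ → M} (hy : ∀ i : Fin (r - 1), y i = x i)
    (h : CoxeterRel (r - 1) y) :
    ∃ f : Equiv.Perm (Fin r) →* M, ∀ w : List (Fin (r - 1)),
      f (w.map (Web.simpleSwap r)).prod = (w.map x).prod := by
  have hval : ∀ w : List (Fin (r - 1)), (w.map x).prod = ((w.map Fin.val).map y).prod := by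
    intro w
    rw [List.map_map]
    exact congrArg _ (List.map_congr_left fun i _ => (hy i).symm)
  let ι : Equiv.Perm (Fin r) →* Equiv.Perm ℕ := Equiv.Perm.viaEmbeddingHom Fin.valEmbedding
  have hι : ∀ w : List (Fin (r - 1)), ι (w.map (Web.simpleSwap r)).prod =
      ((w.map Fin.val).map fun i => Equiv.swap i (i + 1)).prod := by
    intro w
    rw [map_list_prod, List.map_map, List.map_map]
    refine congrArg _ (List.map_congr_left fun i _ => ?_)
    ext k
    simp only [Function.comp_apply]
    by_cases hk : k < r
    · have : k = Fin.valEmbedding (⟨k, hk⟩ : Fin r) := rfl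
      conv_lhs => rw [this]
      rw [Equiv.Perm.viaEmbeddingHom_apply, Equiv.Perm.viaEmbedding_apply]
      simp only [Web.simpleSwap, Equiv.swap_apply_def, Fin.ext_iff, Fin.valEmbedding_apply]
      split_ifs <;> rfl
    · rw [Equiv.Perm.viaEmbeddingHom_apply, Equiv.Perm.viaEmbedding_apply_of_notMem,
        Equiv.swap_apply_of_ne_of_ne (by omega) (by omega)]
      rintro ⟨z, rfl⟩
      exact hk z.2
  have key : ∀ w w' : List (Fin (r - 1)),
      (w.map (Web.simpleSwap r)).prod = (w'.map (Web.simpleSwap r)).prod →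
      (w.map x).prod = (w'.map x).prod := by
    intro w w' hw
    rw [hval, hval]
    refine h.prod_eq _ _ ?_ ?_ ?_
    · intro i hi
      obtain ⟨j, _, rfl⟩ := List.mem_map.1 hi
      exact j.2
    · intro i hi
      obtain ⟨j, _, rfl⟩ := List.mem_map.1 hi
      exact j.2
    · rw [← hι, ← hι, hw]
  refine ⟨{ toFun := fun σ => ((Web.word r σ).map x).prod, map_one' := ?_, map_mul' := ?_ }, ?_⟩
  · exact key _ [] (Web.exists_word r 1).choose_spec
  · intro σ τ
    rw [← List.prod_append, ← List.map_append]
    refine key _ _ ?_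
    rw [List.map_append, List.prod_append]
    exact (Web.exists_word r _).choose_spec.trans (congrArg₂ _
      (Web.exists_word r σ).choose_spec.symm (Web.exists_word r τ).choose_spec.symm)
  · intro w
    exact key _ _ (Web.exists_word r _).choose_spec

end CoxeterRel

/-! ### Young subgroups -/

/-- `IsCut a d` says that `d` is a partial sum of the list `a`, so that the boundary between two
consecutive blocks of positions of sizes `a` lies immediately before the position `d`. -/
def IsCut : List ℕ → ℕ → Prop
  | [], d => d = 0
  | k :: R, d => d = 0 ∨ (k ≤ d ∧ IsCut R (d - k))

/-- The positions `p`, `q` lie in the same of the consecutive blocks of sizes `a`. -/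
def SameBlock (a : List ℕ) (p q : ℕ) : Prop := ∀ d, IsCut a d → (p < d ↔ q < d)

/-- The Young subgroup that preserves each of the consecutive blocks of sizes `a`. -/
def young (r : ℕ) (a : List ℕ) : Subgroup (Equiv.Perm (Fin r)) where
  carrier := {σ | ∀ p : Fin r, SameBlock a p (σ p)}
  one_mem' _ _ _ := Iff.rfl
  mul_mem' {σ τ} hσ hτ p d hd := (hτ p d hd).trans (hσ (τ p) d hd)
  inv_mem' {σ} hσ p d hd := by
    have := hσ (σ⁻¹ p) d hd
    rw [← Equiv.Perm.mul_apply, mul_inv_cancel] at this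
    exact this.symm

lemma isCut_zero (a : List ℕ) : IsCut a 0 := by
  cases a with
  | nil => rfl
  | cons k R => exact Or.inl rfl

lemma isCut_cons (k : ℕ) (R : List ℕ) (d : ℕ) :
    IsCut (k :: R) d ↔ d = 0 ∨ (k ≤ d ∧ IsCut R (d - k)) := Iff.rfl

lemma isCut_append (A B : List ℕ) (d : ℕ) :
    IsCut (A ++ B) d ↔ IsCut A d ∨ (A.sum ≤ d ∧ IsCut B (d - A.sum)) := by
  induction A generalizing d with
  | nil =>
    simp only [List.nil_append, IsCut, List.sum_nil, Nat.zero_le, Nat.sub_zero, true_and]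
    refine ⟨Or.inr, ?_⟩
    rintro (rfl | h)
    · exact isCut_zero B
    · exact h
  | cons k A ih =>
    simp only [List.cons_append, IsCut, ih, List.sum_cons]
    constructor
    · rintro (h | ⟨h1, h2 | h2⟩)
      · exact Or.inl (Or.inl h)
      · exact Or.inl (Or.inr ⟨h1, h2⟩)
      · exact Or.inr ⟨by omega, by rw [← Nat.sub_sub]; exact h2.2⟩
    · rintro ((h | ⟨h1, h2⟩) | ⟨h1, h2⟩)
      · exact Or.inl h
      · exact Or.inr ⟨h1, Or.inl h2⟩
      · exact Or.inr ⟨by omega, Or.inr ⟨by omega, by rw [Nat.sub_sub]; exact h2⟩⟩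

lemma isCut_sum (A : List ℕ) : IsCut A A.sum := by
  induction A with
  | nil => rfl
  | cons k A ih => exact Or.inr ⟨by simp, by simpa using ih⟩

lemma isCut_le_sum {A : List ℕ} {d : ℕ} (h : IsCut A d) : d ≤ A.sum := by
  induction A generalizing d with
  | nil => exact h.le
  | cons k A ih =>
    rcases h with h | ⟨h1, h2⟩
    · omega
    · have := ih h2
      rw [List.sum_cons]; omega

lemma isCut_erase (a : List ℕ) (d : ℕ) : IsCut (FreeWeb.erase a) d ↔ IsCut a d := by
  induction a generalizing d with
  | nil => rfl
  | cons k a ih =>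
    rcases Nat.eq_zero_or_pos k with rfl | hk
    · have : FreeWeb.erase (0 :: a) = FreeWeb.erase a := by simp [FreeWeb.erase]
      rw [this, ih, isCut_cons]
      simp only [Nat.zero_le, Nat.sub_zero, true_and]
      refine ⟨Or.inr, ?_⟩
      rintro (rfl | h)
      · exact isCut_zero a
      · exact h
    · have : FreeWeb.erase (k :: a) = k :: FreeWeb.erase a := by simp [FreeWeb.erase, hk]
      rw [this, isCut_cons, isCut_cons, ih]

lemma isCut_merge (L R : List ℕ) (k l d : ℕ) :
    IsCut (L ++ [k, l] ++ R) d ↔ IsCut (L ++ [k + l] ++ R) d ∨ d = L.sum + k := by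
  simp only [List.append_assoc, isCut_append L, List.cons_append, List.nil_append, isCut_cons]
  constructor
  · rintro (h | ⟨h, h1 | ⟨h1, h2 | h2⟩⟩)
    · exact Or.inl (Or.inl h)
    · exact Or.inl (Or.inr ⟨h, Or.inl h1⟩)
    · exact Or.inr (by omega)
    · exact Or.inl (Or.inr ⟨h, Or.inr ⟨by omega, by rw [← Nat.sub_sub]; exact h2.2⟩⟩)
  · rintro ((h | ⟨h, h1 | ⟨h1, h2⟩⟩) | h)
    · exact Or.inl h
    · exact Or.inr ⟨h, Or.inl h1⟩
    · exact Or.inr ⟨h, Or.inr ⟨by omega, Or.inr ⟨by omega, by rw [Nat.sub_sub]; exact h2⟩⟩⟩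
    · exact Or.inr ⟨by omega, Or.inr ⟨by omega, Or.inl (by omega)⟩⟩

lemma young_le_of_isCut {r : ℕ} {a b : List ℕ} (h : ∀ d, IsCut b d → IsCut a d) :
    young r a ≤ young r b := fun _ hσ p d hd => hσ p d (h d hd)

lemma young_congr {r : ℕ} {a b : List ℕ} (h : ∀ d, IsCut b d ↔ IsCut a d) :
    young r a = young r b :=
  le_antisymm (young_le_of_isCut fun d => (h d).1) (young_le_of_isCut fun d => (h d).2)

lemma SameBlock.symm {a : List ℕ} {p q : ℕ} (h : SameBlock a p q) : SameBlock a q p :=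
  fun d hd => (h d hd).symm

lemma SameBlock.refl (a : List ℕ) (p : ℕ) : SameBlock a p p := fun _ _ => Iff.rfl

lemma swap_mem_young {r : ℕ} {a : List ℕ} {p q : Fin r} (h : SameBlock a p q) :
    Equiv.swap p q ∈ young r a := by
  intro s
  rw [Equiv.swap_apply_def]
  split_ifs with h1 h2
  · rw [h1]; exact h
  · rw [h2]; exact h.symm
  · exact SameBlock.refl a s

/-- A Young subgroup is generated by the simple transpositions that it contains. -/
lemma young_le_closure (r : ℕ) (a : List ℕ) (σ : Equiv.Perm (Fin r)) (hσ : σ ∈ young r a) :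
    σ ∈ Submonoid.closure {τ | ∃ i : Fin (r - 1), SameBlock a i (i + 1) ∧ τ = Web.simpleSwap r i} := by
  -- sorting `σ` by swaps at descents increases `∑ p, p * σ p`
  have hbound : ∀ σ : Equiv.Perm (Fin r), ∑ p : Fin r, (p : ℕ) * (σ p : ℕ) ≤ r * (r * r) := by
    intro σ
    calc _ ≤ ∑ _p : Fin r, r * r := Finset.sum_le_sum fun p _ =>
          Nat.mul_le_mul p.2.le (σ p).2.le
      _ = _ := by simp
  obtain ⟨m, hm⟩ : ∃ m, m = r * (r * r) - ∑ p : Fin r, (p : ℕ) * (σ p : ℕ) := ⟨_, rfl⟩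
  induction m using Nat.strong_induction_on generalizing σ with
  | _ m ih =>
  by_cases hdesc : ∃ i : Fin (r - 1),
      σ ⟨i + 1, by omega⟩ < σ ⟨i, by omega⟩
  · obtain ⟨i, hi⟩ := hdesc
    have hsame : SameBlock a i (i + 1) := by
      intro d hd
      have h1 := hσ ⟨i, by omega⟩ d hd
      have h2 := hσ ⟨i + 1, by omega⟩ d hd
      simp only at h1 h2
      have hi' : (σ ⟨i + 1, by omega⟩ : ℕ) < σ ⟨i, by omega⟩ := hi
      omega
    have hs : Web.simpleSwap r i ∈ young r a := swap_mem_young hsame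
    have hgen : Web.simpleSwap r i ∈ Submonoid.closure
        {τ | ∃ i : Fin (r - 1), SameBlock a i (i + 1) ∧ τ = Web.simpleSwap r i} :=
      Submonoid.subset_closure ⟨i, hsame, rfl⟩
    have hsum : ∑ p : Fin r, (p : ℕ) * (σ p : ℕ) <
        ∑ p : Fin r, (p : ℕ) * ((σ * Web.simpleSwap r i) p : ℕ) := by
      have hne : (⟨i + 1, by omega⟩ : Fin r) ≠ ⟨i, by omega⟩ := by
        simp [Fin.ext_iff]
      have hmem := Finset.mem_erase.2 ⟨hne, Finset.mem_univ _⟩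
      rw [← Finset.add_sum_erase _ (fun p : Fin r => (p : ℕ) * (σ p : ℕ)) (Finset.mem_univ ⟨i, by omega⟩),
        ← Finset.add_sum_erase _ (fun p : Fin r => (p : ℕ) * (σ p : ℕ)) hmem,
        ← Finset.add_sum_erase _ (fun p : Fin r => (p : ℕ) * ((σ * Web.simpleSwap r i) p : ℕ))
          (Finset.mem_univ ⟨i, by omega⟩),
        ← Finset.add_sum_erase _ (fun p : Fin r => (p : ℕ) * ((σ * Web.simpleSwap r i) p : ℕ)) hmem]
      have hrest : ∑ p ∈ (Finset.univ.erase (⟨i, by omega⟩ : Fin r)).erase ⟨i + 1, by omega⟩,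
          (p : ℕ) * ((σ * Web.simpleSwap r i) p : ℕ) =
          ∑ p ∈ (Finset.univ.erase (⟨i, by omega⟩ : Fin r)).erase ⟨i + 1, by omega⟩,
          (p : ℕ) * (σ p : ℕ) := by
        refine Finset.sum_congr rfl fun p hp => ?_
        simp only [Finset.mem_erase, Finset.mem_univ, and_true] at hp
        rw [Equiv.Perm.mul_apply, Web.simpleSwap, Equiv.swap_apply_of_ne_of_ne hp.2 hp.1]
      rw [hrest]
      simp only [Equiv.Perm.mul_apply, Web.simpleSwap, Equiv.swap_apply_left,
        Equiv.swap_apply_right]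
      have hi' : (σ ⟨i + 1, by omega⟩ : ℕ) < σ ⟨i, by omega⟩ := hi
      nlinarith
    have := ih _ (by have := hbound (σ * Web.simpleSwap r i); omega) (σ * Web.simpleSwap r i)
      ((young r a).mul_mem hσ hs) rfl
    have h2 := Submonoid.mul_mem _ this hgen
    rwa [mul_assoc, Web.simpleSwap, Equiv.swap_mul_self, mul_one] at h2
  · have hone : σ = 1 := by
      cases r with
      | zero => exact Subsingleton.elim _ _
      | succ n =>
        have hmono : StrictMono σ := by
          refine Fin.strictMono_iff_lt_succ.2 fun i => lt_of_le_of_ne (not_lt.1 fun h => hdesc ⟨i, h⟩) ?_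
          intro h
          have := σ.injective h
          simp [Fin.ext_iff] at this
        ext p
        have := (hmono.range_inj strictMono_id).1 (by simp [σ.surjective.range_eq])
        rw [this]; rfl
    rw [hone]; exact Submonoid.one_mem _

/-! ### Webs with identity strands on both sides -/

lemma Piece.sum_top (x : Piece) : x.top.sum = x.bot.sum := by
  cases x <;> simp [Piece.top, Piece.bot]

namespace FreeWeb

lemma erase_append (a b : List ℕ) : erase (a ++ b) = erase a ++ erase b := List.filter_append ..

@[simp] lemma erase_nil : erase [] = [] := rfl

@[simp] lemma erase_zero_cons (a : List ℕ) : erase (0 :: a) = erase a := by simp [erase]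

@[simp] lemma erase_succ_cons (k : ℕ) (a : List ℕ) : erase ((k + 1) :: a) = (k + 1) :: erase a := by
  simp [erase]

lemma erase_cons_of_pos {k : ℕ} (hk : 0 < k) (a : List ℕ) : erase (k :: a) = k :: erase a := by
  simp [erase, hk]

lemma erase_erase (a : List ℕ) : erase (erase a) = erase a := by
  simp [erase, List.filter_filter]

lemma erase_eq_self {a : List ℕ} (h : ∀ x ∈ a, 0 < x) : erase a = a :=
  List.filter_eq_self.2 fun x hx => by simpa using h x hx

lemma erase_pos (a : List ℕ) : ∀ x ∈ erase a, 0 < x := fun x hx => by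
  simpa using (List.mem_filter.1 hx).2

lemma sum_erase (a : List ℕ) : (erase a).sum = a.sum := by
  induction a with
  | nil => rfl
  | cons k a ih =>
    rcases Nat.eq_zero_or_pos k with rfl | hk
    · simp [ih]
    · simp [erase_cons_of_pos hk, ih]

lemma ident_congr {r : ℕ} {a b : List ℕ} (h : erase a = erase b) :
    FreeWeb.ident r a = FreeWeb.ident r b := by
  simp only [FreeWeb.ident]
  generalize erase a = x at h ⊢
  subst h
  rfl

lemma piece_congr {r : ℕ} {L L' R R' : List ℕ} (x : Piece) (hL : erase L = erase L')
    (hR : erase R = erase R') : FreeWeb.piece r L x R = FreeWeb.piece r L' x R' := by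
  by_cases h : IsStrands r (erase L ++ x.bot ++ erase R) ∧ IsStrands r (erase L ++ x.top ++ erase R)
  · have h' := h
    rw [hL, hR] at h'
    rw [FreeWeb.piece, FreeWeb.piece, dif_pos h, dif_pos h']
    congr 2
  · have h' := h
    rw [hL, hR] at h'
    rw [FreeWeb.piece, FreeWeb.piece, dif_neg h, dif_neg h']

lemma isStrands_erase (a : List ℕ) : IsStrands a.sum (erase a) := ⟨erase_pos a, sum_erase a⟩

end FreeWeb

lemma isStrands_append {r : ℕ} {a b : List ℕ} :
    IsStrands r (a ++ b) ↔ (∀ x ∈ a, 0 < x) ∧ (∀ x ∈ b, 0 < x) ∧ a.sum + b.sum = r := by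
  simp only [IsStrands, List.mem_append, List.sum_append]
  constructor
  · rintro ⟨h, h'⟩; exact ⟨fun x hx => h x (Or.inl hx), fun x hx => h x (Or.inr hx), h'⟩
  · rintro ⟨h1, h2, h'⟩; exact ⟨fun x hx => hx.elim (h1 x) (h2 x), h'⟩

lemma IsStrands.erase_eq {r : ℕ} {a : List ℕ} (h : IsStrands r a) : FreeWeb.erase a = a :=
  FreeWeb.erase_eq_self h.1

namespace Web

open FreeWeb (erase)

variable {r : ℕ}

lemma mk_rel {x y : FreeAlgebra ℂ (WebGen r)} (h : WebRel r x y) : mk r x = mk r y :=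
  RingQuot.mkAlgHom_rel ℂ h

/-- The local web `x` with identity strands `L` to its left and `R` to its right. -/
noncomputable def piece (r : ℕ) (L : List ℕ) (x : Piece) (R : List ℕ) : Web r :=
  mk r (FreeWeb.piece r L x R)

lemma ident_congr {a b : List ℕ} (h : erase a = erase b) : ident r a = ident r b := by
  rw [ident, ident, FreeWeb.ident_congr h]

lemma ident_erase (a : List ℕ) : ident r (erase a) = ident r a :=
  ident_congr (FreeWeb.erase_erase a)

lemma piece_congr {L L' R R' : List ℕ} (x : Piece) (hL : erase L = erase L')
    (hR : erase R = erase R') : piece r L x R = piece r L' x R' := by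
  rw [piece, piece, FreeWeb.piece_congr x hL hR]

lemma merge_congr {L L' R R' : List ℕ} (k l : ℕ) (hL : erase L = erase L')
    (hR : erase R = erase R') : merge r L k l R = merge r L' k l R' := by
  rw [merge, merge, FreeWeb.merge, FreeWeb.merge, FreeWeb.piece_congr _ hL hR,
    FreeWeb.ident_congr (a := L ++ [k, l] ++ R) (b := L' ++ [k, l] ++ R')
      (by simp only [FreeWeb.erase_append, hL, hR])]

lemma split_congr {L L' R R' : List ℕ} (k l : ℕ) (hL : erase L = erase L')
    (hR : erase R = erase R') : split r L k l R = split r L' k l R' := by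
  rw [split, split, FreeWeb.split, FreeWeb.split, FreeWeb.piece_congr _ hL hR,
    FreeWeb.ident_congr (a := L ++ [k, l] ++ R) (b := L' ++ [k, l] ++ R')
      (by simp only [FreeWeb.erase_append, hL, hR])]

lemma merge_eq_piece {k l : ℕ} (hk : 0 < k) (hl : 0 < l) (L R : List ℕ) :
    merge r L k l R = piece r L (.merge k l) R := by
  rw [merge, FreeWeb.merge, if_neg (by omega), piece]

lemma split_eq_piece {k l : ℕ} (hk : 0 < k) (hl : 0 < l) (L R : List ℕ) :
    split r L k l R = piece r L (.split k l) R := by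
  rw [split, FreeWeb.split, if_neg (by omega), piece]

lemma merge_zero_right (L R : List ℕ) (k : ℕ) : merge r L k 0 R = ident r (L ++ k :: R) := by
  rw [merge, FreeWeb.merge, if_pos (Or.inr rfl)]
  exact ident_congr (by simp [erase, List.filter_cons])

lemma merge_zero_left (L R : List ℕ) (k : ℕ) : merge r L 0 k R = ident r (L ++ k :: R) := by
  rw [merge, FreeWeb.merge, if_pos (Or.inl rfl)]
  exact ident_congr (by simp [erase])

lemma split_zero_right (L R : List ℕ) (k : ℕ) : split r L k 0 R = ident r (L ++ k :: R) := by
  rw [split, FreeWeb.split, if_pos (Or.inr rfl)]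
  exact ident_congr (by simp [erase, List.filter_cons])

lemma split_zero_left (L R : List ℕ) (k : ℕ) : split r L 0 k R = ident r (L ++ k :: R) := by
  rw [split, FreeWeb.split, if_pos (Or.inl rfl)]
  exact ident_congr (by simp [erase])

lemma freeIdent_of_isStrands {a : List ℕ} (h : IsStrands r a) :
    FreeWeb.ident r a = FreeAlgebra.ι ℂ (WebGen.ident a h) := by
  have h' : IsStrands r (erase a) := by rwa [h.erase_eq]
  rw [FreeWeb.ident, dif_pos h']
  congr 2
  exact h.erase_eq

lemma freePiece_of_isStrands {L R : List ℕ} {x : Piece} (h : IsStrands r (L ++ x.bot ++ R))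
    (h' : IsStrands r (L ++ x.top ++ R)) :
    FreeWeb.piece r L x R = FreeAlgebra.ι ℂ (WebGen.piece L x R h h') := by
  have hL : erase L = L := FreeWeb.erase_eq_self fun y hy => h.1 y (by simp [hy])
  have hR : erase R = R := FreeWeb.erase_eq_self fun y hy => h.1 y (by simp [hy])
  have h2 : IsStrands r (erase L ++ x.bot ++ erase R) ∧ IsStrands r (erase L ++ x.top ++ erase R) :=
    ⟨by rwa [hL, hR], by rwa [hL, hR]⟩
  rw [FreeWeb.piece, dif_pos h2]
  congr 2

lemma piece_eq_zero {L R : List ℕ} {x : Piece} (hL : ∀ k ∈ L, 0 < k) (hR : ∀ k ∈ R, 0 < k)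
    (h : ¬ (IsStrands r (L ++ x.bot ++ R) ∧ IsStrands r (L ++ x.top ++ R))) :
    piece r L x R = 0 := by
  rw [piece, FreeWeb.piece, dif_neg, map_zero]
  rwa [FreeWeb.erase_eq_self hL, FreeWeb.erase_eq_self hR]

lemma ident_mul_ident_self (a : List ℕ) : ident r a * ident r a = ident r a := by
  by_cases h : IsStrands r (erase a)
  · have := mk_rel (WebRel.ident_mul (WebGen.ident (erase a) h))
    rw [← freeIdent_of_isStrands h, map_mul] at this
    rw [← ident_erase]
    exact this
  · have : ident r a = 0 := by rw [ident, FreeWeb.ident, dif_neg h, map_zero]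
    rw [this, mul_zero]

lemma ident_mul_ident_of_ne {a b : List ℕ} (ha : IsStrands r a) (hb : IsStrands r b) (h : a ≠ b) :
    ident r a * ident r b = 0 := by
  have := mk_rel (WebRel.compat (WebGen.ident a ha) (WebGen.ident b hb) h)
  rwa [← freeIdent_of_isStrands ha, ← freeIdent_of_isStrands hb, map_mul, map_zero] at this

lemma ident_mul_piece {L R : List ℕ} {x : Piece} (h : IsStrands r (L ++ x.top ++ R)) :
    ident r (L ++ x.top ++ R) * piece r L x R = piece r L x R := by
  by_cases h' : IsStrands r (L ++ x.bot ++ R)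
  · have := mk_rel (WebRel.ident_mul (WebGen.piece L x R h' h))
    rwa [← freePiece_of_isStrands h' h, map_mul] at this
  · rw [piece_eq_zero (fun y hy => h.1 y (by simp [hy])) (fun y hy => h.1 y (by simp [hy]))
      fun h'' => h' h''.1, mul_zero]

lemma piece_mul_ident {L R : List ℕ} {x : Piece} (h : IsStrands r (L ++ x.bot ++ R)) :
    piece r L x R * ident r (L ++ x.bot ++ R) = piece r L x R := by
  by_cases h' : IsStrands r (L ++ x.top ++ R)
  · have := mk_rel (WebRel.mul_ident (WebGen.piece L x R h h'))
    rwa [← freePiece_of_isStrands h h', map_mul] at this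
  · rw [piece_eq_zero (fun y hy => h.1 y (by simp [hy])) (fun y hy => h.1 y (by simp [hy]))
      fun h'' => h' h''.2, zero_mul]

/-- `IsLocal r p a b X` says that `X` is a web of parity `p` from `a` to `b`, which is a product of
merges, splits and dots, and that `X L R` is this web with identity strands `L` to its left and `R`
to its right. -/
inductive IsLocal (r : ℕ) : ℕ → List ℕ → List ℕ → (List ℕ → List ℕ → Web r) → Prop
  | ident (a : List ℕ) : IsLocal r 0 a a fun L R => ident r (L ++ a ++ R)
  | piece (l s : List ℕ) (x : Piece) (htop : ∀ k ∈ x.top, 0 < k) :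
      IsLocal r x.parity (l ++ x.bot ++ s) (l ++ x.top ++ s) fun L R => piece r (L ++ l) x (s ++ R)
  | comp {p q : ℕ} {a b c : List ℕ} {X Y : List ℕ → List ℕ → Web r} (hY : IsLocal r q b c Y)
      (hX : IsLocal r p a b X) : IsLocal r (p + q) a c fun L R => Y L R * X L R
  | congr {p : ℕ} {a b : List ℕ} {X X' : List ℕ → List ℕ → Web r} (hX : IsLocal r p a b X)
      (h : ∀ L R, IsStrands r (L ++ a ++ R) → X L R = X' L R) : IsLocal r p a b X'

namespace IsLocal

variable {p q : ℕ} {a b c d : List ℕ} {X Y : List ℕ → List ℕ → Web r}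

lemma isStrands (hX : IsLocal r p a b X) {L R : List ℕ} (h : IsStrands r (L ++ a ++ R)) :
    IsStrands r (L ++ b ++ R) := by
  induction hX with
  | ident => exact h
  | piece l s x htop =>
    have h2 := x.sum_top
    simp only [IsStrands, List.mem_append, List.sum_append, or_imp, forall_and] at h ⊢
    exact ⟨⟨⟨h.1.1.1, ⟨h.1.1.2.1.1, htop⟩, h.1.1.2.2⟩, h.1.2⟩, by rw [h2]; exact h.2⟩
  | comp _ _ ihY ihX => exact ihY (ihX h)
  | congr _ _ ih => exact ih h

lemma mul_ident (hX : IsLocal r p a b X) {L R : List ℕ} (h : IsStrands r (L ++ a ++ R)) :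
    X L R * Web.ident r (L ++ a ++ R) = X L R := by
  induction hX with
  | ident => exact ident_mul_ident_self _
  | piece l s x htop =>
    have e : L ++ (l ++ x.bot ++ s) ++ R = L ++ l ++ x.bot ++ (s ++ R) := by simp
    rw [e] at h ⊢
    exact piece_mul_ident h
  | comp _ _ _ ihX => rw [mul_assoc, ihX h]
  | congr _ he ih => rw [← he L R h, ih h]

lemma ident_mul (hX : IsLocal r p a b X) {L R : List ℕ} (h : IsStrands r (L ++ a ++ R)) :
    Web.ident r (L ++ b ++ R) * X L R = X L R := by
  induction hX with
  | ident => exact ident_mul_ident_self _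
  | piece l s x htop =>
    have h' := (IsLocal.piece l s x htop).isStrands h
    have e : L ++ (l ++ x.top ++ s) ++ R = L ++ l ++ x.top ++ (s ++ R) := by simp
    rw [e] at h' ⊢
    exact ident_mul_piece h'
  | comp _ hX ihY _ => rw [← mul_assoc, ihY (hX.isStrands h)]
  | congr _ he ih => rw [← he L R h, ih h]

lemma shift (hX : IsLocal r p a b X) (l s : List ℕ) :
    IsLocal r p (l ++ a ++ s) (l ++ b ++ s) fun L R => X (L ++ l) (s ++ R) := by
  induction hX with
  | ident a =>
    refine (IsLocal.ident (l ++ a ++ s)).congr fun L R _ => ?_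
    simp
  | piece l' s' x htop =>
    have := IsLocal.piece (r := r) (l ++ l') (s' ++ s) x htop
    simp only [List.append_assoc] at this ⊢
    exact this
  | comp _ _ ihY ihX => exact ihY.comp ihX
  | congr _ he ih =>
    refine ih.congr fun L R h => he _ _ ?_
    simpa using h

lemma interchange_piece (l s : List ℕ) (x : Piece) (htop : ∀ k ∈ x.top, 0 < k)
    (hY : IsLocal r q c d Y) (L M R : List ℕ)
    (h : IsStrands r (L ++ (l ++ x.bot ++ s) ++ M ++ c ++ R)) :
    Y (L ++ (l ++ x.top ++ s) ++ M) R * Web.piece r (L ++ l) x (s ++ (M ++ c ++ R)) =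
      (-1 : ℂ) ^ (x.parity * q) •
        (Web.piece r (L ++ l) x (s ++ (M ++ d ++ R)) * Y (L ++ (l ++ x.bot ++ s) ++ M) R) := by
  have key : ∀ c : List ℕ, IsStrands r (L ++ (l ++ x.bot ++ s) ++ M ++ c ++ R) →
      IsStrands r (L ++ (l ++ x.top ++ s) ++ M ++ c ++ R) := fun c h => by
    have := (IsLocal.piece l s x htop).isStrands (r := r) (L := L) (R := M ++ c ++ R) (by simpa using h)
    simpa using this
  induction hY with
  | ident a =>
    have h1 := (IsLocal.piece (r := r) l s x htop).ident_mul (L := L) (R := M ++ a ++ R)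
      (by simpa using h)
    have h2 := (IsLocal.piece (r := r) l s x htop).mul_ident (L := L) (R := M ++ a ++ R)
      (by simpa using h)
    simp only [List.append_assoc] at h1 h2 ⊢
    rw [h1, h2]; simp
  | piece l' s' y htop' =>
    have := mk_rel (WebRel.superinterchange (r := r) (L ++ l) x (s ++ M ++ l') y (s' ++ R)
      (by simpa using h))
    rw [map_mul, map_smul, map_mul] at this
    simpa only [List.append_assoc, Web.piece] using this
  | comp hY hX ihY ihX =>
    have h' := hX.isStrands h
    rw [mul_assoc, ihX h, mul_smul_comm, ← mul_assoc, ihY h', smul_mul_assoc, smul_smul, mul_assoc,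
      mul_add, pow_add]
  | congr hX he ih =>
    rw [← he _ _ h, ← he _ _ (key _ h), ih h]

/-- The super interchange law: webs with disjoint supports supercommute. -/
theorem interchange (hX : IsLocal r p a b X) (hY : IsLocal r q c d Y) (L M R : List ℕ)
    (h : IsStrands r (L ++ a ++ M ++ c ++ R)) :
    Y (L ++ b ++ M) R * X L (M ++ c ++ R) =
      (-1 : ℂ) ^ (p * q) • (X L (M ++ d ++ R) * Y (L ++ a ++ M) R) := by
  induction hX with
  | ident a =>
    have h1 := hY.ident_mul (L := L ++ a ++ M) (R := R) h
    have h2 := hY.mul_ident (L := L ++ a ++ M) (R := R) h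
    simp only [List.append_assoc] at h1 h2 ⊢
    rw [h1, h2]; simp
  | piece l s x htop => exact interchange_piece l s x htop hY L M R h
  | comp hY' hX ihY ihX =>
    have h' := hX.isStrands (L := L) (R := M ++ c ++ R) (by simpa using h)
    rw [← mul_assoc, ihY (by simpa using h'), smul_mul_assoc, mul_assoc, ihX h, mul_smul_comm,
      smul_smul, mul_assoc, add_mul, add_comm, pow_add]
  | congr hX he ih =>
    have h' := hY.isStrands h
    rw [← he _ _ (by simpa using h), ← he _ _ (by simpa using h'), ih h]

/-- The interchange law if one of the webs is even. -/
theorem interchange_even (hX : IsLocal r p a b X) (hY : IsLocal r q c d Y) (L M R : List ℕ)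
    (hpq : p * q = 0) (h : IsStrands r (L ++ a ++ M ++ c ++ R)) :
    Y (L ++ b ++ M) R * X L (M ++ c ++ R) = X L (M ++ d ++ R) * Y (L ++ a ++ M) R := by
  rw [hX.interchange hY L M R h, hpq, pow_zero, one_smul]

end IsLocal

lemma isLocal_merge {k l : ℕ} (hk : 0 < k) (hl : 0 < l) :
    IsLocal r 0 [k, l] [k + l] fun L R => merge r L k l R := by
  have := IsLocal.piece (r := r) [] [] (.merge k l) (by simp [Piece.top]; omega)
  refine IsLocal.congr this fun L R _ => ?_
  rw [merge_eq_piece hk hl]; simp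

lemma isLocal_split {k l : ℕ} (hk : 0 < k) (hl : 0 < l) :
    IsLocal r 0 [k + l] [k, l] fun L R => split r L k l R := by
  have := IsLocal.piece (r := r) [] [] (.split k l) (by simp [Piece.top]; omega)
  refine IsLocal.congr this fun L R _ => ?_
  rw [split_eq_piece hk hl]; simp

lemma isLocal_dot {k : ℕ} (hk : 0 < k) : IsLocal r 1 [k] [k] fun L R => dot r L k R := by
  have := IsLocal.piece (r := r) [] [] (.dot k) (by simp [Piece.top]; omega)
  refine IsLocal.congr this fun L R _ => ?_
  simp [dot, piece, FreeWeb.dot]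

/-! ### Complete merges and splits -/

lemma isLocal_merge_one (k : ℕ) :
    IsLocal r 0 (1 :: erase [k]) [1 + k] fun L R => merge r L 1 k R := by
  rcases Nat.eq_zero_or_pos k with rfl | hk
  · refine IsLocal.congr (IsLocal.ident [1]) fun L R _ => ?_
    rw [merge_zero_right]; simp
  · rw [FreeWeb.erase_cons_of_pos hk]
    exact isLocal_merge one_pos hk

lemma isLocal_split_one (k : ℕ) :
    IsLocal r 0 [1 + k] (1 :: erase [k]) fun L R => split r L 1 k R := by
  rcases Nat.eq_zero_or_pos k with rfl | hk
  · refine IsLocal.congr (IsLocal.ident [1]) fun L R _ => ?_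
    rw [split_zero_right]; simp
  · rw [FreeWeb.erase_cons_of_pos hk]
    exact isLocal_split one_pos hk

lemma isLocal_mergeStrand (k : ℕ) :
    IsLocal r 0 (List.replicate k 1) (erase [k]) fun L R => mergeStrand r L k R := by
  induction k with
  | zero =>
    refine IsLocal.congr (IsLocal.ident []) fun L R _ => ?_
    simp [mergeStrand]
  | succ k ih =>
    have h1 := ih.shift [1] []
    have h2 := (isLocal_merge_one (r := r) k).comp (by simpa using h1)
    rw [add_comm 1 k] at h2
    simpa [mergeStrand, List.replicate_succ] using h2

lemma isLocal_splitStrand (k : ℕ) :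
    IsLocal r 0 (erase [k]) (List.replicate k 1) fun L R => splitStrand r L k R := by
  induction k with
  | zero =>
    refine IsLocal.congr (IsLocal.ident []) fun L R _ => ?_
    simp [splitStrand]
  | succ k ih =>
    have h1 := ih.shift [1] []
    have h2 := IsLocal.comp (by simpa using h1) (isLocal_split_one (r := r) k)
    rw [add_comm 1 k] at h2
    simpa [splitStrand, List.replicate_succ] using h2

lemma mergeStrand_congr {L L' R R' : List ℕ} (k : ℕ) (hL : erase L = erase L')
    (hR : erase R = erase R') : mergeStrand r L k R = mergeStrand r L' k R' := by
  induction k generalizing L L' with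
  | zero => exact ident_congr (by simp [FreeWeb.erase_append, hL, hR])
  | succ k ih =>
    rw [mergeStrand, mergeStrand, merge_congr 1 k hL hR, ih]
    simp [FreeWeb.erase_append, hL]

lemma splitStrand_congr {L L' R R' : List ℕ} (k : ℕ) (hL : erase L = erase L')
    (hR : erase R = erase R') : splitStrand r L k R = splitStrand r L' k R' := by
  induction k generalizing L L' with
  | zero => exact ident_congr (by simp [FreeWeb.erase_append, hL, hR])
  | succ k ih =>
    rw [splitStrand, splitStrand, split_congr 1 k hL hR, ih]
    simp [FreeWeb.erase_append, hL]

lemma merge_mul_split {L R : List ℕ} {k l : ℕ} (h : IsStrands r (L ++ k :: l :: R)) :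
    merge r L k l R * split r L k l R = ((k + l).choose l : ℂ) • ident r (L ++ (k + l) :: R) := by
  have := mk_rel (WebRel.digon L k l R (by simpa using h))
  rw [map_mul, map_smul] at this
  simpa [List.append_assoc, merge, split, ident] using this

lemma merge_one_mul_split_one {L R : List ℕ} {k : ℕ} (hL : ∀ x ∈ L, 0 < x) (hR : ∀ x ∈ R, 0 < x)
    (h : L.sum + (k + 1) + R.sum = r) :
    merge r L 1 k R * split r L 1 k R = ((k + 1 : ℕ) : ℂ) • ident r (L ++ (k + 1) :: R) := by
  rcases Nat.eq_zero_or_pos k with rfl | hk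
  · rw [merge_zero_right, split_zero_right, ident_mul_ident_self]; simp
  · rw [merge_mul_split, add_comm 1 k, Nat.choose_succ_self_right]
    rw [isStrands_append]
    refine ⟨hL, ?_, by simp; omega⟩
    simp only [List.mem_cons]
    rintro x (rfl | rfl | hx)
    · exact one_pos
    · exact hk
    · exact hR x hx

lemma mergeStrand_mul_splitStrand {L R : List ℕ} {k : ℕ}
    (h : IsStrands r (L ++ List.replicate k 1 ++ R)) :
    mergeStrand r L k R * splitStrand r L k R = (k.factorial : ℂ) • ident r (L ++ k :: R) := by
  induction k generalizing L with
  | zero =>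
    rw [mergeStrand, splitStrand, ident_mul_ident_self]
    simp [ident_congr (r := r) (a := L ++ R) (b := L ++ 0 :: R) (by simp [FreeWeb.erase_append])]
  | succ k ih =>
    have h' : IsStrands r (L ++ [1] ++ List.replicate k 1 ++ R) := by
      simpa [List.replicate_succ] using h
    have h2 := isStrands_append.1 (by simpa using h : IsStrands r (L ++ (List.replicate (k + 1) 1 ++ R)))
    have h3 := (isLocal_mergeStrand k).isStrands h'
    have h4 := (isLocal_merge_one k).mul_ident (r := r) (L := L) (R := R) (by simpa using h3)
    rw [mergeStrand, splitStrand, mul_assoc, ← mul_assoc (mergeStrand r (L ++ [1]) k R), ih h',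
      smul_mul_assoc, mul_smul_comm, ← mul_assoc, ident_congr (a := L ++ [1] ++ k :: R)
      (b := L ++ 1 :: erase [k] ++ R)
      (by rcases Nat.eq_zero_or_pos k with rfl | hk <;> simp [erase, *]), h4, merge_one_mul_split_one h2.1
      (fun x hx => h2.2.1 x (by simp [hx])) (by simpa [add_assoc] using h2.2.2), smul_smul, Nat.factorial_succ]
    congr 1
    push_cast
    ring

/-- Merging two completely merged strands completes the merge. -/
lemma merge_mul_mergeStrand_mul_mergeStrand {L R : List ℕ} {k l : ℕ} (hk : 0 < k) (hl : 0 < l)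
    (h : IsStrands r (L ++ List.replicate (k + l) 1 ++ R)) :
    merge r L k l R * (mergeStrand r L k (l :: R) * mergeStrand r (L ++ List.replicate k 1) l R) =
      mergeStrand r L (k + l) R := by
  induction k, hk using Nat.le_induction generalizing L with
  | base =>
    have h1 : IsStrands r (L ++ [1] ++ List.replicate l 1 ++ R) := by
      simpa [List.replicate_add] using h
    have h2 := (isLocal_mergeStrand l).ident_mul h1
    rw [FreeWeb.erase_cons_of_pos hl] at h2
    simp only [List.append_assoc, FreeWeb.erase_nil, List.cons_append, List.nil_append] at h2
    rw [add_comm 1 l]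
    simp only [mergeStrand, merge_zero_right, List.append_assoc, List.replicate_one,
      List.cons_append, List.nil_append]
    rw [ident_mul_ident_self, h2]
  | succ k hk ih =>
    have h1 : IsStrands r (L ++ [1] ++ List.replicate (k + l) 1 ++ R) := by
      simpa [List.replicate_succ, Nat.succ_add, add_right_comm] using h
    have ih := ih h1
    have h3 := (isLocal_mergeStrand (k + l)).isStrands h1
    rw [FreeWeb.erase_cons_of_pos (by omega)] at h3
    have h4 : IsStrands r (L ++ [1, k, l] ++ R) := by
      simp only [IsStrands, List.mem_append, List.sum_append, or_imp, forall_and] at h3 ⊢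
      refine ⟨⟨⟨h3.1.1.1.1, ?_⟩, h3.1.2⟩, ?_⟩
      · simp; omega
      · have := h3.2; simp at this ⊢; omega
    have h5 := mk_rel (WebRel.assoc_merge L 1 k l R h4)
    rw [map_mul, map_mul] at h5
    have e1 : mergeStrand r L (k + l + 1) R =
      merge r L 1 (k + l) R * mergeStrand r (L ++ [1]) (k + l) R := rfl
    rw [show k + 1 + l = (k + l) + 1 by omega, e1, ← ih, mergeStrand,
      show L ++ List.replicate (k + 1) 1 = L ++ [1] ++ List.replicate k 1 by
        simp [List.replicate_succ], add_comm k 1]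
    simp only [← mul_assoc]
    congr 2

/-- A split followed by complete splits of both strands is a complete split. -/
lemma splitStrand_mul_splitStrand_mul_split {L R : List ℕ} {k l : ℕ} (hk : 0 < k) (hl : 0 < l)
    (h : IsStrands r (L ++ [k + l] ++ R)) :
    splitStrand r (L ++ List.replicate k 1) l R * splitStrand r L k (l :: R) * split r L k l R =
      splitStrand r L (k + l) R := by
  induction k, hk using Nat.le_induction generalizing L with
  | base =>
    have h2 := (isLocal_split (r := r) one_pos hl).ident_mul h
    simp only [List.append_assoc, List.cons_append, List.nil_append] at h2
    rw [add_comm 1 l]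
    simp only [splitStrand, split_zero_right, List.append_assoc, List.replicate_one,
      List.cons_append, List.nil_append, Nat.succ_eq_add_one, zero_add]
    rw [ident_mul_ident_self, mul_assoc, h2]
  | succ k hk ih =>
    have h1 : IsStrands r (L ++ [1] ++ [k + l] ++ R) := by
      have := (isLocal_split (r := r) one_pos (by omega : 0 < k + l)).isStrands (L := L) (R := R)
        (by simpa [add_comm, add_left_comm, add_assoc] using h)
      simpa using this
    have ih := ih h1
    have h4 : IsStrands r (L ++ [1, k, l] ++ R) := by
      simp only [IsStrands, List.mem_append, List.sum_append, or_imp, forall_and] at h1 ⊢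
      refine ⟨⟨⟨h1.1.1.1.1, ?_⟩, h1.1.2⟩, ?_⟩
      · simp; omega
      · have := h1.2; simp at this ⊢; omega
    have h5 := mk_rel (WebRel.assoc_split L 1 k l R h4)
    rw [map_mul, map_mul] at h5
    have e1 : splitStrand r L (k + l + 1) R =
      splitStrand r (L ++ [1]) (k + l) R * split r L 1 (k + l) R := rfl
    rw [show k + 1 + l = (k + l) + 1 by omega, e1, ← ih, splitStrand,
      show L ++ List.replicate (k + 1) 1 = L ++ [1] ++ List.replicate k 1 by
        simp [List.replicate_succ], add_comm k 1]
    simp only [mul_assoc]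
    congr 2
    exact h5.symm

/-- The local web `merge` followed by `split` on two adjacent `1`-strands. -/
noncomputable def dumbbell (r : ℕ) (L R : List ℕ) : Web r := split r L 1 1 R * merge r L 1 1 R

lemma isLocal_dumbbell : IsLocal r 0 [1, 1] [1, 1] fun L R => dumbbell r L R :=
  (isLocal_split one_pos one_pos).comp (isLocal_merge one_pos one_pos)

lemma dumbbell_congr {L L' R R' : List ℕ} (hL : erase L = erase L') (hR : erase R = erase R') :
    dumbbell r L R = dumbbell r L' R' := by
  rw [dumbbell, dumbbell, split_congr 1 1 hL hR, merge_congr 1 1 hL hR]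

lemma dumbbell_mul_dumbbell {L R : List ℕ} (h : IsStrands r (L ++ [1, 1] ++ R)) :
    dumbbell r L R * dumbbell r L R = (2 : ℂ) • dumbbell r L R := by
  have h2 := merge_mul_split (r := r) (L := L) (R := R) (k := 1) (l := 1) (by simpa using h)
  have h3 := (isLocal_merge (r := r) one_pos one_pos).ident_mul h
  simp only [List.append_assoc, List.cons_append, List.nil_append] at h3
  rw [dumbbell, mul_assoc, ← mul_assoc (merge r L 1 1 R), h2, smul_mul_assoc, h3, mul_smul_comm]
  norm_num

lemma merge_mul_dumbbell {L R : List ℕ} (h : IsStrands r (L ++ [1, 1] ++ R)) :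
    merge r L 1 1 R * dumbbell r L R = (2 : ℂ) • merge r L 1 1 R := by
  have h2 := merge_mul_split (r := r) (L := L) (R := R) (k := 1) (l := 1) (by simpa using h)
  have h3 := (isLocal_merge (r := r) one_pos one_pos).ident_mul h
  simp only [List.append_assoc, List.cons_append, List.nil_append] at h3
  rw [dumbbell, ← mul_assoc, h2, smul_mul_assoc, h3]
  norm_num

lemma dumbbell_mul_split {L R : List ℕ} (h : IsStrands r (L ++ [1, 1] ++ R)) :
    dumbbell r L R * split r L 1 1 R = (2 : ℂ) • split r L 1 1 R := by
  have h2 := merge_mul_split (r := r) (L := L) (R := R) (k := 1) (l := 1) (by simpa using h)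
  have h4 : IsStrands r (L ++ [1 + 1] ++ R) := (isLocal_merge (r := r) one_pos one_pos).isStrands h
  have h3 := (isLocal_split (r := r) one_pos one_pos).mul_ident h4
  simp only [List.append_assoc, List.cons_append, List.nil_append] at h3
  rw [dumbbell, mul_assoc, h2, mul_smul_comm, h3]
  norm_num

/-- The square switch relation on strands `1`, `l + 1`. -/
lemma split_one_mul_merge_one {L R : List ℕ} {l : ℕ} (h : IsStrands r (L ++ 1 :: (l + 1) :: R)) :
    split r L 1 (l + 1) R * merge r L 1 (l + 1) R = ident r (L ++ 1 :: (l + 1) :: R) +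
      merge r (L ++ [1]) 1 l R * (dumbbell r L (l :: R) - ident r (L ++ 1 :: 1 :: l :: R)) *
        split r (L ++ [1]) 1 l R := by
  have h1 := mk_rel (WebRel.square_switch L 0 l R (by simpa using h))
  simp only [map_mul, map_sub, map_smul, FreeWeb.rungL, FreeWeb.rungR] at h1
  change merge r L 0 1 ((l + 1) :: R) * split r (L ++ [0]) 1 (l + 1) R *
      (merge r (L ++ [0]) 1 (l + 1) R * split r L 0 1 ((l + 1) :: R)) -
    merge r (L ++ [1]) 1 l R * split r L 1 1 (l :: R) *
      (merge r L 1 1 (l :: R) * split r (L ++ [1]) 1 l R) =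
    (((0 : ℕ) : ℂ) - (l : ℂ)) • ident r (L ++ [0 + 1, l + 1] ++ R) at h1
  have h' : IsStrands r (L ++ [1, l + 1] ++ R) := by simpa using h
  have h2 := (isLocal_split (r := r) one_pos (Nat.succ_pos l)).ident_mul
    ((isLocal_merge (r := r) one_pos (Nat.succ_pos l)).isStrands h')
  have h3 := (isLocal_merge (r := r) one_pos (Nat.succ_pos l)).mul_ident h'
  have h4 : erase (L ++ [0]) = erase L := by simp [erase]
  have hpos := isStrands_append.1 h
  have h5 := merge_one_mul_split_one (r := r) (L := L ++ [1]) (R := R) (k := l)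
    (by intro x hx; rcases List.mem_append.1 hx with hx | hx
        · exact hpos.1 x hx
        · simp at hx; omega)
    (fun x hx => hpos.2.1 x (by simp [hx])) (by have := hpos.2.2; simp at this ⊢; omega)
  rw [merge_zero_left, split_zero_left, split_congr 1 (l + 1) h4 rfl,
    merge_congr 1 (l + 1) h4 rfl] at h1
  simp only [List.append_assoc, List.cons_append, List.nil_append, Nat.succ_eq_add_one,
    zero_add] at h1 h2 h3 h5 ⊢
  rw [h2, h3] at h1
  have h6 := (isLocal_split_one (r := r) l).shift [1] []
  have h7 : ident r (L ++ 1 :: 1 :: l :: R) * split r (L ++ [1]) 1 l R = split r (L ++ [1]) 1 l R := by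
    have := h6.ident_mul (L := L) (R := R) (by simpa [add_comm 1 l] using h)
    rw [ident_congr (b := L ++ ([1] ++ 1 :: erase [l] ++ []) ++ R)]
    · simpa using this
    · rcases Nat.eq_zero_or_pos l with rfl | hl <;> simp [erase, *]
  rw [mul_sub, sub_mul, mul_assoc _ _ (split r (L ++ [1]) 1 l R), mul_assoc _ _ (split r (L ++ [1]) 1 l R), h7, h5]
  rw [sub_eq_iff_eq_add] at h1
  rw [h1, dumbbell]
  simp only [mul_assoc]
  rw [← sub_eq_zero]
  push_cast
  module

lemma merge_mul_merge_one_one {L R : List ℕ} {k : ℕ} (h : IsStrands r (L ++ [1, 1] ++ erase [k] ++ R)) :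
    merge r L 1 (1 + k) R * merge r (L ++ [1]) 1 k R =
      merge r L (1 + 1) k R * merge r L 1 1 (k :: R) := by
  rcases Nat.eq_zero_or_pos k with rfl | hk
  · have h' : IsStrands r (L ++ [1, 1] ++ R) := by simpa using h
    have h1 := (isLocal_merge (r := r) one_pos one_pos).mul_ident h'
    have h2 := (isLocal_merge (r := r) one_pos one_pos).ident_mul h'
    rw [merge_zero_right, merge_zero_right, merge_congr 1 1 (L := L) (L' := L) (R := 0 :: R) (R' := R) rfl (by simp)]
    simp only [List.append_assoc, List.cons_append, List.nil_append, add_zero] at h1 h2 ⊢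
    rw [h1, h2]
  · have := mk_rel (WebRel.assoc_merge L 1 1 k R (by simpa [FreeWeb.erase_cons_of_pos hk] using h))
    rw [map_mul, map_mul] at this
    exact this.symm

lemma split_mul_split_one_one {L R : List ℕ} {k : ℕ} (h : IsStrands r (L ++ [1, 1] ++ erase [k] ++ R)) :
    split r (L ++ [1]) 1 k R * split r L 1 (1 + k) R =
      split r L 1 1 (k :: R) * split r L (1 + 1) k R := by
  rcases Nat.eq_zero_or_pos k with rfl | hk
  · have h' : IsStrands r (L ++ [1, 1] ++ R) := by simpa using h
    have h'' : IsStrands r (L ++ [1 + 1] ++ R) := (isLocal_merge one_pos one_pos).isStrands h'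
    have h1 := (isLocal_split (r := r) one_pos one_pos).mul_ident h''
    have h2 := (isLocal_split (r := r) one_pos one_pos).ident_mul h''
    rw [split_zero_right, split_zero_right, split_congr 1 1 (L := L) (L' := L) (R := 0 :: R) (R' := R) rfl (by simp)]
    simp only [List.append_assoc, List.cons_append, List.nil_append, add_zero] at h1 h2 ⊢
    rw [h1, h2]
  · have := mk_rel (WebRel.assoc_split L 1 1 k R (by simpa [FreeWeb.erase_cons_of_pos hk] using h))
    rw [map_mul, map_mul] at this
    exact this

end Web

namespace Web

open FreeWeb (erase)

variable {r : ℕ}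

/-! ### Sergeev diagrams -/

/-- The reflected square switch relation on strands `2`, `1`. -/
lemma split_two_one_mul_merge_two_one {L R : List ℕ} (h : IsStrands r (L ++ [1, 1, 1] ++ R)) :
    split r L (1 + 1) 1 R * merge r L (1 + 1) 1 R = ident r (L ++ (1 + 1) :: 1 :: R) +
      merge r L 1 1 (1 :: R) * (dumbbell r (L ++ [1]) R - ident r (L ++ 1 :: 1 :: 1 :: R)) *
        split r L 1 1 (1 :: R) := by
  have h' : IsStrands r (L ++ [1 + 1, 1] ++ R) := by
    have := (isLocal_merge (r := r) one_pos one_pos).isStrands (L := L) (R := 1 :: R)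
      (by simpa using h)
    simpa using this
  have h1 := mk_rel (WebRel.square_switch L 1 0 R h')
  simp only [map_mul, map_sub, map_smul, FreeWeb.rungL, FreeWeb.rungR] at h1
  change merge r L 1 1 (1 :: R) * split r (L ++ [1]) 1 1 R *
      (merge r (L ++ [1]) 1 1 R * split r L 1 1 (1 :: R)) -
    merge r (L ++ [2]) 1 0 R * split r L (1 + 1) 1 (0 :: R) *
      (merge r L (1 + 1) 1 (0 :: R) * split r (L ++ [2]) 1 0 R) =
    (((1 : ℕ) : ℂ) - ((0 : ℕ) : ℂ)) • ident r (L ++ [1 + 1, 0 + 1] ++ R) at h1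
  have h2 := (isLocal_merge (r := r) (k := 1 + 1) two_pos one_pos).mul_ident h'
  have h3 := (isLocal_split (r := r) (k := 1 + 1) two_pos one_pos).ident_mul (L := L) (R := R)
    ((isLocal_merge (r := r) (k := 1 + 1) two_pos one_pos).isStrands h')
  have h5 := merge_mul_split (r := r) (L := L) (R := 1 :: R) (k := 1) (l := 1) (by simpa using h)
  have h6 := (isLocal_split (r := r) one_pos one_pos).ident_mul (L := L) (R := 1 :: R)
    (by simpa using h')
  rw [merge_zero_right, split_zero_right, split_congr (1 + 1) 1 (L := L) (L' := L) (R := 0 :: R)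
    (R' := R) rfl (by simp), merge_congr (1 + 1) 1 (L := L) (L' := L) (R := 0 :: R) (R' := R) rfl
    (by simp)] at h1
  simp only [List.append_assoc, List.cons_append, List.nil_append, one_add_one_eq_two, zero_add]
    at h1 h2 h3 h5 h6 ⊢
  rw [h2, h3] at h1
  rw [mul_sub, sub_mul, mul_assoc _ (ident r _) (split r L 1 1 (1 :: R)), h6, h5]
  rw [sub_eq_iff_eq_add] at h1
  have h7 : merge r L 1 1 (1 :: R) * dumbbell r (L ++ [1]) R * split r L 1 1 (1 :: R) =
      merge r L 1 1 (1 :: R) * split r (L ++ [1]) 1 1 R *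
        (merge r (L ++ [1]) 1 1 R * split r L 1 1 (1 :: R)) := by
    rw [dumbbell]; simp only [mul_assoc]
  rw [h7, h1]
  norm_num
  module

/-- The braid relation, in terms of the dumbbells. -/
lemma dumbbell_braid {L R : List ℕ} (h : IsStrands r (L ++ [1, 1, 1] ++ R)) :
    dumbbell r L (1 :: R) * dumbbell r (L ++ [1]) R * dumbbell r L (1 :: R) - dumbbell r L (1 :: R) =
      dumbbell r (L ++ [1]) R * dumbbell r L (1 :: R) * dumbbell r (L ++ [1]) R -
        dumbbell r (L ++ [1]) R := by
  have hl : IsStrands r (L ++ [1, 1] ++ (1 :: R)) := by simpa using h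
  have hr : IsStrands r ((L ++ [1]) ++ [1, 1] ++ R) := by simpa using h
  have hr2 : IsStrands r (L ++ 1 :: (1 + 1) :: R) := by
    have := (isLocal_merge (r := r) one_pos one_pos).isStrands hr
    simpa using this
  have hl2 : IsStrands r (L ++ [1 + 1] ++ (1 :: R)) :=
    (isLocal_merge (r := r) one_pos one_pos).isStrands hl
  have e1 := split_one_mul_merge_one hr2
  have e2 := split_two_one_mul_merge_two_one h
  have a1 := mk_rel (WebRel.assoc_merge L 1 1 1 R h)
  have a2 := mk_rel (WebRel.assoc_split L 1 1 1 R h)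
  rw [map_mul, map_mul] at a1 a2
  change merge r L (1 + 1) 1 R * merge r L 1 1 (1 :: R) =
    merge r L 1 (1 + 1) R * merge r (L ++ [1]) 1 1 R at a1
  change split r (L ++ [1]) 1 1 R * split r L 1 (1 + 1) R =
    split r L 1 1 (1 :: R) * split r L (1 + 1) 1 R at a2
  have x1 := (isLocal_dumbbell (r := r)).mul_ident hl
  have x2 := (isLocal_dumbbell (r := r)).mul_ident hr
  have s1 := (isLocal_split (r := r) one_pos one_pos).mul_ident hl2
  have s2 := (isLocal_split (r := r) one_pos one_pos).mul_ident (L := L ++ [1]) (R := R)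
    (by simpa using hr2)
  simp only [List.append_assoc, List.cons_append, List.nil_append] at x1 x2 s1 s2
  have d1 := dumbbell_mul_dumbbell hl
  have d2 := dumbbell_mul_dumbbell hr
  have key : split r (L ++ [1]) 1 1 R * (split r L 1 (1 + 1) R * merge r L 1 (1 + 1) R) *
      merge r (L ++ [1]) 1 1 R = split r L 1 1 (1 :: R) *
      (split r L (1 + 1) 1 R * merge r L (1 + 1) 1 R) * merge r L 1 1 (1 :: R) := by
    calc _ = (split r (L ++ [1]) 1 1 R * split r L 1 (1 + 1) R) *
          (merge r L 1 (1 + 1) R * merge r (L ++ [1]) 1 1 R) := by simp only [mul_assoc]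
      _ = _ := by rw [a2, ← a1]; simp only [mul_assoc]
  have k1 : split r (L ++ [1]) 1 1 R * (split r L 1 (1 + 1) R * merge r L 1 (1 + 1) R) *
      merge r (L ++ [1]) 1 1 R = dumbbell r (L ++ [1]) R +
        (dumbbell r (L ++ [1]) R * dumbbell r L (1 :: R) * dumbbell r (L ++ [1]) R -
        (2 : ℂ) • dumbbell r (L ++ [1]) R) := by
    rw [e1, mul_add, add_mul, s2, ← d2]
    congr 1
    calc _ = dumbbell r (L ++ [1]) R * (dumbbell r L (1 :: R) - ident r (L ++ 1 :: 1 :: 1 :: R)) *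
          dumbbell r (L ++ [1]) R := by
          rw [dumbbell, dumbbell]; simp only [mul_assoc]
      _ = _ := by rw [mul_sub, sub_mul, x2]
  have k2 : split r L 1 1 (1 :: R) *
      (split r L (1 + 1) 1 R * merge r L (1 + 1) 1 R) * merge r L 1 1 (1 :: R) =
      dumbbell r L (1 :: R) +
        (dumbbell r L (1 :: R) * dumbbell r (L ++ [1]) R * dumbbell r L (1 :: R) -
        (2 : ℂ) • dumbbell r L (1 :: R)) := by
    rw [e2, mul_add, add_mul, s1, ← d1]
    congr 1
    calc _ = dumbbell r L (1 :: R) * (dumbbell r (L ++ [1]) R - ident r (L ++ 1 :: 1 :: 1 :: R)) *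
          dumbbell r L (1 :: R) := by
          rw [dumbbell, dumbbell]; simp only [mul_assoc]
      _ = _ := by rw [mul_sub, sub_mul, x1]
  rw [k1, k2] at key
  rw [← sub_eq_zero] at key ⊢
  rw [← neg_eq_zero, ← key]
  module

lemma dot_congr {L L' R R' : List ℕ} (k : ℕ) (hL : erase L = erase L') (hR : erase R = erase R') :
    dot r L k R = dot r L' k R' := piece_congr _ hL hR

lemma dot_mul_dumbbell {L R : List ℕ} (h : IsStrands r (L ++ [1, 1] ++ R)) :
    dot r L 1 (1 :: R) * dumbbell r L R - dumbbell r L R * dot r (L ++ [1]) 1 R =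
      dot r L 1 (1 :: R) - dot r (L ++ [1]) 1 R := by
  have h1 := mk_rel (WebRel.square_switch_dot_top L 0 0 R h)
  simp only [map_mul, map_sub, FreeWeb.rungLDot, FreeWeb.rungR] at h1
  change merge r L 0 1 (1 :: R) * dot r (L ++ [0]) 1 (1 :: R) * split r (L ++ [0]) 1 1 R *
      (merge r (L ++ [0]) 1 1 R * split r L 0 1 (1 :: R)) -
    merge r (L ++ [1]) 1 0 R * split r L 1 1 (0 :: R) *
      (merge r L 1 1 (0 :: R) * dot r (L ++ [1]) 1 (0 :: R) * split r (L ++ [1]) 1 0 R) =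
    dot r L 1 (1 :: R) - dot r (L ++ [1]) 1 R at h1
  have h4 : erase (L ++ [0]) = erase L := by simp [erase]
  have h5 : erase (0 :: R) = erase R := by simp
  have d1 := (isLocal_dot (r := r) one_pos).ident_mul (L := L) (R := 1 :: R) (by simpa using h)
  have d2 := (isLocal_dot (r := r) one_pos).mul_ident (L := L ++ [1]) (R := R) (by simpa using h)
  have m1 := (isLocal_merge (r := r) one_pos one_pos).mul_ident h
  have s1 := (isLocal_split (r := r) one_pos one_pos).ident_mul
    ((isLocal_merge (r := r) one_pos one_pos).isStrands h)
  rw [merge_zero_left, split_zero_left, merge_zero_right, split_zero_right, dot_congr 1 h4 rfl,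
    split_congr 1 1 h4 rfl, merge_congr 1 1 h4 rfl, split_congr 1 1 rfl h5, merge_congr 1 1 rfl h5,
    dot_congr 1 rfl h5] at h1
  simp only [List.append_assoc, List.cons_append, List.nil_append] at h1 d1 d2 m1 s1
  rw [d1, m1, s1, mul_assoc (merge r L 1 1 R), d2] at h1
  rw [dumbbell, ← h1]
  simp only [mul_assoc]

lemma dumbbell_mul_dot {L R : List ℕ} (h : IsStrands r (L ++ [1, 1] ++ R)) :
    dumbbell r L R * dot r L 1 (1 :: R) - dot r (L ++ [1]) 1 R * dumbbell r L R =
      dot r L 1 (1 :: R) - dot r (L ++ [1]) 1 R := by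
  have h1 := mk_rel (WebRel.square_switch_dot_bot L 0 0 R h)
  simp only [map_mul, map_sub, FreeWeb.rungL, FreeWeb.rungRDot] at h1
  change merge r L 0 1 (1 :: R) * split r (L ++ [0]) 1 1 R *
      (merge r (L ++ [0]) 1 1 R * dot r (L ++ [0]) 1 (1 :: R) * split r L 0 1 (1 :: R)) -
    merge r (L ++ [1]) 1 0 R * dot r (L ++ [1]) 1 (0 :: R) * split r L 1 1 (0 :: R) *
      (merge r L 1 1 (0 :: R) * split r (L ++ [1]) 1 0 R) =
    dot r L 1 (1 :: R) - dot r (L ++ [1]) 1 R at h1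
  have h4 : erase (L ++ [0]) = erase L := by simp [erase]
  have h5 : erase (0 :: R) = erase R := by simp
  have d1 := (isLocal_dot (r := r) one_pos).mul_ident (L := L) (R := 1 :: R) (by simpa using h)
  have d2 := (isLocal_dot (r := r) one_pos).ident_mul (L := L ++ [1]) (R := R) (by simpa using h)
  have m1 := (isLocal_merge (r := r) one_pos one_pos).mul_ident h
  have s1 := (isLocal_split (r := r) one_pos one_pos).ident_mul
    ((isLocal_merge (r := r) one_pos one_pos).isStrands h)
  rw [merge_zero_left, split_zero_left, merge_zero_right, split_zero_right, dot_congr 1 h4 rfl,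
    split_congr 1 1 h4 rfl, merge_congr 1 1 h4 rfl, split_congr 1 1 rfl h5, merge_congr 1 1 rfl h5,
    dot_congr 1 rfl h5] at h1
  simp only [List.append_assoc, List.cons_append, List.nil_append] at h1 d1 d2 m1 s1
  rw [s1, m1, d2, mul_assoc (merge r L 1 1 R), d1] at h1
  rw [dumbbell, ← h1]
  simp only [mul_assoc]

lemma isStrands_replicate (r : ℕ) : IsStrands r (List.replicate r 1) :=
  ⟨fun x hx => by rw [(List.mem_replicate.1 hx).2]; exact one_pos, by simp⟩

lemma eq_replicate_one {a : List ℕ} {n : ℕ} (h : a.length = n) (h' : ∀ x ∈ a, x = 1) :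
    a = List.replicate n 1 := List.eq_replicate_iff.2 ⟨h, h'⟩

lemma isStrands_ones {a : List ℕ} (h : a.length = r) (h' : ∀ x ∈ a, x = 1) : IsStrands r a := by
  rw [eq_replicate_one h h']
  exact isStrands_replicate r

/-- The dumbbell at the positions `i`, `i + 1` of `r` strands labelled `1`. -/
noncomputable def dumbbellAt (r i : ℕ) : Web r :=
  dumbbell r (List.replicate i 1) (List.replicate (r - 2 - i) 1)

/-- The crossing of the `i`-th and the next strand, extended by the identity outside of the
corner of the `1`-strands. It is an involution in the whole web superalgebra. -/
noncomputable def unitCrossing (r i : ℕ) : Web r :=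
  dumbbellAt r i + (1 - (2 : ℂ) • ident r (List.replicate r 1))

lemma replicate_append_two {i : ℕ} (hi : i + 1 < r) :
    List.replicate i 1 ++ [1, 1] ++ List.replicate (r - 2 - i) 1 = List.replicate r 1 :=
  eq_replicate_one (by simp; omega) (by simp; omega)

lemma replicate_append_one {i : ℕ} (hi : i < r) :
    List.replicate i 1 ++ [1] ++ List.replicate (r - 1 - i) 1 = List.replicate r 1 :=
  eq_replicate_one (by simp; omega) (by simp; omega)

lemma isStrands_two {i : ℕ} (hi : i + 1 < r) :
    IsStrands r (List.replicate i 1 ++ [1, 1] ++ List.replicate (r - 2 - i) 1) := by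
  rw [replicate_append_two hi]; exact isStrands_replicate r

lemma isStrands_one {i : ℕ} (hi : i < r) :
    IsStrands r (List.replicate i 1 ++ [1] ++ List.replicate (r - 1 - i) 1) := by
  rw [replicate_append_one hi]; exact isStrands_replicate r

lemma dumbbellAt_mul_ident {i : ℕ} (hi : i + 1 < r) :
    dumbbellAt r i * ident r (List.replicate r 1) = dumbbellAt r i := by
  have := (isLocal_dumbbell (r := r)).mul_ident (isStrands_two hi)
  rwa [replicate_append_two hi] at this

lemma ident_mul_dumbbellAt {i : ℕ} (hi : i + 1 < r) :
    ident r (List.replicate r 1) * dumbbellAt r i = dumbbellAt r i := by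
  have := (isLocal_dumbbell (r := r)).ident_mul (isStrands_two hi)
  rwa [replicate_append_two hi] at this

lemma dumbbellAt_sq {i : ℕ} (hi : i + 1 < r) :
    dumbbellAt r i * dumbbellAt r i = (2 : ℂ) • dumbbellAt r i :=
  dumbbell_mul_dumbbell (isStrands_two hi)

lemma dumbbellAt_braid {i : ℕ} (hi : i + 2 < r) :
    dumbbellAt r i * dumbbellAt r (i + 1) * dumbbellAt r i - dumbbellAt r i =
      dumbbellAt r (i + 1) * dumbbellAt r i * dumbbellAt r (i + 1) - dumbbellAt r (i + 1) := by
  have e1 : dumbbellAt r i = dumbbell r (List.replicate i 1) (1 :: List.replicate (r - 3 - i) 1) := by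
    rw [dumbbellAt, ← List.replicate_succ]
    congr 2; omega
  have e2 : dumbbellAt r (i + 1) =
      dumbbell r (List.replicate i 1 ++ [1]) (List.replicate (r - 3 - i) 1) := by
    rw [dumbbellAt, ← List.replicate_succ']
    congr 2; omega
  rw [e1, e2]
  refine dumbbell_braid ?_
  exact isStrands_ones (by simp; omega) (by simp; omega)

lemma dumbbellAt_comm {i j : ℕ} (hij : i + 1 < j) (hj : j + 1 < r) :
    dumbbellAt r i * dumbbellAt r j = dumbbellAt r j * dumbbellAt r i := by
  have := (isLocal_dumbbell (r := r)).interchange_even (isLocal_dumbbell (r := r))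
    (List.replicate i 1) (List.replicate (j - i - 2) 1) (List.replicate (r - 2 - j) 1) rfl (by
      exact isStrands_ones (by simp; omega) (by simp; omega))
  rw [eq_replicate_one (a := List.replicate i 1 ++ [1, 1] ++ List.replicate (j - i - 2) 1) (n := j)
    (by simp; omega) (by simp; omega),
    eq_replicate_one (a := List.replicate (j - i - 2) 1 ++ [1, 1] ++ List.replicate (r - 2 - j) 1)
    (n := r - 2 - i) (by simp; omega) (by simp; omega)] at this
  exact this.symm

lemma strandDot_mul_dumbbellAt {i j : ℕ} (hi : i + 1 < r) (hj : j < r) (h1 : j ≠ i)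
    (h2 : j ≠ i + 1) :
    strandDot r ⟨j, hj⟩ * dumbbellAt r i = dumbbellAt r i * strandDot r ⟨j, hj⟩ := by
  rcases lt_or_gt_of_ne h1 with h | h
  · have := (isLocal_dot (r := r) one_pos).interchange_even (isLocal_dumbbell (r := r))
      (List.replicate j 1) (List.replicate (i - j - 1) 1) (List.replicate (r - 2 - i) 1) rfl (by
        exact isStrands_ones (by simp; omega) (by simp; omega))
    rw [eq_replicate_one (a := List.replicate j 1 ++ [1] ++ List.replicate (i - j - 1) 1) (n := i)
      (by simp; omega) (by simp; omega),
      eq_replicate_one (a := List.replicate (i - j - 1) 1 ++ [1, 1] ++ List.replicate (r - 2 - i) 1)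
      (n := r - 1 - j) (by simp; omega) (by simp; omega)] at this
    exact this.symm
  · have := (isLocal_dumbbell (r := r)).interchange_even (isLocal_dot (r := r) one_pos)
      (List.replicate i 1) (List.replicate (j - i - 2) 1) (List.replicate (r - 1 - j) 1) rfl (by
        exact isStrands_ones (by simp; omega) (by simp; omega))
    rw [eq_replicate_one (a := List.replicate i 1 ++ [1, 1] ++ List.replicate (j - i - 2) 1) (n := j)
      (by simp; omega) (by simp; omega),
      eq_replicate_one (a := List.replicate (j - i - 2) 1 ++ [1] ++ List.replicate (r - 1 - j) 1)
      (n := r - 2 - i) (by simp; omega) (by simp; omega)] at this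
    exact this

lemma strandDot_mul_ident (j : Fin r) :
    strandDot r j * ident r (List.replicate r 1) = strandDot r j := by
  have := (isLocal_dot (r := r) one_pos).mul_ident (isStrands_one j.2)
  rwa [replicate_append_one j.2] at this

lemma ident_mul_strandDot (j : Fin r) :
    ident r (List.replicate r 1) * strandDot r j = strandDot r j := by
  have := (isLocal_dot (r := r) one_pos).ident_mul (isStrands_one j.2)
  rwa [replicate_append_one j.2] at this

lemma strandDot_sq (j : Fin r) : strandDot r j * strandDot r j = ident r (List.replicate r 1) := by
  have := mk_rel (WebRel.dot_collision (List.replicate j 1) 1 (List.replicate (r - 1 - j) 1)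
    (isStrands_one j.2))
  rw [map_mul, map_smul] at this
  rw [replicate_append_one j.2, Nat.cast_one, one_smul] at this
  exact this

lemma strandDot_anticomm_of_lt {i j : Fin r} (h : i < j) :
    strandDot r j * strandDot r i = -(strandDot r i * strandDot r j) := by
  have hij : (i : ℕ) < j := h
  have := (isLocal_dot (r := r) one_pos).interchange (isLocal_dot (r := r) one_pos)
    (List.replicate i 1) (List.replicate (j - i - 1) 1) (List.replicate (r - 1 - j) 1) (by
      exact isStrands_ones (by simp; omega) (by simp; omega))
  rw [eq_replicate_one (a := List.replicate i 1 ++ [1] ++ List.replicate (j - i - 1) 1) (n := j)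
    (by simp; omega) (by simp; omega),
    eq_replicate_one (a := List.replicate (j - i - 1) 1 ++ [1] ++ List.replicate (r - 1 - j) 1)
    (n := r - 1 - i) (by simp; omega) (by simp; omega)] at this
  rw [mul_one, pow_one] at this
  exact this.trans (neg_one_smul ℂ (strandDot r i * strandDot r j))

lemma strandDot_anticomm {i j : Fin r} (h : i ≠ j) :
    strandDot r i * strandDot r j = -(strandDot r j * strandDot r i) := by
  rcases lt_or_gt_of_ne h with h | h
  · rw [strandDot_anticomm_of_lt h, neg_neg]
  · exact strandDot_anticomm_of_lt h

lemma strandDot_mul_dumbbellAt_self {i : ℕ} (hi : i + 1 < r) :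
    strandDot r ⟨i, by omega⟩ * dumbbellAt r i - dumbbellAt r i * strandDot r ⟨i + 1, hi⟩ =
      strandDot r ⟨i, by omega⟩ - strandDot r ⟨i + 1, hi⟩ := by
  have := dot_mul_dumbbell (isStrands_two hi)
  rw [← List.replicate_succ, ← List.replicate_succ',
    show r - 2 - i + 1 = r - 1 - i by omega] at this
  have e : r - 1 - (i + 1) = r - 2 - i := by omega
  simp only [strandDot, e]
  exact this

lemma dumbbellAt_mul_strandDot_self {i : ℕ} (hi : i + 1 < r) :
    dumbbellAt r i * strandDot r ⟨i, by omega⟩ - strandDot r ⟨i + 1, hi⟩ * dumbbellAt r i =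
      strandDot r ⟨i, by omega⟩ - strandDot r ⟨i + 1, hi⟩ := by
  have := dumbbell_mul_dot (isStrands_two hi)
  rw [← List.replicate_succ, ← List.replicate_succ',
    show r - 2 - i + 1 = r - 1 - i by omega] at this
  have e : r - 1 - (i + 1) = r - 2 - i := by omega
  simp only [strandDot, e]
  exact this

lemma unitCrossing_rel (r : ℕ) : CoxeterRel (r - 1) (unitCrossing r) where
  sq i hi := by
    have hi' : i + 1 < r := by omega
    simp only [unitCrossing, mul_add, add_mul, mul_sub, sub_mul, mul_one, one_mul, smul_mul_assoc,
      mul_smul_comm, dumbbellAt_mul_ident hi', ident_mul_dumbbellAt hi', dumbbellAt_sq hi',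
      ident_mul_ident_self]
    module
  braid i hi := by
    have hi' : i + 1 < r := by omega
    have hi'' : i + 1 + 1 < r := by omega
    have h := dumbbellAt_braid (r := r) (i := i) (by omega)
    rw [sub_eq_sub_iff_add_eq_add] at h
    have h' := eq_sub_of_add_eq h
    have e1 : dumbbellAt r i * dumbbellAt r (i + 1) * ident r (List.replicate r 1) =
        dumbbellAt r i * dumbbellAt r (i + 1) := by rw [mul_assoc, dumbbellAt_mul_ident hi'']
    have e2 : dumbbellAt r (i + 1) * dumbbellAt r i * ident r (List.replicate r 1) =
        dumbbellAt r (i + 1) * dumbbellAt r i := by rw [mul_assoc, dumbbellAt_mul_ident hi']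
    simp only [unitCrossing, mul_add, add_mul, mul_sub, sub_mul, mul_one, one_mul, smul_mul_assoc,
      mul_smul_comm, dumbbellAt_mul_ident hi', ident_mul_dumbbellAt hi', dumbbellAt_sq hi',
      dumbbellAt_mul_ident hi'', ident_mul_dumbbellAt hi'', dumbbellAt_sq hi'', e1, e2,
      ident_mul_ident_self, h']
    module
  comm i j hij hj := by
    have hi' : i + 1 < r := by omega
    have hj' : j + 1 < r := by omega
    simp only [unitCrossing, mul_add, add_mul, mul_sub, sub_mul, mul_one, one_mul, smul_mul_assoc,
      mul_smul_comm, dumbbellAt_mul_ident hi', ident_mul_dumbbellAt hi',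
      dumbbellAt_mul_ident hj', ident_mul_dumbbellAt hj', ident_mul_ident_self,
      dumbbellAt_comm hij hj']
    module

lemma unitCrossing_mul_ident {i : ℕ} (hi : i + 1 < r) :
    unitCrossing r i * ident r (List.replicate r 1) =
      ident r (List.replicate r 1) * unitCrossing r i := by
  simp only [unitCrossing, mul_add, add_mul, mul_sub, sub_mul, mul_one, one_mul, smul_mul_assoc,
    mul_smul_comm, dumbbellAt_mul_ident hi, ident_mul_dumbbellAt hi]

lemma ident_mul_unitCrossing (i : Fin (r - 1)) :
    ident r (List.replicate r 1) * unitCrossing r i = crossing r i := by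
  have hi : (i : ℕ) + 1 < r := by omega
  simp only [unitCrossing, mul_add, mul_sub, mul_one,
    mul_smul_comm, ident_mul_dumbbellAt hi, ident_mul_ident_self]
  rw [crossing, dumbbellAt, dumbbell]
  module

lemma unitCrossing_mul_strandDot (i : Fin (r - 1)) (j : Fin r) :
    unitCrossing r i * strandDot r j = strandDot r (simpleSwap r i j) * unitCrossing r i := by
  have hi : (i : ℕ) + 1 < r := by omega
  simp only [unitCrossing, mul_add, add_mul, mul_sub, sub_mul, mul_one, one_mul, smul_mul_assoc,
    mul_smul_comm, strandDot_mul_ident, ident_mul_strandDot]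
  by_cases h1 : (j : ℕ) = i
  · have ej : j = ⟨i, by omega⟩ := Fin.ext h1
    rw [ej, simpleSwap, Equiv.swap_apply_left, ← sub_eq_zero,
      ← sub_eq_zero.2 (dumbbellAt_mul_strandDot_self hi)]
    module
  · by_cases h2 : (j : ℕ) = i + 1
    · have ej : j = ⟨i + 1, hi⟩ := Fin.ext h2
      rw [ej, simpleSwap, Equiv.swap_apply_right, ← sub_eq_zero,
        ← sub_eq_zero.2 (strandDot_mul_dumbbellAt_self hi).symm]
      module
    · rw [simpleSwap, Equiv.swap_apply_of_ne_of_ne (fun h => h1 (congrArg Fin.val h))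
        (fun h => h2 (congrArg Fin.val h)), strandDot_mul_dumbbellAt hi j.2 h1 h2]

lemma exists_permHom (r : ℕ) : ∃ f : Equiv.Perm (Fin r) →* Web r, ∀ w : List (Fin (r - 1)),
    f (w.map (simpleSwap r)).prod = (w.map fun i : Fin (r - 1) => unitCrossing r i).prod :=
  CoxeterRel.exists_hom (fun _ => rfl) (unitCrossing_rel r)

/-- The dots and crossings on `1`-strands form a Sergeev system in the web superalgebra. -/
noncomputable def sergeevSystem (r : ℕ) : SergeevSystem r (Web r) where
  e := ident r (List.replicate r 1)
  perm := (exists_permHom r).choose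
  dot := strandDot r
  e_mul_e := ident_mul_ident_self _
  perm_mul_e σ := by
    obtain ⟨w, rfl⟩ := exists_word r σ
    rw [(exists_permHom r).choose_spec]
    induction w with
    | nil => simp
    | cons i w ih =>
      rw [List.map_cons, List.prod_cons, mul_assoc, ih, ← mul_assoc,
        unitCrossing_mul_ident (by omega), mul_assoc]
  e_mul_dot := ident_mul_strandDot
  dot_mul_e := strandDot_mul_ident
  dot_mul_self := strandDot_sq
  dot_mul_dot _ _ := strandDot_anticomm
  perm_mul_dot σ j := by
    obtain ⟨w, rfl⟩ := exists_word r σ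
    rw [(exists_permHom r).choose_spec]
    induction w generalizing j with
    | nil => simp
    | cons i w ih =>
      simp only [List.map_cons, List.prod_cons, Equiv.Perm.mul_apply]
      rw [mul_assoc, ih, ← mul_assoc, unitCrossing_mul_strandDot, mul_assoc]

lemma sergeevSystem_perm_simpleSwap (i : Fin (r - 1)) :
    (sergeevSystem r).perm (simpleSwap r i) = unitCrossing r i := by
  have : (exists_permHom r).choose (simpleSwap r i) = unitCrossing r i := by
    simpa using (exists_permHom r).choose_spec [i]
  exact this

open Classical in
lemma sergeev_eq (a : Set (Fin r)) (σ : Equiv.Perm (Fin r)) :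
    sergeev r a σ = (sergeevSystem r).dots ((List.finRange r).filter (· ∈ a)) *
      (sergeevSystem r).perm σ * (sergeevSystem r).e := by
  have key : ∀ w : List (Fin (r - 1)), ident r (List.replicate r 1) * (w.map (crossing r)).prod =
      ident r (List.replicate r 1) * (w.map fun i : Fin (r - 1) => unitCrossing r i).prod := by
    intro w
    induction w with
    | nil => rfl
    | cons i w ih =>
      rw [List.map_cons, List.map_cons, List.prod_cons, List.prod_cons, ← ident_mul_unitCrossing,
        ← mul_assoc, ← mul_assoc, ident_mul_ident_self, ← mul_assoc, ← unitCrossing_mul_ident (by omega),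
        mul_assoc, ih, ← mul_assoc]
  rw [sergeev, mul_assoc, key, mul_assoc _ ((sergeevSystem r).perm σ), (sergeevSystem r).perm_mul_e]
  rw [← (exists_permHom r).choose_spec, show ((word r σ).map (simpleSwap r)).prod = σ from
    (exists_word r σ).choose_spec, ← (sergeevSystem r).prod_ite_dot]
  rfl

end Web

namespace Web

open FreeWeb (erase)

variable {r : ℕ}

lemma dumbbellAt_mem_span {i : ℕ} (hi : i + 1 < r) : dumbbellAt r i ∈ (sergeevSystem r).span := by
  have h1 := (sergeevSystem r).perm_mem_span (simpleSwap r ⟨i, by omega⟩)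
  rw [sergeevSystem_perm_simpleSwap] at h1
  have h2 : dumbbellAt r i = unitCrossing r i * (sergeevSystem r).e + (sergeevSystem r).e := by
    change _ = unitCrossing r i * ident r (List.replicate r 1) + ident r (List.replicate r 1)
    simp only [unitCrossing, add_mul, sub_mul, one_mul, smul_mul_assoc,
      dumbbellAt_mul_ident hi, ident_mul_ident_self]
    module
  rw [h2]
  exact add_mem h1 (sergeevSystem r).e_mem_span

/-- The complete merge of `k` strands followed by the complete split. -/
noncomputable def bundle (r : ℕ) (L : List ℕ) (k : ℕ) (R : List ℕ) : Web r :=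
  splitStrand r L k R * mergeStrand r L k R

lemma isLocal_bundle (k : ℕ) :
    IsLocal r 0 (List.replicate k 1) (List.replicate k 1) fun L R => bundle r L k R :=
  (isLocal_splitStrand k).comp (isLocal_mergeStrand k)

lemma erase_cons (k : ℕ) (a : List ℕ) : erase (k :: a) = erase [k] ++ erase a := by
  rw [← FreeWeb.erase_append]; rfl

lemma erase_append_cons (L R : List ℕ) (k : ℕ) : erase (L ++ k :: R) = erase (L ++ erase [k] ++ R) := by
  simp [FreeWeb.erase_append, FreeWeb.erase_erase, erase_cons k R]

/-- The inductive description of the symmetrizers `bundle`, which shows that they are polynomials in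
the crossings. -/
lemma bundle_succ_succ {L R : List ℕ} {k : ℕ}
    (h : IsStrands r (L ++ List.replicate (k + 2) 1 ++ R)) :
    ((k.factorial : ℂ) * k.factorial) • bundle r L (k + 2) R =
      ((k.factorial : ℂ) * k.factorial) • bundle r (L ++ [1]) (k + 1) R +
        bundle r (L ++ [1]) (k + 1) R * (bundle r (L ++ [1] ++ [1]) k R *
          (dumbbell r L (List.replicate k 1 ++ R) -
            ident r (L ++ List.replicate (k + 2) 1 ++ R))) * bundle r (L ++ [1]) (k + 1) R := by
  have hk : IsStrands r (L ++ [1] ++ [1] ++ List.replicate k 1 ++ R) := by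
    simpa [List.replicate_succ] using h
  have hk' : IsStrands r (L ++ [1] ++ [1] ++ erase [k] ++ R) := (isLocal_mergeStrand k).isStrands hk
  have hk1 : IsStrands r (L ++ [1] ++ List.replicate (k + 1) 1 ++ R) := by
    simpa [List.replicate_succ] using h
  have hk1' : IsStrands r (L ++ [1] ++ [k + 1] ++ R) := by
    simpa using (isLocal_mergeStrand (k + 1)).isStrands hk1
  have eI : ident r (L ++ [1] ++ [1] ++ erase [k] ++ R) = ident r (L ++ 1 :: 1 :: k :: R) := by
    refine ident_congr ?_
    have := erase_append_cons (L ++ [1] ++ [1]) R k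
    rw [← this]; simp
  -- `k!` times the ladders that occur in the square switch relation
  have hm : (k.factorial : ℂ) • merge r (L ++ [1]) 1 k R =
      mergeStrand r (L ++ [1]) (k + 1) R * splitStrand r (L ++ [1] ++ [1]) k R := by
    rw [mergeStrand, mul_assoc, mergeStrand_mul_splitStrand hk, mul_smul_comm]
    congr 1
    have := (isLocal_merge_one (r := r) k).mul_ident (L := L ++ [1]) (R := R) (by simpa using hk')
    conv_lhs => rw [← this]
    congr 1
    refine ident_congr ?_
    have := erase_append_cons (L ++ [1] ++ [1]) R k
    rw [this]; simp
  have hs : (k.factorial : ℂ) • split r (L ++ [1]) 1 k R =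
      mergeStrand r (L ++ [1] ++ [1]) k R * splitStrand r (L ++ [1]) (k + 1) R := by
    rw [splitStrand, ← mul_assoc, mergeStrand_mul_splitStrand hk, smul_mul_assoc]
    congr 1
    have := (isLocal_split_one (r := r) k).ident_mul (L := L ++ [1]) (R := R)
      (by simpa [add_comm] using hk1')
    conv_lhs => rw [← this]
    congr 1
    refine ident_congr ?_
    have := erase_append_cons (L ++ [1] ++ [1]) R k
    rw [this]; simp
  have hd : dumbbell r L (k :: R) * mergeStrand r (L ++ [1] ++ [1]) k R =
      mergeStrand r (L ++ [1] ++ [1]) k R * dumbbell r L (List.replicate k 1 ++ R) := by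
    have := (isLocal_dumbbell (r := r)).interchange_even (isLocal_mergeStrand (r := r) k) L [] R rfl
      (by simpa using hk)
    rw [dumbbell_congr (L := L) (L' := L) (R := k :: R) (R' := [] ++ erase [k] ++ R) rfl (by
      have := erase_append_cons [] R k
      simpa using this)]
    simpa using this.symm
  have hi : ident r (L ++ 1 :: 1 :: k :: R) * mergeStrand r (L ++ [1] ++ [1]) k R =
      mergeStrand r (L ++ [1] ++ [1]) k R * ident r (L ++ List.replicate (k + 2) 1 ++ R) := by
    have h1 := (isLocal_mergeStrand (r := r) k).ident_mul hk
    have h2 := (isLocal_mergeStrand (r := r) k).mul_ident hk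
    rw [eI] at h1
    rw [h1, show L ++ List.replicate (k + 2) 1 ++ R = L ++ [1] ++ [1] ++ List.replicate k 1 ++ R by
      simp [List.replicate_succ], h2]
  have hsq := split_one_mul_merge_one (r := r) (L := L) (R := R) (l := k) (by simpa using hk1')
  have hb : bundle r L (k + 2) R = splitStrand r (L ++ [1]) (k + 1) R *
      (split r L 1 (k + 1) R * merge r L 1 (k + 1) R) * mergeStrand r (L ++ [1]) (k + 1) R := by
    rw [bundle, splitStrand, mergeStrand]; simp only [mul_assoc]
  have hid : ident r (L ++ 1 :: (k + 1) :: R) * mergeStrand r (L ++ [1]) (k + 1) R =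
      mergeStrand r (L ++ [1]) (k + 1) R := by
    have := (isLocal_mergeStrand (r := r) (k + 1)).ident_mul hk1
    simpa using this
  rw [hb, hsq, mul_add, add_mul, smul_add, mul_assoc _ (ident r _), hid]
  congr 1
  calc _ = splitStrand r (L ++ [1]) (k + 1) R * (((k.factorial : ℂ) • merge r (L ++ [1]) 1 k R) *
        (dumbbell r L (k :: R) - ident r (L ++ 1 :: 1 :: k :: R)) *
        ((k.factorial : ℂ) • split r (L ++ [1]) 1 k R)) * mergeStrand r (L ++ [1]) (k + 1) R := by
        simp only [smul_mul_assoc, mul_smul_comm, smul_smul]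
    _ = splitStrand r (L ++ [1]) (k + 1) R * mergeStrand r (L ++ [1]) (k + 1) R *
        (splitStrand r (L ++ [1] ++ [1]) k R *
          ((dumbbell r L (k :: R) - ident r (L ++ 1 :: 1 :: k :: R)) *
          mergeStrand r (L ++ [1] ++ [1]) k R)) * (splitStrand r (L ++ [1]) (k + 1) R *
          mergeStrand r (L ++ [1]) (k + 1) R) := by
        rw [hm, hs]; simp only [mul_assoc]
    _ = _ := by
        rw [sub_mul, hd, hi, ← mul_sub]
        simp only [bundle, mul_assoc]

lemma bundle_mem_span (k n m : ℕ) (h : n + k + m = r) :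
    bundle r (List.replicate n 1) k (List.replicate m 1) ∈ (sergeevSystem r).span := by
  induction k using Nat.strong_induction_on generalizing n m with
  | _ k ih =>
  match k, ih with
  | 0, _ =>
    rw [bundle, splitStrand, mergeStrand, ident_mul_ident_self,
      eq_replicate_one (a := List.replicate n 1 ++ List.replicate m 1) (n := r)
        (by simp; omega) (by simp)]
    exact (sergeevSystem r).e_mem_span
  | 1, _ =>
    rw [bundle, splitStrand, mergeStrand, splitStrand, mergeStrand, split_zero_right,
      merge_zero_right, eq_replicate_one (a := List.replicate n 1 ++ [1] ++ List.replicate m 1)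
        (n := r) (by simp; omega) (by simp; omega),
      eq_replicate_one (a := List.replicate n 1 ++ 1 :: List.replicate m 1)
        (n := r) (by simp; omega) (by simp; omega), ident_mul_ident_self, ident_mul_ident_self]
    exact (sergeevSystem r).e_mem_span
  | k + 2, ih =>
    have h0 : ((k.factorial : ℂ) * k.factorial) ≠ 0 := by
      have : (k.factorial : ℂ) ≠ 0 := Nat.cast_ne_zero.2 (Nat.factorial_ne_zero k)
      exact mul_ne_zero this this
    have e := bundle_succ_succ (r := r) (L := List.replicate n 1) (R := List.replicate m 1) (k := k)
      (isStrands_ones (by simp; omega) (by simp))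
    rw [← inv_smul_smul₀ h0 (bundle r _ (k + 2) _), e]
    have h1 := ih (k + 1) (by omega) (n + 1) m (by omega)
    have h2 := ih k (by omega) (n + 1 + 1) m (by omega)
    have h3 := dumbbellAt_mem_span (r := r) (i := n) (by omega)
    rw [List.replicate_succ'] at h1
    rw [List.replicate_succ', List.replicate_succ'] at h2
    rw [dumbbellAt, eq_replicate_one (a := List.replicate (r - 2 - n) 1) (n := k + m) (by simp; omega)
      (by simp), List.replicate_add] at h3
    have h4 := (sergeevSystem r).e_mem_span
    rw [show (sergeevSystem r).e = ident r (List.replicate r 1) from rfl,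
      ← eq_replicate_one (a := List.replicate n 1 ++ List.replicate (k + 2) 1 ++ List.replicate m 1)
        (n := r) (by simp; omega) (by simp)] at h4
    refine Submodule.smul_mem _ _ (add_mem (Submodule.smul_mem _ _ h1) ?_)
    exact SergeevSystem.mul_mem_span _ (SergeevSystem.mul_mem_span _ h1
      (SergeevSystem.mul_mem_span _ h2 (sub_mem h3 h4))) h1

/-! ### Complete merges and splits of all strands -/

/-- The complete merges of `1`-strands into the strands of `a`, with identity strands `K` to the
left and `B` to the right. -/
noncomputable def mergeCtx (r : ℕ) : List ℕ → List ℕ → List ℕ → Web r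
  | K, [], B => ident r (K ++ B)
  | K, k :: a, B => mergeStrand r K k (a ++ B) * mergeCtx r (K ++ List.replicate k 1) a B

/-- The complete splits of the strands of `a`, with identity strands `K` to the left and `B` to the
right. -/
noncomputable def splitCtx (r : ℕ) : List ℕ → List ℕ → List ℕ → Web r
  | K, [], B => ident r (K ++ B)
  | K, k :: a, B => splitCtx r (K ++ List.replicate k 1) a B * splitStrand r K k (a ++ B)

lemma mergeCtx_nil (K a : List ℕ) : mergeCtx r K a [] = mergeAll r K a := by
  induction a generalizing K with
  | nil => simp [mergeCtx, mergeAll]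
  | cons k a ih => simp [mergeCtx, mergeAll, ih]

lemma splitCtx_nil (K a : List ℕ) : splitCtx r K a [] = splitAll r K a := by
  induction a generalizing K with
  | nil => simp [splitCtx, splitAll]
  | cons k a ih => simp [splitCtx, splitAll, ih]

lemma isLocal_mergeCtx (a : List ℕ) :
    IsLocal r 0 (List.replicate a.sum 1) (erase a) fun K B => mergeCtx r K a B := by
  induction a with
  | nil =>
    refine IsLocal.congr (IsLocal.ident []) fun L R _ => ?_
    simp [mergeCtx]
  | cons k a ih =>
    have h1 := ih.shift (List.replicate k 1) []
    simp only [List.append_nil, List.nil_append] at h1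
    have h2 : IsLocal r 0 (List.replicate k 1 ++ erase a) (erase (k :: a))
        fun K B => mergeStrand r K k (a ++ B) := by
      rw [erase_cons]
      have := (isLocal_mergeStrand (r := r) k).shift [] (erase a)
      refine IsLocal.congr (by simpa using this) fun K B _ => ?_
      exact mergeStrand_congr k (by simp) (by simp [FreeWeb.erase_append, FreeWeb.erase_erase])
    rw [List.sum_cons, List.replicate_add]
    exact h2.comp h1

lemma isLocal_splitCtx (a : List ℕ) :
    IsLocal r 0 (erase a) (List.replicate a.sum 1) fun K B => splitCtx r K a B := by
  induction a with
  | nil =>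
    refine IsLocal.congr (IsLocal.ident []) fun L R _ => ?_
    simp [splitCtx]
  | cons k a ih =>
    have h1 := ih.shift (List.replicate k 1) []
    simp only [List.append_nil, List.nil_append] at h1
    have h2 : IsLocal r 0 (erase (k :: a)) (List.replicate k 1 ++ erase a)
        fun K B => splitStrand r K k (a ++ B) := by
      rw [erase_cons]
      have := (isLocal_splitStrand (r := r) k).shift [] (erase a)
      refine IsLocal.congr (by simpa using this) fun K B _ => ?_
      exact splitStrand_congr k (by simp) (by simp [FreeWeb.erase_append, FreeWeb.erase_erase])
    rw [List.sum_cons, List.replicate_add]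
    exact h1.comp h2

lemma isStrands_ones_append {K a : List ℕ} (h : IsStrands r (K ++ a)) :
    IsStrands r (K ++ List.replicate a.sum 1) := by
  rw [isStrands_append] at h ⊢
  refine ⟨h.1, fun x hx => ?_, by simpa using h.2.2⟩
  rw [(List.mem_replicate.1 hx).2]; exact one_pos

lemma erase_right {K a : List ℕ} (h : IsStrands r (K ++ a)) : erase a = a :=
  FreeWeb.erase_eq_self (isStrands_append.1 h).2.1

lemma ident_mul_mergeAll {K a : List ℕ} (h : IsStrands r (K ++ a)) :
    ident r (K ++ a) * mergeAll r K a = mergeAll r K a := by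
  have := (isLocal_mergeCtx (r := r) a).ident_mul (L := K) (R := [])
    (by simpa using isStrands_ones_append h)
  rw [erase_right h, mergeCtx_nil] at this
  simpa using this

lemma mergeAll_mul_ident {K a : List ℕ} (h : IsStrands r (K ++ a)) :
    mergeAll r K a * ident r (K ++ List.replicate a.sum 1) = mergeAll r K a := by
  have := (isLocal_mergeCtx (r := r) a).mul_ident (L := K) (R := [])
    (by simpa using isStrands_ones_append h)
  rw [mergeCtx_nil] at this
  simpa using this

lemma ident_mul_splitAll {K a : List ℕ} (h : IsStrands r (K ++ a)) :
    ident r (K ++ List.replicate a.sum 1) * splitAll r K a = splitAll r K a := by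
  have := (isLocal_splitCtx (r := r) a).ident_mul (L := K) (R := [])
    (by rw [erase_right h]; simpa using h)
  rw [splitCtx_nil] at this
  simpa using this

lemma splitAll_mul_ident {K a : List ℕ} (h : IsStrands r (K ++ a)) :
    splitAll r K a * ident r (K ++ a) = splitAll r K a := by
  have := (isLocal_splitCtx (r := r) a).mul_ident (L := K) (R := [])
    (by rw [erase_right h]; simpa using h)
  rw [erase_right h, splitCtx_nil] at this
  simpa using this

lemma mergeAll_append {K a b : List ℕ} (h : IsStrands r (K ++ (a ++ b))) :
    mergeAll r K (a ++ b) = mergeCtx r K a b * mergeAll r (K ++ List.replicate a.sum 1) b := by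
  induction a generalizing K with
  | nil =>
    have := ident_mul_mergeAll (r := r) (K := K) (a := b) (by simpa using h)
    simp [mergeCtx, this]
  | cons k a ih =>
    have h' : IsStrands r (K ++ List.replicate k 1 ++ (a ++ b)) := by
      simp only [isStrands_append, List.mem_append, List.cons_append, List.mem_cons, List.sum_append,
        List.sum_cons, List.sum_replicate, or_imp, forall_and, smul_eq_mul, mul_one] at h ⊢
      refine ⟨⟨h.1, fun x hx => ?_⟩, h.2.1.2, by omega⟩
      rw [(List.mem_replicate.1 hx).2]; exact one_pos
    rw [List.cons_append, mergeAll, mergeCtx, ih h', mul_assoc, List.sum_cons, List.replicate_add,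
      List.append_assoc K]

lemma exists_mergeAll_mul_splitAll {K a : List ℕ} (h : IsStrands r (K ++ a)) :
    ∃ z : ℂ, z ≠ 0 ∧ mergeAll r K a * splitAll r K a = z • ident r (K ++ a) := by
  induction a generalizing K with
  | nil => exact ⟨1, one_ne_zero, by simp [mergeAll, splitAll, ident_mul_ident_self]⟩
  | cons k a ih =>
    have h' : IsStrands r (K ++ List.replicate k 1 ++ a) := by
      simp only [isStrands_append, List.mem_append, List.mem_cons, List.sum_append,
        List.sum_cons, List.sum_replicate, or_imp, forall_and, smul_eq_mul, mul_one] at h ⊢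
      refine ⟨⟨h.1, fun x hx => ?_⟩, h.2.1.2, by omega⟩
      rw [(List.mem_replicate.1 hx).2]; exact one_pos
    obtain ⟨z, hz, e⟩ := ih h'
    refine ⟨z * k.factorial, mul_ne_zero hz (Nat.cast_ne_zero.2 (Nat.factorial_ne_zero k)), ?_⟩
    have h1 := (isLocal_mergeStrand (r := r) k).mul_ident h'
    rw [mergeAll, splitAll, mul_assoc, ← mul_assoc (mergeAll r _ a), e, smul_mul_assoc,
      mul_smul_comm, ← mul_assoc, h1, mergeStrand_mul_splitStrand h', smul_smul]

/-! ### Absorption of permutations -/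

/-- A complete merge absorbs the dumbbells on its strands, hence the crossings of its strands. -/
lemma mergeStrand_mul_dumbbell {K R : List ℕ} {k t : ℕ} (ht : t + 1 < k)
    (h : IsStrands r (K ++ List.replicate k 1 ++ R)) :
    mergeStrand r K k R * dumbbell r (K ++ List.replicate t 1) (List.replicate (k - 2 - t) 1 ++ R) =
      (2 : ℂ) • mergeStrand r K k R := by
  induction t generalizing K k with
  | zero =>
    obtain ⟨k, rfl⟩ : ∃ l, k = l + 2 := ⟨k - 2, by omega⟩
    have hk : IsStrands r (K ++ [1] ++ [1] ++ List.replicate k 1 ++ R) := by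
      simpa [List.replicate_succ] using h
    have hk' : IsStrands r (K ++ [1] ++ [1] ++ erase [k] ++ R) := (isLocal_mergeStrand k).isStrands hk
    have e1 : mergeStrand r K (k + 2) R =
        merge r K (1 + 1) k R * (merge r K 1 1 (k :: R) * mergeStrand r (K ++ [1] ++ [1]) k R) := by
      rw [mergeStrand, mergeStrand, ← mul_assoc, ← mul_assoc, add_comm k 1,
        merge_mul_merge_one_one (by simpa using hk')]
    have e2 := (isLocal_dumbbell (r := r)).interchange_even (isLocal_mergeStrand (r := r) k) K [] R rfl
      (by simpa using hk)
    have e3 : dumbbell r K (k :: R) = dumbbell r K (erase [k] ++ R) :=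
      dumbbell_congr rfl (by simpa using erase_append_cons [] R k)
    have e4 : merge r K 1 1 (k :: R) = merge r K 1 1 (erase [k] ++ R) :=
      merge_congr 1 1 rfl (by simpa using erase_append_cons [] R k)
    have e5 := merge_mul_dumbbell (r := r) (L := K) (R := erase [k] ++ R) (by simpa using hk')
    have e2' : mergeStrand r (K ++ [1] ++ [1]) k R * dumbbell r K (List.replicate k 1 ++ R) =
      dumbbell r K (erase [k] ++ R) * mergeStrand r (K ++ [1] ++ [1]) k R := by simpa using e2
    rw [e1, mul_assoc, mul_assoc, show k + 2 - 2 - 0 = k by omega, List.replicate_zero,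
      List.append_nil, e2', e4, ← mul_assoc (merge r K 1 1 _), e5, smul_mul_assoc, mul_smul_comm]
  | succ t ih =>
    obtain ⟨k, rfl⟩ : ∃ l, k = l + 1 := ⟨k - 1, by omega⟩
    have := ih (K := K ++ [1]) (k := k) (by omega) (by simpa [List.replicate_succ] using h)
    rw [mergeStrand, mul_assoc, show k + 1 - 2 - (t + 1) = k - 2 - t by omega,
      show K ++ List.replicate (t + 1) 1 = K ++ [1] ++ List.replicate t 1 by
        simp [List.replicate_succ], this, mul_smul_comm]

lemma dumbbell_mul_splitStrand {K R : List ℕ} {k t : ℕ} (ht : t + 1 < k)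
    (h : IsStrands r (K ++ List.replicate k 1 ++ R)) :
    dumbbell r (K ++ List.replicate t 1) (List.replicate (k - 2 - t) 1 ++ R) * splitStrand r K k R =
      (2 : ℂ) • splitStrand r K k R := by
  induction t generalizing K k with
  | zero =>
    obtain ⟨k, rfl⟩ : ∃ l, k = l + 2 := ⟨k - 2, by omega⟩
    have hk : IsStrands r (K ++ [1] ++ [1] ++ List.replicate k 1 ++ R) := by
      simpa [List.replicate_succ] using h
    have hk' : IsStrands r (K ++ [1] ++ [1] ++ erase [k] ++ R) := (isLocal_mergeStrand k).isStrands hk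
    have e1 : splitStrand r K (k + 2) R =
        splitStrand r (K ++ [1] ++ [1]) k R * split r K 1 1 (k :: R) * split r K (1 + 1) k R := by
      rw [splitStrand, splitStrand, mul_assoc, mul_assoc, add_comm k 1,
        split_mul_split_one_one (by simpa using hk')]
    have e2 := (isLocal_dumbbell (r := r)).interchange_even (isLocal_splitStrand (r := r) k) K [] R rfl
      (by simpa using hk')
    have e4 : split r K 1 1 (k :: R) = split r K 1 1 (erase [k] ++ R) :=
      split_congr 1 1 rfl (by simpa using erase_append_cons [] R k)
    have e5 := dumbbell_mul_split (r := r) (L := K) (R := erase [k] ++ R) (by simpa using hk')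
    have e2' : dumbbell r K (List.replicate k 1 ++ R) * splitStrand r (K ++ [1] ++ [1]) k R =
      splitStrand r (K ++ [1] ++ [1]) k R * dumbbell r K (erase [k] ++ R) := by simpa using e2.symm
    rw [e1, show k + 2 - 2 - 0 = k by omega, List.replicate_zero,
      List.append_nil, e4, ← mul_assoc, ← mul_assoc, e2', mul_assoc (splitStrand r _ k R), e5,
      mul_smul_comm, smul_mul_assoc]
  | succ t ih =>
    obtain ⟨k, rfl⟩ : ∃ l, k = l + 1 := ⟨k - 1, by omega⟩
    have := ih (K := K ++ [1]) (k := k) (by omega) (by simpa [List.replicate_succ] using h)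
    rw [splitStrand, ← mul_assoc, show k + 1 - 2 - (t + 1) = k - 2 - t by omega,
      show K ++ List.replicate (t + 1) 1 = K ++ [1] ++ List.replicate t 1 by
        simp [List.replicate_succ], this, smul_mul_assoc]

lemma sameBlock_tail {k : ℕ} {a : List ℕ} {p q : ℕ} (h : SameBlock (k :: a) p q) (hp : k ≤ p)
    (hq : k ≤ q) : SameBlock a (p - k) (q - k) := by
  intro d hd
  have := h (d + k) (Or.inr ⟨by omega, by simpa using hd⟩)
  omega

lemma mergeAll_mul_dumbbellAt {a : List ℕ} {n i : ℕ} (h : IsStrands r (List.replicate n 1 ++ a))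
    (hn : n ≤ i) (hi : i + 1 < r) (hs : SameBlock a (i - n) (i + 1 - n)) :
    mergeAll r (List.replicate n 1) a * dumbbellAt r i =
      (2 : ℂ) • mergeAll r (List.replicate n 1) a := by
  induction a generalizing n with
  | nil =>
    have := h.2
    simp at this
    omega
  | cons k a ih =>
    have h' : IsStrands r (List.replicate n 1 ++ List.replicate k 1 ++ a) := by
      simp only [isStrands_append, List.mem_append, List.mem_cons, List.sum_append,
        List.sum_cons, List.sum_replicate, or_imp, forall_and, smul_eq_mul, mul_one] at h ⊢
      refine ⟨⟨h.1, fun x hx => ?_⟩, h.2.1.2, by omega⟩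
      rw [(List.mem_replicate.1 hx).2]; exact one_pos
    rw [mergeAll, mul_assoc]
    by_cases hk : n + k ≤ i
    · have h2 := sameBlock_tail hs (by omega) (by omega)
      rw [← List.replicate_add] at h' ⊢
      rw [ih h' hk (by rwa [show i - (n + k) = i - n - k by omega,
        show i + 1 - (n + k) = i + 1 - n - k by omega]), mul_smul_comm]
    · have hcut := hs k (Or.inr ⟨le_rfl, by simpa using isCut_zero a⟩)
      have hsum : n + k + a.sum = r := by simpa [add_assoc] using h'.2
      have e := (isLocal_dumbbell (r := r)).interchange_even (isLocal_mergeCtx (r := r) a)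
        (List.replicate i 1) (List.replicate (n + k - 2 - i) 1) [] rfl
        (isStrands_ones (by simp; omega) (by simp; omega))
      rw [erase_right h', mergeCtx_nil, eq_replicate_one (n := n + k)
        (a := List.replicate i 1 ++ [1, 1] ++ List.replicate (n + k - 2 - i) 1) (by simp; omega)
        (by simp; omega), eq_replicate_one (n := r - 2 - i)
        (a := List.replicate (n + k - 2 - i) 1 ++ List.replicate a.sum 1 ++ []) (by simp; omega)
        (by simp), List.append_nil] at e
      rw [← List.replicate_add, dumbbellAt, e, ← mul_assoc]
      have e2 := mergeStrand_mul_dumbbell (r := r) (K := List.replicate n 1) (R := a) (k := k)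
        (t := i - n) (by omega) h'
      rw [← List.replicate_add, show n + (i - n) = i by omega,
        show k - 2 - (i - n) = n + k - 2 - i by omega] at e2
      rw [e2, smul_mul_assoc]

lemma dumbbellAt_mul_splitAll {a : List ℕ} {n i : ℕ} (h : IsStrands r (List.replicate n 1 ++ a))
    (hn : n ≤ i) (hi : i + 1 < r) (hs : SameBlock a (i - n) (i + 1 - n)) :
    dumbbellAt r i * splitAll r (List.replicate n 1) a =
      (2 : ℂ) • splitAll r (List.replicate n 1) a := by
  induction a generalizing n with
  | nil =>
    have := h.2
    simp at this
    omega
  | cons k a ih =>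
    have h' : IsStrands r (List.replicate n 1 ++ List.replicate k 1 ++ a) := by
      simp only [isStrands_append, List.mem_append, List.mem_cons, List.sum_append,
        List.sum_cons, List.sum_replicate, or_imp, forall_and, smul_eq_mul, mul_one] at h ⊢
      refine ⟨⟨h.1, fun x hx => ?_⟩, h.2.1.2, by omega⟩
      rw [(List.mem_replicate.1 hx).2]; exact one_pos
    rw [splitAll, ← mul_assoc]
    by_cases hk : n + k ≤ i
    · have h2 := sameBlock_tail hs (by omega) (by omega)
      rw [← List.replicate_add] at h' ⊢
      rw [ih h' hk (by rwa [show i - (n + k) = i - n - k by omega,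
        show i + 1 - (n + k) = i + 1 - n - k by omega]), smul_mul_assoc]
    · have hcut := hs k (Or.inr ⟨le_rfl, by simpa using isCut_zero a⟩)
      have hsum : n + k + a.sum = r := by simpa [add_assoc] using h'.2
      have h'' : IsStrands r (List.replicate i 1 ++ [1, 1] ++ List.replicate (n + k - 2 - i) 1 ++ a) := by
        rw [eq_replicate_one (n := n + k)
          (a := List.replicate i 1 ++ [1, 1] ++ List.replicate (n + k - 2 - i) 1) (by simp; omega)
          (by simp; omega), List.replicate_add]
        exact h'
      have e := (isLocal_dumbbell (r := r)).interchange_even (isLocal_splitCtx (r := r) a)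
        (List.replicate i 1) (List.replicate (n + k - 2 - i) 1) [] rfl
        (by rw [erase_right h']; simpa using h'')
      rw [erase_right h', splitCtx_nil, eq_replicate_one (n := n + k)
        (a := List.replicate i 1 ++ [1, 1] ++ List.replicate (n + k - 2 - i) 1) (by simp; omega)
        (by simp; omega), eq_replicate_one (n := r - 2 - i)
        (a := List.replicate (n + k - 2 - i) 1 ++ List.replicate a.sum 1 ++ []) (by simp; omega)
        (by simp), List.append_nil] at e
      rw [← List.replicate_add, dumbbellAt, ← e, mul_assoc]
      have e2 := dumbbell_mul_splitStrand (r := r) (K := List.replicate n 1) (R := a) (k := k)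
        (t := i - n) (by omega) h'
      rw [← List.replicate_add, show n + (i - n) = i by omega,
        show k - 2 - (i - n) = n + k - 2 - i by omega] at e2
      rw [e2, mul_smul_comm]

/-- The Young subgroup is generated by the simple transpositions that it contains, so that it is
enough to absorb crossings. -/
lemma mergeAll_mul_perm {a : List ℕ} (h : IsStrands r a) {σ : Equiv.Perm (Fin r)}
    (hσ : σ ∈ young r a) : mergeAll r [] a * (sergeevSystem r).perm σ = mergeAll r [] a := by
  have h2 := mergeAll_mul_ident (r := r) (K := []) (a := a) h
  rw [h.2, List.nil_append] at h2
  induction young_le_closure r a σ hσ using Submonoid.closure_induction with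
  | one => simp
  | mul x y hx hy ihx ihy =>
    have : ∀ z ∈ Submonoid.closure {τ | ∃ i : Fin (r - 1), SameBlock a i (i + 1) ∧ τ = simpleSwap r i},
        z ∈ young r a := by
      intro z hz
      have hle : Submonoid.closure {τ | ∃ i : Fin (r - 1), SameBlock a i (i + 1) ∧ τ = simpleSwap r i} ≤
          (young r a).toSubmonoid := by
        rw [Submonoid.closure_le]
        rintro _ ⟨i, hi, rfl⟩
        exact swap_mem_young hi
      exact hle hz
    rw [map_mul, ← mul_assoc, ihx (this x hx), ihy (this y hy)]
  | mem x hx =>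
    obtain ⟨i, hi, rfl⟩ := hx
    have h1 := mergeAll_mul_dumbbellAt (r := r) (a := a) (n := 0) (i := i) h (Nat.zero_le _) (by omega)
      (by simpa using hi)
    rw [List.replicate_zero] at h1
    rw [sergeevSystem_perm_simpleSwap, unitCrossing, mul_add, mul_sub, mul_one, mul_smul_comm, h1, h2]
    module

lemma perm_mul_splitAll {a : List ℕ} (h : IsStrands r a) {σ : Equiv.Perm (Fin r)}
    (hσ : σ ∈ young r a) : (sergeevSystem r).perm σ * splitAll r [] a = splitAll r [] a := by
  have h2 := ident_mul_splitAll (r := r) (K := []) (a := a) h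
  rw [h.2, List.nil_append] at h2
  induction young_le_closure r a σ hσ using Submonoid.closure_induction with
  | one => simp
  | mul x y hx hy ihx ihy =>
    have : ∀ z ∈ Submonoid.closure {τ | ∃ i : Fin (r - 1), SameBlock a i (i + 1) ∧ τ = simpleSwap r i},
        z ∈ young r a := by
      intro z hz
      have hle : Submonoid.closure {τ | ∃ i : Fin (r - 1), SameBlock a i (i + 1) ∧ τ = simpleSwap r i} ≤
          (young r a).toSubmonoid := by
        rw [Submonoid.closure_le]
        rintro _ ⟨i, hi, rfl⟩
        exact swap_mem_young hi
      exact hle hz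
    rw [map_mul, mul_assoc, ihy (this y hy), ihx (this x hx)]
  | mem x hx =>
    obtain ⟨i, hi, rfl⟩ := hx
    have h1 := dumbbellAt_mul_splitAll (r := r) (a := a) (n := 0) (i := i) h (Nat.zero_le _) (by omega)
      (by simpa using hi)
    rw [List.replicate_zero] at h1
    rw [sergeevSystem_perm_simpleSwap, unitCrossing, add_mul, sub_mul, one_mul, smul_mul_assoc, h1, h2]
    module

end Web

namespace Web

open FreeWeb (erase)

variable {r : ℕ}

/-! ### The web superalgebra is spanned by split, Sergeev diagram, merge -/

lemma isStrands_replicate_append {K a : List ℕ} {k : ℕ} (h : IsStrands r (K ++ k :: a)) :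
    IsStrands r (K ++ List.replicate k 1 ++ a) := by
  simp only [isStrands_append, List.mem_append, List.mem_cons, List.sum_append,
    List.sum_cons, List.sum_replicate, or_imp, forall_and, smul_eq_mul, mul_one] at h ⊢
  refine ⟨⟨h.1, fun x hx => ?_⟩, h.2.1.2, by omega⟩
  rw [(List.mem_replicate.1 hx).2]; exact one_pos

lemma merge_mul_mergeAll {K R : List ℕ} {k l : ℕ} (h : IsStrands r (K ++ k :: l :: R)) :
    merge r K k l R * mergeAll r K (k :: l :: R) = mergeAll r K ((k + l) :: R) := by
  have hpos := isStrands_append.1 h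
  have hk : 0 < k := hpos.2.1 k (by simp)
  have hl : 0 < l := hpos.2.1 l (by simp)
  have h1 : IsStrands r (K ++ List.replicate (k + l) 1 ++ R) := by
    have := isStrands_replicate_append (isStrands_replicate_append h)
    rwa [List.append_assoc K, ← List.replicate_add] at this
  rw [mergeAll, mergeAll, mergeAll, ← merge_mul_mergeStrand_mul_mergeStrand hk hl h1]
  rw [List.replicate_add, ← List.append_assoc]
  simp only [mul_assoc]

lemma dot_mul_mergeStrand {K R : List ℕ} {k : ℕ} (hk : 0 < k)
    (h : IsStrands r (K ++ List.replicate k 1 ++ R)) :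
    dot r K k R * mergeStrand r K k R = mergeStrand r K k R *
      ∑ j ∈ Finset.range k, dot r (K ++ List.replicate j 1) 1 (List.replicate (k - 1 - j) 1 ++ R) := by
  induction k, hk using Nat.le_induction generalizing K with
  | base =>
    have h1 := (isLocal_dot (r := r) one_pos).mul_ident (L := K) (R := R) (by simpa using h)
    have h2 := (isLocal_dot (r := r) one_pos).ident_mul (L := K) (R := R) (by simpa using h)
    simp only [List.append_assoc, List.cons_append, List.nil_append] at h1 h2
    simp [mergeStrand, merge_zero_right, ident_mul_ident_self, h1, h2]
  | succ k hk ih =>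
    have h1 : IsStrands r (K ++ [1] ++ List.replicate k 1 ++ R) := by
      simpa [List.replicate_succ] using h
    have h2 : IsStrands r (K ++ [1] ++ erase [k] ++ R) := (isLocal_mergeStrand k).isStrands h1
    rw [FreeWeb.erase_cons_of_pos hk] at h2
    have h3 := mk_rel (WebRel.dot_merge K k R (by simpa using h2))
    rw [map_mul, map_add, map_mul, map_mul] at h3
    change dot r K (1 + k) R * merge r K 1 k R =
      merge r K 1 k R * dot r K 1 (k :: R) + merge r K 1 k R * dot r (K ++ [1]) k R at h3
    have h4 := (isLocal_dot (r := r) one_pos).interchange_even (isLocal_mergeStrand (r := r) k)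
      K [] R rfl (by simpa using h1)
    rw [FreeWeb.erase_cons_of_pos hk] at h4
    simp only [FreeWeb.erase_nil, List.append_nil, List.nil_append, List.cons_append] at h4
    rw [mergeStrand, ← mul_assoc, add_comm k 1, h3, add_mul, mul_assoc, mul_assoc, ih h1, ← h4,
      add_comm 1 k, Finset.sum_range_succ', mul_add, add_comm]
    congr 1
    · rw [mul_assoc]
      congr 2
      refine Finset.sum_congr rfl fun j _ => ?_
      rw [show k + 1 - 1 - (j + 1) = k - 1 - j by omega]
      simp [List.replicate_succ]
    · simp [mul_assoc]

lemma mergeAll_mul_e {a : List ℕ} {n : ℕ} (h : IsStrands r (List.replicate n 1 ++ a)) :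
    mergeAll r (List.replicate n 1) a * (sergeevSystem r).e = mergeAll r (List.replicate n 1) a := by
  have h1 := mergeAll_mul_ident h
  have h2 : n + a.sum = r := by simpa using h.2
  rwa [← List.replicate_add, h2] at h1

lemma exists_dot_mul_mergeAll {n k : ℕ} {R : List ℕ} (h : IsStrands r (List.replicate n 1 ++ k :: R)) :
    ∃ y ∈ (sergeevSystem r).span, dot r (List.replicate n 1) k R *
      mergeAll r (List.replicate n 1) (k :: R) = mergeAll r (List.replicate n 1) (k :: R) * y := by
  have hk : 0 < k := h.1 k (by simp)
  have h1 := isStrands_replicate_append h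
  have hsum : n + (k + R.sum) = r := by simpa using h.2
  refine ⟨(∑ j ∈ Finset.range k, dot r (List.replicate (n + j) 1) 1
    (List.replicate (r - 1 - (n + j)) 1) : Web r), ?_, ?_⟩
  · refine Submodule.sum_mem _ fun j hj => ?_
    rw [Finset.mem_range] at hj
    exact (sergeevSystem r).dot_mem_span ⟨n + j, by omega⟩
  · rw [mergeAll, ← mul_assoc, dot_mul_mergeStrand hk h1, mul_assoc, mul_assoc]
    refine congrArg _ ?_
    rw [Finset.sum_mul, Finset.mul_sum]
    refine Finset.sum_congr rfl fun j hj => ?_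
    rw [Finset.mem_range] at hj
    have e := (isLocal_dot (r := r) one_pos).interchange_even (isLocal_mergeCtx (r := r) R)
      (List.replicate (n + j) 1) (List.replicate (k - 1 - j) 1) [] rfl
      (isStrands_ones (by simp; omega) (by simp; omega))
    rw [erase_right h1, mergeCtx_nil, eq_replicate_one (n := n + k)
      (a := List.replicate (n + j) 1 ++ [1] ++ List.replicate (k - 1 - j) 1) (by simp; omega)
      (by simp; omega), eq_replicate_one (n := r - 1 - (n + j))
      (a := List.replicate (k - 1 - j) 1 ++ List.replicate R.sum 1 ++ []) (by simp; omega)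
      (by simp), List.append_nil] at e
    rw [← List.replicate_add, ← List.replicate_add, e]

/-- A split below which the strand is completely merged: both are separated by a symmetrizer, which
lies in the Sergeev superalgebra. -/
lemma exists_split_mul_mergeAll {n k l : ℕ} {R : List ℕ}
    (h : IsStrands r (List.replicate n 1 ++ k :: l :: R)) :
    ∃ y ∈ (sergeevSystem r).span, split r (List.replicate n 1) k l R *
      mergeAll r (List.replicate n 1) ((k + l) :: R) =
        mergeAll r (List.replicate n 1) (k :: l :: R) * y := by
  have hk : 0 < k := h.1 k (by simp)
  have hl : 0 < l := h.1 l (by simp)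
  have hsum : n + (k + (l + R.sum)) = r := by simpa using h.2
  have h1 := isStrands_replicate_append h
  have h2 := isStrands_replicate_append h1
  have h3 : IsStrands r (List.replicate n 1 ++ [k + l] ++ R) := by
    have := (isLocal_merge (r := r) hk hl).isStrands (L := List.replicate n 1) (R := R)
      (by simpa using h)
    exact this
  have h4 : IsStrands r (List.replicate n 1 ++ List.replicate (k + l) 1 ++ R) := by
    rw [List.replicate_add, ← List.append_assoc]; exact h2
  have hz : (k.factorial : ℂ) * l.factorial ≠ 0 :=
    mul_ne_zero (Nat.cast_ne_zero.2 (Nat.factorial_ne_zero k))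
      (Nat.cast_ne_zero.2 (Nat.factorial_ne_zero l))
  refine ⟨((k.factorial : ℂ) * l.factorial)⁻¹ •
    bundle r (List.replicate n 1) (k + l) (List.replicate R.sum 1),
    Submodule.smul_mem _ _ (bundle_mem_span _ _ _ (by omega)), ?_⟩
  rw [mul_smul_comm, eq_inv_smul_iff₀ hz]
  -- `k! l!` times the split is a complete split followed by complete merges
  have e1 : ((k.factorial : ℂ) * l.factorial) • split r (List.replicate n 1) k l R =
      mergeStrand r (List.replicate n 1) k (l :: R) *
        mergeStrand r (List.replicate n 1 ++ List.replicate k 1) l R *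
        splitStrand r (List.replicate n 1) (k + l) R := by
    have f1 := mergeStrand_mul_splitStrand h1
    have f2 := mergeStrand_mul_splitStrand h2
    have f3 := (isLocal_mergeStrand (r := r) k).mul_ident h1
    have f4 := (isLocal_split (r := r) hk hl).ident_mul h3
    simp only [List.append_assoc, List.cons_append, List.nil_append] at f3 f4
    rw [← splitStrand_mul_splitStrand_mul_split hk hl h3, ← mul_assoc, ← mul_assoc,
      mul_assoc (mergeStrand r _ k _) (mergeStrand r _ l _), f2, mul_smul_comm, List.append_assoc, f3,
      smul_mul_assoc, smul_mul_assoc, f1, smul_mul_assoc, f4, smul_smul, mul_comm]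
  have e2 : bundle r (List.replicate n 1) (k + l) R *
      mergeAll r (List.replicate n 1 ++ List.replicate (k + l) 1) R =
      mergeAll r (List.replicate n 1 ++ List.replicate (k + l) 1) R *
      bundle r (List.replicate n 1) (k + l) (List.replicate R.sum 1) := by
    have e := (isLocal_bundle (r := r) (k + l)).interchange_even (isLocal_mergeCtx (r := r) R)
      (List.replicate n 1) [] [] rfl
      (isStrands_ones (by simp; omega) (by simp))
    rw [erase_right h2, mergeCtx_nil] at e
    simpa using e.symm
  rw [← smul_mul_assoc, e1, mergeAll, mergeAll, mergeAll, mul_assoc _ (splitStrand r _ _ _),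
    ← mul_assoc (splitStrand r _ _ _)]
  change _ * (bundle r (List.replicate n 1) (k + l) R * _) = _
  rw [e2, List.append_assoc (List.replicate n 1) (List.replicate k 1) (List.replicate l 1),
    ← List.replicate_add k l]
  simp only [mul_assoc]

lemma exists_piece_mul_mergeAll {n : ℕ} {x : Piece} {R : List ℕ}
    (h : IsStrands r (List.replicate n 1 ++ x.bot ++ R)) (htop : ∀ k ∈ x.top, 0 < k) :
    ∃ y ∈ (sergeevSystem r).span, piece r (List.replicate n 1) x R *
      mergeAll r (List.replicate n 1) (x.bot ++ R) =
        mergeAll r (List.replicate n 1) (x.top ++ R) * y := by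
  cases x with
  | merge k l =>
    have h' : IsStrands r (List.replicate n 1 ++ k :: l :: R) := by simpa [Piece.bot] using h
    have hk : 0 < k := h'.1 k (by simp)
    have hl : 0 < l := h'.1 l (by simp)
    refine ⟨_, (sergeevSystem r).e_mem_span, ?_⟩
    have h3 := (isLocal_merge (r := r) hk hl).isStrands (L := List.replicate n 1) (R := R)
      (by simpa using h')
    rw [← merge_eq_piece hk hl, mergeAll_mul_e (by simpa [Piece.top] using h3)]
    exact merge_mul_mergeAll h'
  | split k l =>
    have hk : 0 < k := htop k (by simp [Piece.top])
    have hl : 0 < l := htop l (by simp [Piece.top])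
    rw [← split_eq_piece hk hl]
    refine exists_split_mul_mergeAll ?_
    have h3 := (isLocal_split (r := r) hk hl).isStrands (L := List.replicate n 1) (R := R) h
    simpa using h3
  | dot k =>
    exact exists_dot_mul_mergeAll (by simpa [Piece.bot] using h)

lemma exists_piece_mul_mergeAll' {L : List ℕ} {x : Piece} {R : List ℕ}
    (h : IsStrands r (L ++ x.bot ++ R)) (htop : ∀ k ∈ x.top, 0 < k) :
    ∃ y ∈ (sergeevSystem r).span, piece r L x R * mergeAll r [] (L ++ x.bot ++ R) =
      mergeAll r [] (L ++ x.top ++ R) * y := by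
  have h' : IsStrands r (L ++ x.top ++ R) := by
    have := (IsLocal.piece (r := r) L R x htop).isStrands (L := []) (R := []) (by simpa using h)
    simpa using this
  have hL : erase L = L := FreeWeb.erase_eq_self fun y hy => h.1 y (by simp [hy])
  have h1 : IsStrands r (List.replicate L.sum 1 ++ x.bot ++ R) := by
    rw [List.append_assoc, isStrands_append] at h ⊢
    refine ⟨fun y hy => ?_, h.2.1, by simpa using h.2.2⟩
    rw [(List.mem_replicate.1 hy).2]; exact one_pos
  obtain ⟨y, hy, e⟩ := exists_piece_mul_mergeAll h1 htop
  refine ⟨y, hy, ?_⟩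
  have e2 := (isLocal_mergeCtx (r := r) L).interchange_even (IsLocal.piece (r := r) [] [] x htop)
    [] [] R (zero_mul _) (by simpa using h1)
  simp only [List.nil_append, List.append_nil, hL] at e2
  rw [List.append_assoc, mergeAll_append (K := []) (by simpa using h), ← mul_assoc, e2, mul_assoc,
    List.nil_append, e, ← mul_assoc, List.append_assoc,
    mergeAll_append (K := []) (by simpa using h'), List.nil_append]

/-- The webs that factor as complete splits, an element of the Sergeev superalgebra, and complete
merges. -/
def factored (r : ℕ) : Submodule ℂ (Web r) :=
  Submodule.span ℂ {w | ∃ a b : List ℕ, ∃ y ∈ (sergeevSystem r).span, IsStrands r a ∧ IsStrands r b ∧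
    w = mergeAll r [] b * y * splitAll r [] a}

lemma gen_mul_mem_factored (g : WebGen r) {w : Web r} (hw : w ∈ factored r) :
    mk r (FreeAlgebra.ι ℂ g) * w ∈ factored r := by
  induction hw using Submodule.span_induction with
  | zero => rw [mul_zero]; exact Submodule.zero_mem _
  | add x y _ _ hx hy => rw [mul_add]; exact add_mem hx hy
  | smul z x _ hx => rw [mul_smul_comm]; exact Submodule.smul_mem _ _ hx
  | mem w hw =>
    obtain ⟨a, b, y, hy, ha, hb, rfl⟩ := hw
    have hb1 := ident_mul_mergeAll (r := r) (K := []) (a := b) hb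
    rw [List.nil_append] at hb1
    cases g with
    | ident c hc =>
      rw [← freeIdent_of_isStrands hc]
      change ident r c * _ ∈ _
      by_cases hcb : c = b
      · rw [hcb, ← mul_assoc, ← mul_assoc, hb1]
        exact Submodule.subset_span ⟨a, b, y, hy, ha, hb, rfl⟩
      · rw [← hb1]
        simp only [← mul_assoc]
        rw [ident_mul_ident_of_ne hc hb hcb]
        simp
    | piece L x R h h' =>
      rw [← freePiece_of_isStrands h h']
      change piece r L x R * _ ∈ _
      by_cases hcb : L ++ x.bot ++ R = b
      · subst hcb
        obtain ⟨y', hy', e⟩ := exists_piece_mul_mergeAll' h fun k hk => h'.1 k (by simp [hk])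
        rw [← mul_assoc, ← mul_assoc, e]
        refine Submodule.subset_span ⟨a, L ++ x.top ++ R, y' * y,
          SergeevSystem.mul_mem_span _ hy' hy, ha, h', ?_⟩
        simp only [mul_assoc]
      · rw [← hb1, ← piece_mul_ident h]
        simp only [← mul_assoc]
        rw [mul_assoc (piece r L x R), ident_mul_ident_of_ne h hb hcb]
        simp

/-- Splitting and merging an identity completely yields the identity up to a nonzero scalar. -/
lemma one_mem_factored : (1 : Web r) ∈ factored r := by
  have h := mk_rel (WebRel.sum_ident (r := r))
  rw [map_one, map_sum] at h
  rw [← h]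
  refine Submodule.sum_mem _ fun a _ => ?_
  have ha : IsStrands r a.blocks := ⟨fun _ hx => a.blocks_pos hx, a.blocks_sum⟩
  obtain ⟨z, hz, e⟩ := exists_mergeAll_mul_splitAll (r := r) (K := []) (a := a.blocks) ha
  rw [List.nil_append] at e
  change ident r a.blocks ∈ _
  rw [← inv_smul_smul₀ hz (ident r a.blocks), ← e]
  refine Submodule.smul_mem _ _ (Submodule.subset_span
    ⟨_, _, _, (sergeevSystem r).e_mem_span, ha, ha, ?_⟩)
  have := mergeAll_mul_e (r := r) (n := 0) ha
  rw [List.replicate_zero] at this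
  rw [this]

theorem mem_factored (w : Web r) : w ∈ factored r := by
  obtain ⟨x, rfl⟩ := RingQuot.mkAlgHom_surjective ℂ (WebRel r) w
  have key : ∀ w ∈ factored r, mk r x * w ∈ factored r := by
    induction x using FreeAlgebra.induction with
    | grade0 z =>
      intro w hw
      rw [AlgHom.commutes, ← Algebra.smul_def]
      exact Submodule.smul_mem _ _ hw
    | grade1 g => exact fun w hw => gen_mul_mem_factored g hw
    | mul x y hx hy => intro w hw; rw [map_mul, mul_assoc]; exact hx _ (hy _ hw)
    | add x y hx hy => intro w hw; rw [map_add, add_mul]; exact add_mem (hx _ hw) (hy _ hw)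
  have := key 1 one_mem_factored
  rwa [mul_one] at this

/-- Each web from `a` to `b` is the composite of the complete splits of the strands of `a`, an
element of the Sergeev superalgebra, and the complete merges into the strands of `b`. -/
theorem exists_factorization {a b : List ℕ} (ha : IsStrands r a) (hb : IsStrands r b) (w : Web r) :
    ∃ y ∈ (sergeevSystem r).span,
      ident r b * w * ident r a = mergeAll r [] b * y * splitAll r [] a := by
  induction mem_factored w using Submodule.span_induction with
  | zero => exact ⟨0, Submodule.zero_mem _, by simp⟩
  | add x y _ _ hx hy =>
    obtain ⟨x', hx', ex⟩ := hx
    obtain ⟨y', hy', ey⟩ := hy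
    exact ⟨x' + y', add_mem hx' hy', by rw [mul_add, add_mul, ex, ey, mul_add, add_mul]⟩
  | smul z x _ hx =>
    obtain ⟨x', hx', ex⟩ := hx
    exact ⟨z • x', Submodule.smul_mem _ _ hx', by
      rw [mul_smul_comm, smul_mul_assoc, ex, mul_smul_comm, smul_mul_assoc]⟩
  | mem w hw =>
    obtain ⟨a', b', y, hy, ha', hb', rfl⟩ := hw
    have hb1 := ident_mul_mergeAll (r := r) (K := []) (a := b') hb'
    have ha1 := splitAll_mul_ident (r := r) (K := []) (a := a') ha'
    rw [List.nil_append] at hb1 ha1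
    by_cases hbb : b = b'
    · by_cases haa : a' = a
      · subst hbb haa
        refine ⟨y, hy, ?_⟩
        rw [← mul_assoc, ← mul_assoc, hb1, mul_assoc, ha1]
      · refine ⟨0, Submodule.zero_mem _, ?_⟩
        rw [← ha1]
        simp only [mul_assoc]
        rw [ident_mul_ident_of_ne ha' ha haa]
        simp
    · refine ⟨0, Submodule.zero_mem _, ?_⟩
      rw [← hb1]
      simp only [← mul_assoc]
      rw [ident_mul_ident_of_ne hb hb' hbb]
      simp

end Web

/-! ### Averages over Young subgroups and their coset sums -/

namespace SergeevSystem

open scoped Classical in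
/-- The idempotent of a group of permutations: the average of its elements. -/
noncomputable def avg {r : ℕ} {A : Type*} [Ring A] [Algebra ℂ A] (S : SergeevSystem r A)
    (H : Subgroup (Equiv.Perm (Fin r))) : A :=
  (Nat.card H : ℂ)⁻¹ • ∑ σ : H, S.perm σ

/-- The sum of the transpositions of `p` with the elements of `I`; the one of `p` with itself is the
identity. -/
noncomputable def transvSum {r : ℕ} {A : Type*} [Ring A] (S : SergeevSystem r A)
    (I : Finset (Fin r)) (p : Fin r) : A :=
  ∑ i ∈ I, S.perm (Equiv.swap i p)

/-- The sum of the dots at the positions in `I`. -/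
noncomputable def dotSum {r : ℕ} {A : Type*} [Ring A] (S : SergeevSystem r A)
    (I : Finset (Fin r)) : A :=
  ∑ i ∈ I, S.dot i

variable {r : ℕ} {A : Type*} [Ring A] (S : SergeevSystem r A)

lemma perm_mul_dotSum {σ : Equiv.Perm (Fin r)} {I : Finset (Fin r)} (h : ∀ i, σ i ∈ I ↔ i ∈ I) :
    S.perm σ * S.dotSum I = S.dotSum I * S.perm σ := by
  rw [dotSum, Finset.mul_sum, Finset.sum_mul]
  refine Finset.sum_equiv σ (fun i => (h i).symm) fun i _ => S.perm_mul_dot σ i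

lemma dotSum_mul_dotSum {I J : Finset (Fin r)} (h : Disjoint I J) :
    S.dotSum I * S.dotSum J = -(S.dotSum J * S.dotSum I) := by
  rw [dotSum, dotSum, Finset.sum_mul_sum, Finset.sum_mul_sum, Finset.sum_comm,
    ← Finset.sum_neg_distrib]
  refine Finset.sum_congr rfl fun j hj => ?_
  rw [← Finset.sum_neg_distrib]
  exact Finset.sum_congr rfl fun i hi => S.dot_mul_dot i j fun h' =>
    Finset.disjoint_left.1 h hi (h' ▸ hj)

/-- The square of an odd sum of anticommuting elements is the sum of their squares. -/
lemma dotSum_mul_self [Algebra ℂ A] (I : Finset (Fin r)) :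
    S.dotSum I * S.dotSum I = (I.card : ℂ) • S.e := by
  classical
  induction I using Finset.induction_on with
  | empty => simp [dotSum]
  | insert i I hi ih =>
    have h1 := S.dotSum_mul_dotSum (Finset.disjoint_singleton_left.2 hi)
    have h2 : S.dotSum {i} = S.dot i := by simp [dotSum]
    have h3 : S.dotSum (insert i I) = S.dot i + S.dotSum I := Finset.sum_insert hi
    rw [h2] at h1
    rw [h3, add_mul, mul_add, mul_add, S.dot_mul_self, ih, h1, Finset.card_insert_of_notMem hi]
    push_cast
    rw [add_smul, one_smul]
    abel

section Average

variable [Algebra ℂ A] {G H K : Subgroup (Equiv.Perm (Fin r))}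

lemma perm_mul_avg {σ : Equiv.Perm (Fin r)} (hσ : σ ∈ H) : S.perm σ * S.avg H = S.avg H := by
  classical
  rw [avg, mul_smul_comm, Finset.mul_sum]
  congr 1
  refine Fintype.sum_equiv (Equiv.mulLeft (⟨σ, hσ⟩ : H)) _ _ fun τ => ?_
  simp

lemma avg_mul_perm {σ : Equiv.Perm (Fin r)} (hσ : σ ∈ H) : S.avg H * S.perm σ = S.avg H := by
  classical
  rw [avg, smul_mul_assoc, Finset.sum_mul]
  congr 1
  refine Fintype.sum_equiv (Equiv.mulRight (⟨σ, hσ⟩ : H)) _ _ fun τ => ?_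
  simp

/-- An average of elements that are all equal. -/
lemma avg_mul_eq {x y : A} (h : ∀ σ ∈ H, S.perm σ * x = y) : S.avg H * x = y := by
  classical
  rw [avg, smul_mul_assoc, Finset.sum_mul, Finset.sum_congr rfl fun (σ : H) _ => h σ σ.2]
  have : (Nat.card H : ℂ) ≠ 0 := Nat.cast_ne_zero.2 Nat.card_pos.ne'
  rw [Finset.sum_const, Finset.card_univ, ← Nat.card_eq_fintype_card, ← Nat.cast_smul_eq_nsmul ℂ,
    inv_smul_smul₀ this]

lemma mul_avg_eq {x y : A} (h : ∀ σ ∈ H, x * S.perm σ = y) : x * S.avg H = y := by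
  classical
  rw [avg, mul_smul_comm, Finset.mul_sum, Finset.sum_congr rfl fun (σ : H) _ => h σ σ.2]
  have : (Nat.card H : ℂ) ≠ 0 := Nat.cast_ne_zero.2 Nat.card_pos.ne'
  rw [Finset.sum_const, Finset.card_univ, ← Nat.card_eq_fintype_card, ← Nat.cast_smul_eq_nsmul ℂ,
    inv_smul_smul₀ this]

lemma avg_mul_comm {x : A} (h : ∀ σ ∈ H, S.perm σ * x = x * S.perm σ) :
    S.avg H * x = x * S.avg H := by
  classical
  rw [avg, smul_mul_assoc, mul_smul_comm, Finset.mul_sum, Finset.sum_mul,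
    Finset.sum_congr rfl fun (σ : H) _ => h σ σ.2]

lemma avg_mul_avg_of_le (h : H ≤ K) : S.avg H * S.avg K = S.avg K :=
  S.avg_mul_eq fun _ hσ => S.perm_mul_avg (h hσ)

lemma avg_mul_avg_of_ge (h : H ≤ K) : S.avg K * S.avg H = S.avg K :=
  S.mul_avg_eq fun _ hσ => S.avg_mul_perm (h hσ)

lemma avg_mul_self : S.avg H * S.avg H = S.avg H := S.avg_mul_avg_of_le le_rfl

/-- The average of a product of two subgroups that is again a subgroup. -/
lemma avg_mul_avg (hH : H ≤ G) (hK : K ≤ G) (h : ∀ g ∈ G, ∃ x ∈ H, ∃ y ∈ K, g = x * y) :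
    S.avg H * S.avg K = S.avg G := by
  have : S.avg H * (S.avg G * S.avg K) = S.avg G := by
    rw [S.avg_mul_avg_of_ge hK, S.avg_mul_avg_of_le hH]
  rw [← this, ← mul_assoc]
  refine Eq.symm ?_
  have h1 : ∀ σ ∈ G, S.avg H * S.perm σ * S.avg K = S.avg H * S.avg K := by
    intro g hg
    obtain ⟨x, hx, y, hy, rfl⟩ := h g hg
    rw [map_mul, ← mul_assoc, S.avg_mul_perm hx, mul_assoc, S.perm_mul_avg hy]
  have h2 : S.avg H * S.avg G * S.avg K = S.avg H * (S.avg G * S.avg K) := mul_assoc _ _ _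
  rw [h2]
  classical
  have h3 : ∀ x : A, S.avg G * x = (Nat.card G : ℂ)⁻¹ • ∑ σ : G, S.perm σ * x := by
    intro x
    rw [avg, smul_mul_assoc, Finset.sum_mul]
  have : (Nat.card G : ℂ) ≠ 0 := Nat.cast_ne_zero.2 Nat.card_pos.ne'
  rw [h3, mul_smul_comm, Finset.mul_sum,
    Finset.sum_congr rfl fun (σ : G) _ => (mul_assoc _ _ _).symm.trans (h1 σ σ.2), Finset.sum_const,
    Finset.card_univ, ← Nat.card_eq_fintype_card, ← Nat.cast_smul_eq_nsmul ℂ, inv_smul_smul₀ this]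

/-- The transpositions of `p` with the points of its orbit `I` under `K` represent the cosets of the
stabilizer `H` of `p`. -/
lemma card_smul_avg {I : Finset (Fin r)} {p : Fin r} (hp : p ∈ I)
    (hswap : ∀ i ∈ I, Equiv.swap i p ∈ K) (hI : ∀ σ ∈ K, σ p ∈ I)
    (hH : ∀ σ, σ ∈ H ↔ σ ∈ K ∧ σ p = p) :
    (I.card : ℂ) • S.avg K = S.transvSum I p * S.avg H := by
  classical
  let E : I × H ≃ K :=
    { toFun := fun x => ⟨Equiv.swap (x.1 : Fin r) p * (x.2 : Equiv.Perm (Fin r)), K.mul_mem (hswap _ x.1.2) ((hH _).1 x.2.2).1⟩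
      invFun := fun σ => (⟨σ.1 p, hI _ σ.2⟩, ⟨Equiv.swap (σ.1 p) p * σ.1, (hH _).2
        ⟨K.mul_mem (hswap _ (hI _ σ.2)) σ.2, by simp⟩⟩)
      left_inv := fun x => by
        have := ((hH _).1 x.2.2).2
        ext1
        · exact Subtype.ext (by simp [this])
        · exact Subtype.ext (by simp [this, ← mul_assoc])
      right_inv := fun σ => Subtype.ext (by simp [← mul_assoc]) }
  have hcard : Nat.card K = I.card * Nat.card H := by
    rw [← Nat.card_congr E, Nat.card_prod]; simp
  have hI0 : (I.card : ℂ) ≠ 0 := Nat.cast_ne_zero.2 (Finset.card_pos.2 ⟨p, hp⟩).ne'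
  rw [avg, avg, hcard, smul_smul, Nat.cast_mul, mul_inv, ← mul_assoc, mul_inv_cancel₀ hI0, one_mul,
    mul_smul_comm]
  congr 1
  rw [transvSum, Finset.sum_mul_sum, ← Finset.sum_coe_sort I, ← Fintype.sum_prod_type',
    ← Fintype.sum_equiv E (fun x => S.perm (E x)) _ fun x => rfl]
  simp [E]

end Average

section Ladder

/-! ### Identities between coset sums -/

variable {S} {X Y : Finset (Fin r)} {p q : Fin r} {x : A}

lemma perm_swap_mul_perm_swap_mul (hXY : Disjoint X Y) (hp : p ∈ X)
    (hX : ∀ i ∈ X, ∀ j ∈ X, S.perm (Equiv.swap i j) * x = x) {i j : Fin r} (hi : i ∈ X)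
    (hj : j ∈ Y) :
    S.perm (Equiv.swap i p) * (S.perm (Equiv.swap j p) * x) = S.perm (Equiv.swap i j) * x := by
  have hij : j ≠ i := fun h => Finset.disjoint_left.1 hXY hi (h ▸ hj)
  have hjp : j ≠ p := fun h => Finset.disjoint_left.1 hXY hp (h ▸ hj)
  have : Equiv.swap i p * Equiv.swap j p = Equiv.swap i j * Equiv.swap i p := by
    rw [Equiv.mul_swap_eq_swap_mul, Equiv.swap_apply_of_ne_of_ne hij hjp, Equiv.swap_apply_right,
      Equiv.swap_comm]
  rw [← mul_assoc, ← map_mul, this, map_mul, mul_assoc, hX i hi p hp]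

lemma transvSum_insert (hp : p ∉ Y) :
    S.transvSum (insert p Y) p = 1 + S.transvSum Y p := by
  rw [transvSum, Finset.sum_insert hp, Equiv.swap_self, ← Equiv.Perm.one_def, map_one, transvSum]

lemma transvSum_mul_transvSum [Algebra ℂ A] (hXY : Disjoint X Y) (hp : p ∈ X)
    (hX : ∀ i ∈ X, ∀ j ∈ X, S.perm (Equiv.swap i j) * x = x) :
    S.transvSum X p * (S.transvSum (insert p Y) p * x) =
      (X.card : ℂ) • x + ∑ i ∈ X, ∑ j ∈ Y, S.perm (Equiv.swap i j) * x := by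
  rw [transvSum_insert (Finset.disjoint_left.1 hXY hp), add_mul, one_mul, mul_add]
  congr 1
  · rw [transvSum, Finset.sum_mul, Finset.sum_congr rfl fun i hi => hX i hi p hp, Finset.sum_const,
      Nat.cast_smul_eq_nsmul]
  · rw [transvSum, transvSum, Finset.sum_mul, Finset.sum_mul]
    refine Finset.sum_congr rfl fun i hi => ?_
    rw [Finset.mul_sum]
    exact Finset.sum_congr rfl fun j hj => perm_swap_mul_perm_swap_mul hXY hp hX hi hj

/-- The ladders `EF` and `FE` on two blocks `X`, `Y` give the same double sum of transpositions,
besides the terms that come from the trivial transpositions. -/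
lemma transvSum_commutator [Algebra ℂ A] (hXY : Disjoint X Y) (hp : p ∈ X) (hq : q ∈ Y)
    (hX : ∀ i ∈ X, ∀ j ∈ X, S.perm (Equiv.swap i j) * x = x)
    (hY : ∀ i ∈ Y, ∀ j ∈ Y, S.perm (Equiv.swap i j) * x = x) :
    S.transvSum X p * (S.transvSum (insert p Y) p * x) -
      S.transvSum Y q * (S.transvSum (insert q X) q * x) = ((X.card : ℂ) - Y.card) • x := by
  rw [transvSum_mul_transvSum hXY hp hX, transvSum_mul_transvSum hXY.symm hq hY, Finset.sum_comm,
    sub_smul]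
  simp only [Equiv.swap_comm]
  abel

/-- The version of `transvSum_commutator` with a dot on one of the two rungs. -/
lemma transvSum_dot_commutator (hXY : Disjoint X Y) (hp : p ∈ X) (hq : q ∈ Y)
    (hX : ∀ i ∈ X, ∀ j ∈ X, S.perm (Equiv.swap i j) * x = x)
    (hY : ∀ i ∈ Y, ∀ j ∈ Y, S.perm (Equiv.swap i j) * x = x) :
    S.transvSum X p * (S.dot p * (S.transvSum (insert p Y) p * x)) -
      S.transvSum Y q * (S.transvSum (insert q X) q * (S.dot q * x)) =
        S.dotSum X * x - S.dotSum Y * x := by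
  have h1 : S.transvSum X p * (S.dot p * (S.transvSum (insert p Y) p * x)) =
      S.dotSum X * x + ∑ i ∈ X, ∑ j ∈ Y, S.dot i * (S.perm (Equiv.swap i j) * x) := by
    rw [transvSum_insert (Finset.disjoint_left.1 hXY hp), add_mul, one_mul, mul_add, mul_add]
    congr 1
    · rw [transvSum, Finset.sum_mul, dotSum, Finset.sum_mul]
      refine Finset.sum_congr rfl fun i hi => ?_
      rw [← mul_assoc, perm_mul_dot, Equiv.swap_apply_right, mul_assoc, hX i hi p hp]
    · rw [transvSum, transvSum, Finset.sum_mul, Finset.sum_mul]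
      refine Finset.sum_congr rfl fun i hi => ?_
      rw [Finset.mul_sum, Finset.mul_sum]
      refine Finset.sum_congr rfl fun j hj => ?_
      rw [← mul_assoc, perm_mul_dot, Equiv.swap_apply_right, mul_assoc,
        perm_swap_mul_perm_swap_mul hXY hp hX hi hj]
  have h2 : S.transvSum Y q * (S.transvSum (insert q X) q * (S.dot q * x)) =
      S.dotSum Y * x + ∑ j ∈ Y, ∑ i ∈ X, S.dot i * (S.perm (Equiv.swap j i) * x) := by
    rw [transvSum_insert (Finset.disjoint_right.1 hXY hq), add_mul, one_mul, mul_add]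
    congr 1
    · rw [transvSum, Finset.sum_mul, dotSum, Finset.sum_mul]
      refine Finset.sum_congr rfl fun i hi => ?_
      rw [← mul_assoc, perm_mul_dot, Equiv.swap_apply_right, mul_assoc, hY i hi q hq]
    · rw [transvSum, transvSum, Finset.sum_mul, Finset.sum_mul]
      refine Finset.sum_congr rfl fun j hj => ?_
      rw [Finset.mul_sum]
      refine Finset.sum_congr rfl fun i hi => ?_
      have hij : i ≠ j := fun h => Finset.disjoint_left.1 hXY hi (h ▸ hj)
      have hiq : i ≠ q := fun h => Finset.disjoint_left.1 hXY hi (h ▸ hq)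
      rw [← mul_assoc (S.perm (Equiv.swap i q)), perm_mul_dot, Equiv.swap_apply_right, mul_assoc,
        ← mul_assoc, perm_mul_dot, Equiv.swap_apply_of_ne_of_ne hij hiq, mul_assoc,
        perm_swap_mul_perm_swap_mul hXY.symm hq hY hj hi]
  rw [h1, h2, Finset.sum_comm]
  simp only [Equiv.swap_comm]
  abel

lemma transvSum_insert_swap {I : Finset (Fin r)} (hp : p ∉ I) :
    S.transvSum (insert p I) q = S.perm (Equiv.swap p q) + S.transvSum I q := by
  rw [transvSum, Finset.sum_insert hp, transvSum]

lemma transvSum_comm {I J : Finset (Fin r)} (hIJ : Disjoint I J) (hp : p ∈ I) (hq : q ∈ J) :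
    S.transvSum I p * S.transvSum J q = S.transvSum J q * S.transvSum I p := by
  rw [transvSum, transvSum, Finset.sum_mul_sum, Finset.sum_mul_sum, Finset.sum_comm]
  refine Finset.sum_congr rfl fun j hj => Finset.sum_congr rfl fun i hi => ?_
  have hne : ∀ {a b : Fin r}, a ∈ I → b ∈ J → a ≠ b := fun ha hb h =>
    Finset.disjoint_left.1 hIJ ha (h ▸ hb)
  have h1 : Equiv.swap i p * Equiv.swap j q = Equiv.swap j q * Equiv.swap i p := by
    rw [Equiv.mul_swap_eq_swap_mul, Equiv.swap_apply_of_ne_of_ne (hne hi hj).symm (hne hp hj).symm,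
      Equiv.swap_apply_of_ne_of_ne (hne hi hq).symm (hne hp hq).symm]
  rw [← map_mul, h1, map_mul]

lemma dot_mul_transvSum {I : Finset (Fin r)} (hq : q ∈ I) (hp : p ∉ I) :
    S.dot p * S.transvSum I q = S.transvSum I q * S.dot p := by
  rw [transvSum, Finset.mul_sum, Finset.sum_mul]
  refine Finset.sum_congr rfl fun i hi => ?_
  rw [perm_mul_dot, Equiv.swap_apply_of_ne_of_ne (by rintro rfl; exact hp hi) (by rintro rfl; exact hp hq)]

variable {I J : Finset (Fin r)}

lemma transvSum_double (hIJ : Disjoint I J) (hp : p ∈ I) (hq : q ∈ J) :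
    S.transvSum I p * S.transvSum (insert p J) q - S.transvSum J q * S.transvSum I p =
      S.transvSum I p * S.perm (Equiv.swap p q) := by
  rw [transvSum_insert_swap (Finset.disjoint_left.1 hIJ hp), mul_add, transvSum_comm hIJ hp hq]
  abel

/-- The left hand side is that of `transvSum_double`. -/
lemma transvSum_double_dots (hIJ : Disjoint I J) (hp : p ∈ I) (hq : q ∈ J) (he : S.e = 1) :
    S.transvSum I p * S.transvSum (insert p J) q - S.transvSum J q * S.transvSum I p =
      S.transvSum I p * S.dot p * (S.transvSum (insert p J) q * S.dot q) +
        S.transvSum J q * S.dot q * (S.transvSum I p * S.dot p) := by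
  have hpJ := Finset.disjoint_left.1 hIJ hp
  have hqI := Finset.disjoint_right.1 hIJ hq
  have hpq : p ≠ q := fun h => hpJ (h ▸ hq)
  have h1 : S.transvSum I p * S.dot p * (S.transvSum J q * S.dot q) =
      -(S.transvSum J q * S.dot q * (S.transvSum I p * S.dot p)) := by
    calc _ = S.transvSum I p * (S.dot p * S.transvSum J q) * S.dot q := by
          simp only [mul_assoc]
      _ = S.transvSum J q * S.transvSum I p * (S.dot p * S.dot q) := by
          rw [dot_mul_transvSum hq hpJ, ← transvSum_comm hIJ hp hq]; simp only [mul_assoc]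
      _ = -(S.transvSum J q * (S.transvSum I p * S.dot q) * S.dot p) := by
          rw [S.dot_mul_dot p q hpq]; simp only [mul_assoc, mul_neg]
      _ = _ := by rw [← dot_mul_transvSum hp hqI]; simp only [mul_assoc]
  have h2 : S.dot p * (S.perm (Equiv.swap p q) * S.dot q) = S.perm (Equiv.swap p q) := by
    rw [perm_mul_dot, Equiv.swap_apply_right, ← mul_assoc, dot_mul_self, he, one_mul]
  rw [transvSum_double hIJ hp hq, transvSum_insert_swap hpJ, add_mul, mul_add, h1,
    mul_assoc (S.transvSum I p) (S.dot p), h2]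
  abel

lemma transvSum_double_dot (hIJ : Disjoint I J) (hp : p ∈ I) (hq : q ∈ J) :
    S.transvSum I p * (S.transvSum (insert p J) q * S.dot q) -
        S.transvSum J q * S.dot q * S.transvSum I p =
      S.transvSum I p * S.dot p * S.transvSum (insert p J) q -
        S.transvSum J q * (S.transvSum I p * S.dot p) := by
  have hpJ := Finset.disjoint_left.1 hIJ hp
  have hqI := Finset.disjoint_right.1 hIJ hq
  rw [transvSum_insert_swap hpJ, mul_assoc (S.transvSum J q), dot_mul_transvSum hp hqI,
    mul_assoc (S.transvSum I p) (S.dot p), mul_add (S.dot p), dot_mul_transvSum hq hpJ, add_mul,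
    mul_add, mul_add, perm_mul_dot, Equiv.swap_apply_right, ← mul_assoc _ _ (S.dot q),
    ← mul_assoc _ _ (S.dot q), ← mul_assoc _ (S.transvSum J q) (S.dot p),
    ← mul_assoc _ _ (S.dot p), transvSum_comm hIJ hp hq]
  abel

end Ladder

end SergeevSystem

/-! ### The blocks of a tuple -/

/-- The `k` positions from `x` on. -/
def block (r x k : ℕ) : Finset (Fin r) := Finset.univ.filter fun p => x ≤ p ∧ p < x + k

@[simp] lemma mem_block {r x k : ℕ} {p : Fin r} : p ∈ block r x k ↔ x ≤ p ∧ p < x + k := by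
  simp [block]

lemma card_block {r x k : ℕ} (h : x + k ≤ r) : (block r x k).card = k := by
  have : (block r x k).map Fin.valEmbedding = Finset.Ico x (x + k) := by
    ext p
    simp only [Finset.mem_map, mem_block, Fin.valEmbedding_apply, Finset.mem_Ico]
    refine ⟨?_, fun hp => ⟨⟨p, by omega⟩, hp, rfl⟩⟩
    rintro ⟨q, hq, rfl⟩
    exact hq
  rw [← Finset.card_map, this]
  simp

lemma disjoint_block {r x k y l : ℕ} (h : x + k ≤ y) : Disjoint (block r x k) (block r y l) :=
  Finset.disjoint_left.2 fun p hp hq => by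
    rw [mem_block] at hp hq; omega

lemma block_add_left (r x k l : ℕ) :
    block r x (k + l) = (block r x k).disjUnion (block r (x + k) l) (disjoint_block le_rfl) := by
  ext p
  simp only [mem_block, Finset.mem_disjUnion]
  omega

/-- The positions `x, …, x + k - 1` form a block of the tuple `a`. -/
structure IsBlock (a : List ℕ) (x k : ℕ) : Prop where
  left : IsCut a x
  right : IsCut a (x + k)
  mid : ∀ d, IsCut a d → d ≤ x ∨ x + k ≤ d

lemma isBlock_append (L : List ℕ) (k : ℕ) (R : List ℕ) : IsBlock (L ++ k :: R) L.sum k where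
  left := (isCut_append _ _ _).2 (Or.inl (isCut_sum L))
  right := (isCut_append _ _ _).2 (Or.inr ⟨by omega, (isCut_cons _ _ _).2
    (Or.inr ⟨by omega, by simpa using isCut_zero R⟩)⟩)
  mid d hd := by
    rcases (isCut_append _ _ _).1 hd with h | ⟨h, h'⟩
    · exact Or.inl (isCut_le_sum h)
    · rcases (isCut_cons _ _ _).1 h' with h' | h'
      · omega
      · omega

namespace IsBlock

variable {r x k : ℕ} {a : List ℕ}

lemma sameBlock (h : IsBlock a x k) {p q : Fin r} (hp : p ∈ block r x k) (hq : q ∈ block r x k) :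
    SameBlock a p q := by
  intro d hd
  rw [mem_block] at hp hq
  have := h.mid d hd
  omega

lemma apply_mem_iff (h : IsBlock a x k) {σ : Equiv.Perm (Fin r)} (hσ : σ ∈ young r a) (p : Fin r) :
    σ p ∈ block r x k ↔ p ∈ block r x k := by
  rw [mem_block, mem_block]
  have h1 := hσ p _ h.left
  have h2 := hσ p _ h.right
  omega

end IsBlock

namespace SergeevSystem

variable {r : ℕ} {A : Type*} [Ring A] [Algebra ℂ A] (S : SergeevSystem r A)

/-- The idempotent of the Young subgroup of a tuple. -/
noncomputable def youngAvg (a : List ℕ) : A := S.avg (young r a)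

lemma youngAvg_congr {a b : List ℕ} (h : ∀ d, IsCut a d ↔ IsCut b d) :
    S.youngAvg a = S.youngAvg b := by
  rw [youngAvg, youngAvg, young_congr h]

lemma youngAvg_erase (a : List ℕ) : S.youngAvg (FreeWeb.erase a) = S.youngAvg a :=
  S.youngAvg_congr (isCut_erase a)

lemma youngAvg_mul_of_le {a b : List ℕ} (h : ∀ d, IsCut b d → IsCut a d) :
    S.youngAvg a * S.youngAvg b = S.youngAvg b :=
  S.avg_mul_avg_of_le (young_le_of_isCut h)

lemma youngAvg_mul_of_ge {a b : List ℕ} (h : ∀ d, IsCut b d → IsCut a d) :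
    S.youngAvg b * S.youngAvg a = S.youngAvg b :=
  S.avg_mul_avg_of_ge (young_le_of_isCut h)

lemma youngAvg_mul_self (a : List ℕ) : S.youngAvg a * S.youngAvg a = S.youngAvg a :=
  S.avg_mul_self

lemma youngAvg_mul_dotSum {a : List ℕ} {x k : ℕ} (h : IsBlock a x k) :
    S.youngAvg a * S.dotSum (block r x k) = S.dotSum (block r x k) * S.youngAvg a :=
  S.avg_mul_comm fun _ hσ => S.perm_mul_dotSum fun i => h.apply_mem_iff hσ i

lemma perm_swap_mul_youngAvg {a : List ℕ} {x k : ℕ} (h : IsBlock a x k) :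
    ∀ i ∈ block r x k, ∀ j ∈ block r x k,
      S.perm (Equiv.swap i j) * S.youngAvg a = S.youngAvg a := fun _ hi _ hj =>
  S.perm_mul_avg (swap_mem_young (h.sameBlock hi hj))

/-- Splitting off the first or the last position `p` of a block of `a` (the result being `b`)
amounts to the choice of a coset of the smaller Young subgroup. -/
lemma card_smul_youngAvg {a b : List ℕ} {x k : ℕ} {p : Fin r} (hblk : IsBlock a x k)
    (hp : p ∈ block r x k) (hx : x + k ≤ r) (hc : IsCut a p ∨ IsCut a (p + 1))
    (hb : ∀ d, IsCut b d ↔ IsCut a d ∨ d = p ∨ d = p + 1) :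
    (k : ℂ) • S.youngAvg a = S.transvSum (block r x k) p * S.youngAvg b := by
  have := S.card_smul_avg (I := block r x k) (p := p) (K := young r a) (H := young r b) hp
    (fun i hi => swap_mem_young (hblk.sameBlock hi hp)) (fun σ hσ => (hblk.apply_mem_iff hσ p).2 hp)
    ?_
  · rwa [card_block hx] at this
  intro σ
  constructor
  · intro hσ
    refine ⟨young_le_of_isCut (fun d hd => (hb d).2 (Or.inl hd)) hσ, ?_⟩
    have h1 := hσ p p ((hb _).2 (Or.inr (Or.inl rfl)))
    have h2 := hσ p (p + 1) ((hb _).2 (Or.inr (Or.inr rfl)))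
    exact Fin.ext (by omega)
  · rintro ⟨hσ, hσp⟩ q d hd
    have hq : (q : ℕ) = p ↔ (σ q : ℕ) = p := by
      rw [← Fin.ext_iff, ← Fin.ext_iff]
      conv_rhs => rw [← hσp, σ.injective.eq_iff]
    rcases (hb d).1 hd with hd | rfl | rfl
    · exact hσ q d hd
    · rcases hc with hc | hc
      · exact hσ q _ hc
      · have := hσ q _ hc
        omega
    · rcases hc with hc | hc
      · have := hσ q _ hc
        omega
      · exact hσ q _ hc

/-- A leftward rung labelled `1`. -/
lemma youngAvg_rungL {L R : List ℕ} {k l : ℕ} {p : Fin r} (hp : (p : ℕ) = L.sum + k) :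
    ((k + 1 : ℕ) : ℂ) • S.youngAvg (L ++ [k + 1] ++ l :: R) =
      S.transvSum (block r L.sum (k + 1)) p * S.youngAvg (L ++ [k, 1] ++ l :: R) := by
  have hblk : IsBlock (L ++ [k + 1] ++ l :: R) L.sum (k + 1) := by
    simpa using isBlock_append L (k + 1) (l :: R)
  have hc : IsCut (L ++ [k + 1] ++ l :: R) (p + 1) := by
    rw [hp, add_assoc]; exact hblk.right
  refine S.card_smul_youngAvg hblk (by simp; omega) (by omega) (Or.inr hc) fun d => ?_
  rw [isCut_merge, hp]
  refine ⟨Or.imp_right Or.inl, ?_⟩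
  rintro (h | h | rfl)
  · exact Or.inl h
  · exact Or.inr h
  · exact Or.inl (hp ▸ hc)

/-- A rightward rung labelled `1`. -/
lemma youngAvg_rungR {L R : List ℕ} {l : ℕ} {p : Fin r} (hp : (p : ℕ) = L.sum)
    (hl : L.sum + (1 + l) ≤ r) :
    ((1 + l : ℕ) : ℂ) • S.youngAvg (L ++ [1 + l] ++ R) =
      S.transvSum (block r L.sum (1 + l)) p * S.youngAvg (L ++ [1, l] ++ R) := by
  have hblk : IsBlock (L ++ [1 + l] ++ R) L.sum (1 + l) := by
    simpa using isBlock_append L (1 + l) R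
  refine S.card_smul_youngAvg hblk (by simp; omega) hl (Or.inl (hp ▸ hblk.left)) fun d => ?_
  rw [isCut_merge, hp]
  refine ⟨Or.imp_right Or.inr, ?_⟩
  rintro (h | rfl | h)
  · exact Or.inl h
  · exact Or.inl hblk.left
  · exact Or.inr h

end SergeevSystem

/-- An element of the Young subgroup of a concatenation acts separately on the two parts. -/
lemma exists_mul_of_mem_young_append {r : ℕ} {A A' B B' : List ℕ} (hA : A.sum = A'.sum)
    {g : Equiv.Perm (Fin r)} (hg : g ∈ young r (A' ++ B')) :
    ∃ x ∈ young r (A ++ B'), ∃ y ∈ young r (A' ++ B), g = x * y := by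
  have hcut : IsCut (A' ++ B') A'.sum := (isCut_append _ _ _).2 (Or.inl (isCut_sum A'))
  have hP : ∀ p : Fin r, (g p : ℕ) < A'.sum ↔ (p : ℕ) < A'.sum := fun p => (hg p _ hcut).symm
  have hgi : ∀ p, g (g⁻¹ p) = p := fun p => g.apply_symm_apply p
  let P : Fin r → Prop := fun p => (p : ℕ) < A'.sum
  let y : Equiv.Perm (Fin r) := Equiv.Perm.ofSubtype (g.subtypePerm (p := P) hP)
  have hy1 : ∀ p : Fin r, (p : ℕ) < A'.sum → y p = g p := fun p hp => by
    rw [Equiv.Perm.ofSubtype_apply_of_mem _ (show P p from hp)]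
    rfl
  have hy2 : ∀ p : Fin r, ¬ (p : ℕ) < A'.sum → y p = p := fun p hp =>
    Equiv.Perm.ofSubtype_apply_of_not_mem _ hp
  have hx1 : ∀ p : Fin r, (p : ℕ) < A'.sum → (g * y⁻¹) p = p := fun p hp => by
    have h1 : (g⁻¹ p : ℕ) < A'.sum := by
      rw [← hP, hgi]; exact hp
    have h2 : y⁻¹ p = g⁻¹ p := by
      rw [Equiv.Perm.inv_eq_iff_eq, hy1 _ h1, hgi]
    rw [Equiv.Perm.mul_apply, h2, hgi]
  have hx2 : ∀ p : Fin r, ¬ (p : ℕ) < A'.sum → (g * y⁻¹) p = g p := fun p hp => by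
    have h2 : y⁻¹ p = p := by rw [Equiv.Perm.inv_eq_iff_eq, hy2 _ hp]
    rw [Equiv.Perm.mul_apply, h2]
  refine ⟨g * y⁻¹, ?_, y, ?_, by simp⟩
  · intro p
    by_cases hp : (p : ℕ) < A'.sum
    · rw [hx1 p hp]; exact SameBlock.refl _ _
    · rw [hx2 p hp]
      intro d hd
      rcases (isCut_append _ _ _).1 hd with hd | hd
      · have := hP p
        have := isCut_le_sum hd
        omega
      · exact hg p d ((isCut_append _ _ _).2 (Or.inr (hA ▸ hd)))
  · intro p
    by_cases hp : (p : ℕ) < A'.sum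
    · rw [hy1 p hp]
      intro d hd
      rcases (isCut_append _ _ _).1 hd with hd | hd
      · exact hg p d ((isCut_append _ _ _).2 (Or.inl hd))
      · have := hP p
        omega
    · rw [hy2 p hp]; exact SameBlock.refl _ _

namespace SergeevSystem

variable {r : ℕ} {A : Type*} [Ring A] [Algebra ℂ A] (S : SergeevSystem r A) {a a' b b' : List ℕ}

/-- The average over a Young subgroup can be taken over its factors one after the other. -/
lemma youngAvg_append (h : a.sum = a'.sum)
    (ha : ∀ d, IsCut a' d → IsCut a d) (hb : ∀ d, IsCut b' d → IsCut b d) :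
    S.youngAvg (a ++ b') * S.youngAvg (a' ++ b) = S.youngAvg (a' ++ b') ∧
      S.youngAvg (a' ++ b) * S.youngAvg (a ++ b') = S.youngAvg (a' ++ b') := by
  have h1 : young r (a ++ b') ≤ young r (a' ++ b') := young_le_of_isCut fun d hd => by
    rw [isCut_append, h]
    exact ((isCut_append _ _ _).1 hd).imp_left (ha d)
  have h2 : young r (a' ++ b) ≤ young r (a' ++ b') := young_le_of_isCut fun d hd => by
    rw [isCut_append]
    exact ((isCut_append _ _ _).1 hd).imp_right (And.imp_right (hb _))
  refine ⟨S.avg_mul_avg h1 h2 fun g hg => exists_mul_of_mem_young_append h hg,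
    S.avg_mul_avg h2 h1 fun g hg => ?_⟩
  obtain ⟨x, hx, y, hy, hxy⟩ := exists_mul_of_mem_young_append h (inv_mem hg)
  exact ⟨y⁻¹, inv_mem hy, x⁻¹, inv_mem hx, by rw [← mul_inv_rev, ← hxy, inv_inv]⟩

end SergeevSystem

/-! ### The representation attached to a Sergeev system -/

/-- The thickness of the strand on which all strands of a local web come together. -/
def Piece.strand : Piece → ℕ
  | .merge k l => k + l
  | .split k l => k + l
  | .dot k => k

lemma FreeWeb.erase_cons_zero (k : ℕ) (R : List ℕ) : erase (k :: 0 :: R) = erase (k :: R) := by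
  rw [← List.singleton_append, erase_append, erase_zero_cons, ← erase_append, List.singleton_append]

lemma Piece.sum_bot (x : Piece) : x.bot.sum = x.strand := by
  cases x <;> simp [bot, strand]

lemma Piece.isCut_bot (x : Piece) {L R : List ℕ} {d : ℕ} (h : IsCut (L ++ [x.strand] ++ R) d) :
    IsCut (L ++ x.bot ++ R) d := by
  cases x with
  | merge k l => exact (isCut_merge _ _ _ _ _).2 (Or.inl h)
  | split k l => exact h
  | dot k => exact h

lemma Piece.isCut_top (x : Piece) {L R : List ℕ} {d : ℕ} (h : IsCut (L ++ [x.strand] ++ R) d) :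
    IsCut (L ++ x.top ++ R) d := by
  cases x with
  | merge k l => exact h
  | split k l => exact (isCut_merge _ _ _ _ _).2 (Or.inl h)
  | dot k => exact h

lemma WebGen.isStrands_bot {r : ℕ} (g : WebGen r) : IsStrands r g.bot := by
  cases g with
  | ident a h => exact h
  | piece L x R hbot htop => exact hbot

lemma WebGen.isStrands_top {r : ℕ} (g : WebGen r) : IsStrands r g.top := by
  cases g with
  | ident a h => exact h
  | piece L x R hbot htop => exact htop

/-- The composition with the blocks `erase a`. -/
def eraseComposition {r : ℕ} (a : List ℕ) (h : a.sum = r) : Composition r where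
  blocks := FreeWeb.erase a
  blocks_pos h := FreeWeb.erase_pos a _ h
  blocks_sum := by rw [FreeWeb.sum_erase, h]

/-- The matrix, with rows and columns indexed by compositions, whose only entry is `x`, in the
row `b` and the column `a`. -/
def matUnit (r : ℕ) {A : Type*} [Ring A] (b a : List ℕ) (x : A) :
    Matrix (Composition r) (Composition r) A :=
  fun i j => if i.blocks = FreeWeb.erase b ∧ j.blocks = FreeWeb.erase a then x else 0

section matUnit

variable {r : ℕ} {A : Type*} [Ring A] {a a' b b' c : List ℕ} {x y : A}

lemma matUnit_mul (h : b.sum = r) : matUnit r c b x * matUnit r b a y = matUnit r c a (x * y) := by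
  ext i j
  rw [Matrix.mul_apply, Finset.sum_eq_single (eraseComposition b h)]
  · simp only [matUnit, eraseComposition, and_true, true_and]
    split_ifs <;> simp_all
  · intro k _ hk
    have : ¬ k.blocks = FreeWeb.erase b := fun h' => hk (Composition.ext h')
    simp [matUnit, this]
  · simp

lemma matUnit_mul_of_ne (h : FreeWeb.erase b ≠ FreeWeb.erase b') :
    matUnit r c b x * matUnit r b' a y = 0 := by
  ext i j
  rw [Matrix.mul_apply]
  refine Finset.sum_eq_zero fun k _ => ?_
  by_cases hk : k.blocks = FreeWeb.erase b
  · have : ¬ k.blocks = FreeWeb.erase b' := fun h' => h (hk.symm.trans h')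
    simp [matUnit, this]
  · simp [matUnit, hk]

lemma matUnit_congr (hb : FreeWeb.erase b = FreeWeb.erase b')
    (ha : FreeWeb.erase a = FreeWeb.erase a') : matUnit r b a x = matUnit r b' a' x := by
  ext i j
  rw [matUnit, matUnit, hb, ha]

lemma matUnit_add : matUnit r b a (x + y) = matUnit r b a x + matUnit r b a y := by
  ext i j
  simp only [matUnit, Matrix.add_apply]
  split_ifs <;> simp

lemma matUnit_sub : matUnit r b a (x - y) = matUnit r b a x - matUnit r b a y := by
  ext i j
  simp only [matUnit, Matrix.sub_apply]
  split_ifs <;> simp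

lemma matUnit_smul [Algebra ℂ A] (z : ℂ) : matUnit r b a (z • x) = z • matUnit r b a x := by
  ext i j
  simp only [matUnit, Matrix.smul_apply]
  split_ifs <;> simp

end matUnit

namespace SergeevSystem

variable {r : ℕ} {A : Type*} [Ring A]

lemma dotSum_singleton (S : SergeevSystem r A) (p : Fin r) {x : ℕ} (hp : (p : ℕ) = x) :
    S.dotSum (block r x 1) = S.dot p := by
  have : block r x 1 = {p} := by
    ext q
    rw [mem_block, Finset.mem_singleton, Fin.ext_iff]
    omega
  rw [this, dotSum, Finset.sum_singleton]

variable [Algebra ℂ A] (S : SergeevSystem r A)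

/-- The diagonal matrix of the idempotents of the Young subgroups. -/
noncomputable def youngDiag : Matrix (Composition r) (Composition r) A :=
  Matrix.diagonal fun c => S.youngAvg c.blocks

lemma youngDiag_idem : IsIdempotentElem S.youngDiag := by
  rw [IsIdempotentElem, youngDiag, Matrix.diagonal_mul_diagonal]
  congr 1
  ext c
  exact S.youngAvg_mul_self _

lemma youngDiag_mul (b a : List ℕ) (x : A) :
    S.youngDiag * matUnit r b a x = matUnit r b a (S.youngAvg b * x) := by
  ext i j
  rw [youngDiag, Matrix.diagonal_mul]
  simp only [matUnit]
  split_ifs with h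
  · rw [h.1, youngAvg_erase]
  · simp

lemma mul_youngDiag (b a : List ℕ) (x : A) :
    matUnit r b a x * S.youngDiag = matUnit r b a (x * S.youngAvg a) := by
  ext i j
  rw [youngDiag, Matrix.mul_diagonal]
  simp only [matUnit]
  split_ifs with h
  · rw [h.2, youngAvg_erase]
  · simp

/-- The ring in which the web superalgebra is represented: the matrices over `A`, indexed by
compositions of `r`, whose entry at `b`, `a` is fixed by the Young idempotent of `b` on the left and
by that of `a` on the right. -/
abbrev WebTarget : Type _ := S.youngDiag_idem.Corner

/-- The scalars, embedded into the corner ring. -/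
noncomputable def scalarHom : ℂ →+* S.WebTarget where
  toFun z := ⟨z • S.youngDiag, (Subsemigroup.mem_corner_iff S.youngDiag_idem).2
    ⟨by rw [mul_smul_comm, S.youngDiag_idem], by rw [smul_mul_assoc, S.youngDiag_idem]⟩⟩
  map_zero' := Subtype.ext (zero_smul _ _)
  map_one' := Subtype.ext (one_smul _ _)
  map_add' _ _ := Subtype.ext (add_smul _ _ _)
  map_mul' z w := Subtype.ext <| by
    change (z * w) • S.youngDiag = (z • S.youngDiag) * (w • S.youngDiag)
    rw [smul_mul_assoc, mul_smul_comm, S.youngDiag_idem, mul_smul]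

noncomputable instance : Algebra ℂ S.WebTarget :=
  S.scalarHom.toAlgebra' fun z x => Subtype.ext <| by
    have := (Subsemigroup.mem_corner_iff S.youngDiag_idem).1 x.2
    change (z • S.youngDiag) * x.1 = x.1 * (z • S.youngDiag)
    rw [smul_mul_assoc, mul_smul_comm, this.1, this.2]

lemma val_smul (z : ℂ) (x : S.WebTarget) : (z • x).1 = z • x.1 := by
  have := (Subsemigroup.mem_corner_iff S.youngDiag_idem).1 x.2
  change (z • S.youngDiag) * x.1 = _
  rw [smul_mul_assoc, this.1]

/-- The factor by which a local web acts, besides the symmetrization on its strand: a binomial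
coefficient for a merge and the sum of the dots for a dot. -/
noncomputable def pieceFactor (s : ℕ) : Piece → A
  | .merge k l => ((k + l).choose l : ℂ) • 1
  | .split _ _ => 1
  | .dot k => S.dotSum (block r s k)

lemma pieceFactor_comm {a L R : List ℕ} {x : Piece} (ha : x.parity = 1 → a = L ++ [x.strand] ++ R) :
    S.youngAvg a * S.pieceFactor L.sum x = S.pieceFactor L.sum x * S.youngAvg a := by
  cases x with
  | merge k l => simp [pieceFactor]
  | split k l => simp [pieceFactor]
  | dot k =>
    rw [ha rfl]
    exact S.youngAvg_mul_dotSum (by simpa [Piece.strand] using isBlock_append L k R)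

/-- The element by which a generator acts. -/
noncomputable def genValue : WebGen r → A
  | .ident a _ => S.youngAvg a
  | .piece L x R _ _ => S.pieceFactor L.sum x * S.youngAvg (L ++ [x.strand] ++ R)

lemma youngAvg_mul_pieceFactor (L R : List ℕ) (x : Piece) :
    S.youngAvg (L ++ x.top ++ R) * (S.pieceFactor L.sum x * S.youngAvg (L ++ [x.strand] ++ R)) =
      S.pieceFactor L.sum x * S.youngAvg (L ++ [x.strand] ++ R) := by
  rw [← mul_assoc, S.pieceFactor_comm (R := R), mul_assoc,
    S.youngAvg_mul_of_le fun d => x.isCut_top]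
  cases x <;> simp [Piece.parity, Piece.top, Piece.strand]

lemma pieceFactor_mul_youngAvg (L R : List ℕ) (x : Piece) :
    S.pieceFactor L.sum x * S.youngAvg (L ++ [x.strand] ++ R) * S.youngAvg (L ++ x.bot ++ R) =
      S.pieceFactor L.sum x * S.youngAvg (L ++ [x.strand] ++ R) := by
  rw [mul_assoc, S.youngAvg_mul_of_ge fun d => x.isCut_bot]

lemma youngAvg_mul_genValue (g : WebGen r) : S.youngAvg g.top * S.genValue g = S.genValue g := by
  cases g with
  | ident a h => exact S.youngAvg_mul_self a
  | piece L x R hbot htop => exact S.youngAvg_mul_pieceFactor L R x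

lemma genValue_mul_youngAvg (g : WebGen r) : S.genValue g * S.youngAvg g.bot = S.genValue g := by
  cases g with
  | ident a h => exact S.youngAvg_mul_self a
  | piece L x R hbot htop => exact S.pieceFactor_mul_youngAvg L R x

/-- The matrix by which a generator acts. -/
noncomputable def genTarget (g : WebGen r) : S.WebTarget :=
  ⟨matUnit r g.top g.bot (S.genValue g), (Subsemigroup.mem_corner_iff S.youngDiag_idem).2
    ⟨by rw [youngDiag_mul, youngAvg_mul_genValue], by rw [mul_youngDiag, genValue_mul_youngAvg]⟩⟩

/-- The representation of the free algebra on the generators. -/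
noncomputable def freeRep : FreeAlgebra ℂ (WebGen r) →ₐ[ℂ] S.WebTarget :=
  FreeAlgebra.lift ℂ S.genTarget

lemma freeRep_ι (g : WebGen r) :
    (S.freeRep (FreeAlgebra.ι ℂ g)).1 = matUnit r g.top g.bot (S.genValue g) := by
  rw [freeRep, FreeAlgebra.lift_ι_apply, genTarget]

/-- The element `w` of the free algebra acts from the strands `a` to the strands `b`, by `x`. -/
structure ActsBy (w : FreeAlgebra ℂ (WebGen r)) (b a : List ℕ) (x : A) : Prop where
  sum_bot : a.sum = r
  eq : (S.freeRep w).1 = matUnit r b a x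
  left : S.youngAvg b * x = x
  right : x * S.youngAvg a = x

namespace ActsBy

variable {S} {w w' : FreeAlgebra ℂ (WebGen r)} {a b c : List ℕ} {x y t : A}

lemma mul (h : S.ActsBy w c b x) (h' : S.ActsBy w' b a y) : S.ActsBy (w * w') c a (x * y) where
  sum_bot := h'.sum_bot
  eq := by
    rw [map_mul]
    change (S.freeRep w).1 * (S.freeRep w').1 = _
    rw [h.eq, h'.eq, matUnit_mul h.sum_bot]
  left := by rw [← mul_assoc, h.left]
  right := by rw [mul_assoc, h'.right]

lemma cancel (h : S.ActsBy w c b (t * S.youngAvg b)) (h' : S.ActsBy w' b a y) :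
    S.ActsBy (w * w') c a (t * y) := by
  have := h.mul h'
  rwa [mul_assoc, h'.left] at this

lemma add (h : S.ActsBy w b a x) (h' : S.ActsBy w' b a y) : S.ActsBy (w + w') b a (x + y) where
  sum_bot := h.sum_bot
  eq := by
    rw [map_add]
    change (S.freeRep w).1 + (S.freeRep w').1 = _
    rw [h.eq, h'.eq, matUnit_add]
  left := by rw [mul_add, h.left, h'.left]
  right := by rw [add_mul, h.right, h'.right]

lemma sub (h : S.ActsBy w b a x) (h' : S.ActsBy w' b a y) : S.ActsBy (w - w') b a (x - y) where
  sum_bot := h.sum_bot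
  eq := by
    rw [map_sub]
    change (S.freeRep w).1 - (S.freeRep w').1 = _
    rw [h.eq, h'.eq, matUnit_sub]
  left := by rw [mul_sub, h.left, h'.left]
  right := by rw [sub_mul, h.right, h'.right]

lemma smul (z : ℂ) (h : S.ActsBy w b a x) : S.ActsBy (z • w) b a (z • x) where
  sum_bot := h.sum_bot
  eq := by rw [map_smul, val_smul, h.eq, matUnit_smul]
  left := by rw [mul_smul_comm, h.left]
  right := by rw [smul_mul_assoc, h.right]

lemma freeRep_eq (h : S.ActsBy w b a x) (h' : S.ActsBy w' b a y) (hxy : x = y) :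
    S.freeRep w = S.freeRep w' :=
  Subtype.ext (by rw [h.eq, h'.eq, hxy])

end ActsBy

/-! ### The action of the local webs -/

lemma actsBy_gen (g : WebGen r) : S.ActsBy (FreeAlgebra.ι ℂ g) g.top g.bot (S.genValue g) :=
  ⟨g.isStrands_bot.2, S.freeRep_ι g, S.youngAvg_mul_genValue g, S.genValue_mul_youngAvg g⟩

lemma actsBy_ident {a : List ℕ} (h : a.sum = r) :
    S.ActsBy (FreeWeb.ident r a) a a (S.youngAvg a) where
  sum_bot := h
  eq := by
    have h' : IsStrands r (FreeWeb.erase a) := by rw [← h]; exact FreeWeb.isStrands_erase a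
    rw [FreeWeb.ident, dif_pos h', freeRep_ι]
    simp only [WebGen.top, WebGen.bot, genValue, youngAvg_erase]
    exact matUnit_congr (FreeWeb.erase_erase a) (FreeWeb.erase_erase a)
  left := S.youngAvg_mul_self a
  right := S.youngAvg_mul_self a

lemma actsBy_piece {L R : List ℕ} {x : Piece} (hbot : ∀ k ∈ x.bot, 0 < k)
    (htop : ∀ k ∈ x.top, 0 < k) (h : (L ++ x.bot ++ R).sum = r) :
    S.ActsBy (FreeWeb.piece r L x R) (L ++ x.top ++ R) (L ++ x.bot ++ R)
      (S.pieceFactor L.sum x * S.youngAvg (L ++ [x.strand] ++ R)) where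
  sum_bot := h
  eq := by
    have hb := FreeWeb.erase_eq_self hbot
    have ht := FreeWeb.erase_eq_self htop
    have hb' : IsStrands r (FreeWeb.erase L ++ x.bot ++ FreeWeb.erase R) := by
      rw [← h, ← hb, ← FreeWeb.erase_append, ← FreeWeb.erase_append, hb]
      exact FreeWeb.isStrands_erase _
    have ht' : IsStrands r (FreeWeb.erase L ++ x.top ++ FreeWeb.erase R) := by
      have : (L ++ x.top ++ R).sum = r := by
        rw [← h]; simp [Piece.sum_top]
      rw [← this, ← ht, ← FreeWeb.erase_append, ← FreeWeb.erase_append, ht]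
      exact FreeWeb.isStrands_erase _
    rw [FreeWeb.piece, dif_pos ⟨hb', ht'⟩, freeRep_ι]
    have h1 : S.youngAvg (FreeWeb.erase L ++ [x.strand] ++ FreeWeb.erase R) =
        S.youngAvg (L ++ [x.strand] ++ R) := by
      rw [← S.youngAvg_erase, ← S.youngAvg_erase (L ++ [x.strand] ++ R)]
      simp only [FreeWeb.erase_append, FreeWeb.erase_erase]
    simp only [WebGen.top, WebGen.bot, genValue, h1, FreeWeb.sum_erase]
    apply matUnit_congr <;> simp only [FreeWeb.erase_append, FreeWeb.erase_erase]
  left := S.youngAvg_mul_pieceFactor L R x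
  right := S.pieceFactor_mul_youngAvg L R x

lemma actsBy_merge (L : List ℕ) (k l : ℕ) (R : List ℕ) (h : (L ++ [k, l] ++ R).sum = r) :
    S.ActsBy (FreeWeb.merge r L k l R) (L ++ [k + l] ++ R) (L ++ [k, l] ++ R)
      (((k + l).choose l : ℂ) • S.youngAvg (L ++ [k + l] ++ R)) := by
  rw [FreeWeb.merge]
  split_ifs with h0
  · have h1 := S.actsBy_ident h
    have h2 : FreeWeb.erase (L ++ [k + l] ++ R) = FreeWeb.erase (L ++ [k, l] ++ R) := by
      rcases h0 with rfl | rfl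
      · simp [FreeWeb.erase_append]
      · simp [FreeWeb.erase_append, FreeWeb.erase_cons_zero]
    have h3 : S.youngAvg (L ++ [k + l] ++ R) = S.youngAvg (L ++ [k, l] ++ R) := by
      rw [← S.youngAvg_erase, h2, S.youngAvg_erase]
    have h4 : (k + l).choose l = 1 := by rcases h0 with rfl | rfl <;> simp
    rw [h4, h3, Nat.cast_one, one_smul]
    exact ⟨h, by rw [h1.eq]; exact matUnit_congr h2.symm rfl, by rw [h3]; exact h1.left, h1.right⟩
  · have := S.actsBy_piece (x := .merge k l) (L := L) (R := R) (by simp [Piece.bot]; omega)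
      (by simp [Piece.top]; omega) h
    simpa [pieceFactor, Piece.top, Piece.bot, Piece.strand] using this

lemma actsBy_split (L : List ℕ) (k l : ℕ) (R : List ℕ) (h : (L ++ [k + l] ++ R).sum = r) :
    S.ActsBy (FreeWeb.split r L k l R) (L ++ [k, l] ++ R) (L ++ [k + l] ++ R)
      (S.youngAvg (L ++ [k + l] ++ R)) := by
  rw [FreeWeb.split]
  split_ifs with h0
  · have h' : (L ++ [k, l] ++ R).sum = r := by rw [← h]; simp; omega
    have h1 := S.actsBy_ident h'
    have h2 : FreeWeb.erase (L ++ [k + l] ++ R) = FreeWeb.erase (L ++ [k, l] ++ R) := by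
      rcases h0 with rfl | rfl
      · simp [FreeWeb.erase_append]
      · simp [FreeWeb.erase_append, FreeWeb.erase_cons_zero]
    have h3 : S.youngAvg (L ++ [k + l] ++ R) = S.youngAvg (L ++ [k, l] ++ R) := by
      rw [← S.youngAvg_erase, h2, S.youngAvg_erase]
    rw [h3]
    exact ⟨h, by rw [h1.eq]; exact matUnit_congr rfl h2.symm, h1.left, by rw [h3]; exact h1.right⟩
  · have := S.actsBy_piece (x := .split k l) (L := L) (R := R) (by simp [Piece.bot]; omega)
      (by simp [Piece.top]; omega) h
    simpa [pieceFactor, Piece.top, Piece.bot, Piece.strand] using this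

lemma actsBy_dot (L : List ℕ) {k : ℕ} (hk : 0 < k) (R : List ℕ) (h : (L ++ [k] ++ R).sum = r) :
    S.ActsBy (FreeWeb.dot r L k R) (L ++ [k] ++ R) (L ++ [k] ++ R)
      (S.dotSum (block r L.sum k) * S.youngAvg (L ++ [k] ++ R)) :=
  S.actsBy_piece (x := .dot k) (by simpa [Piece.bot] using hk) (by simpa [Piece.top] using hk) h

/-- The dot on a rung commutes with the symmetrization that fixes the rung. -/
lemma youngAvg_mul_dot (L R : List ℕ) {p : Fin r} (hp : (p : ℕ) = L.sum) :
    S.youngAvg (L ++ 1 :: R) * S.dot p = S.dot p * S.youngAvg (L ++ 1 :: R) := by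
  rw [← S.dotSum_singleton p hp]
  exact S.youngAvg_mul_dotSum (isBlock_append L 1 R)

variable {L R T B : List ℕ} {k l : ℕ} {p : Fin r}

lemma actsBy_rungL (hp : (p : ℕ) = L.sum + k) (h : B.sum = r) (hT : T = L ++ (k + 1) :: l :: R)
    (hB : B = L ++ k :: (l + 1) :: R) :
    S.ActsBy (FreeWeb.rungL r L k l R) T B
      (S.transvSum (block r L.sum (k + 1)) p * S.youngAvg B) := by
  subst hT hB
  have h1 := S.actsBy_merge L k 1 (l :: R) (by rw [← h]; simp; omega)
  have h2 := S.actsBy_split (L ++ [k]) 1 l R (by rw [← h]; simp; omega)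
  rw [Nat.choose_one_right, S.youngAvg_rungL hp] at h1
  simp only [List.append_assoc, List.cons_append, List.nil_append] at h1 h2
  have := h1.cancel h2
  rwa [add_comm 1 l] at this

lemma actsBy_rungLDot (hp : (p : ℕ) = L.sum + k) (h : B.sum = r)
    (hT : T = L ++ (k + 1) :: l :: R) (hB : B = L ++ k :: (l + 1) :: R) :
    S.ActsBy (FreeWeb.rungLDot r L k l R) T B
      (S.transvSum (block r L.sum (k + 1)) p * S.dot p * S.youngAvg B) := by
  subst hT hB
  have h1 := S.actsBy_merge L k 1 (l :: R) (by rw [← h]; simp; omega)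
  have h2 := S.actsBy_split (L ++ [k]) 1 l R (by rw [← h]; simp; omega)
  have h3 := S.actsBy_dot (L ++ [k]) one_pos (l :: R) (by rw [← h]; simp; omega)
  have h4 := S.youngAvg_mul_dot (L ++ [k]) (l :: R) (p := p) (by simp [hp])
  rw [Nat.choose_one_right, S.youngAvg_rungL hp] at h1
  rw [S.dotSum_singleton p (by simp [hp])] at h3
  simp only [List.append_assoc, List.cons_append, List.nil_append] at h1 h2 h3 h4
  have := (h1.cancel h3)
  rw [← mul_assoc] at this
  have := this.cancel h2
  rwa [add_comm 1 l] at this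

lemma actsBy_rungR (hp : (p : ℕ) = L.sum + k) (h : B.sum = r) (hT : T = L ++ k :: (l + 1) :: R)
    (hB : B = L ++ (k + 1) :: l :: R) :
    S.ActsBy (FreeWeb.rungR r L k l R) T B
      (S.transvSum (block r (L.sum + k) (l + 1)) p * S.youngAvg B) := by
  subst hT hB
  have h1 := S.actsBy_merge (L ++ [k]) 1 l R (by rw [← h]; simp; omega)
  have h2 := S.actsBy_split L k 1 (l :: R) (by rw [← h]; simp)
  have h3 := S.youngAvg_rungR (L := L ++ [k]) (R := R) (l := l) (p := p) (by simp [hp])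
    (by rw [← h]; simp; omega)
  rw [add_comm 1 l, Nat.choose_succ_self_right, add_comm l 1, h3] at h1
  simp only [List.append_assoc, List.cons_append, List.nil_append, List.sum_append, List.sum_cons,
    List.sum_nil, add_zero] at h1 h2
  have := h1.cancel h2
  rwa [add_comm 1 l] at this

lemma actsBy_rungRDot (hp : (p : ℕ) = L.sum + k) (h : B.sum = r)
    (hT : T = L ++ k :: (l + 1) :: R) (hB : B = L ++ (k + 1) :: l :: R) :
    S.ActsBy (FreeWeb.rungRDot r L k l R) T B
      (S.transvSum (block r (L.sum + k) (l + 1)) p * S.dot p * S.youngAvg B) := by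
  subst hT hB
  have h1 := S.actsBy_merge (L ++ [k]) 1 l R (by rw [← h]; simp; omega)
  have h2 := S.actsBy_split L k 1 (l :: R) (by rw [← h]; simp)
  have h4 := S.actsBy_dot (L ++ [k]) one_pos (l :: R) (by rw [← h]; simp; omega)
  have h5 := S.youngAvg_mul_dot (L ++ [k]) (l :: R) (p := p) (by simp [hp])
  have h3 := S.youngAvg_rungR (L := L ++ [k]) (R := R) (l := l) (p := p) (by simp [hp])
    (by rw [← h]; simp; omega)
  rw [add_comm 1 l, Nat.choose_succ_self_right, add_comm l 1, h3] at h1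
  rw [S.dotSum_singleton p (by simp [hp])] at h4
  simp only [List.append_assoc, List.cons_append, List.nil_append, List.sum_append, List.sum_cons,
    List.sum_nil, add_zero] at h1 h2 h4 h5
  have := (h1.cancel h4)
  rw [← mul_assoc] at this
  have := this.cancel h2
  rwa [add_comm 1 l] at this

end SergeevSystem

lemma insert_block_right {r x l : ℕ} {p : Fin r} (hp : (p : ℕ) = x) :
    insert p (block r (x + 1) l) = block r x (l + 1) := by
  ext i
  rw [Finset.mem_insert, mem_block, mem_block, Fin.ext_iff]
  omega

lemma insert_block_left {r x k : ℕ} {q : Fin r} (hq : (q : ℕ) = x + k) :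
    insert q (block r x k) = block r x (k + 1) := by
  ext i
  rw [Finset.mem_insert, mem_block, mem_block, Fin.ext_iff]
  omega

namespace SergeevSystem

variable {r : ℕ} {A : Type*} [Ring A]

lemma dotSum_block_add (S : SergeevSystem r A) (x k l : ℕ) :
    S.dotSum (block r x (k + l)) = S.dotSum (block r x k) + S.dotSum (block r (x + k) l) := by
  rw [block_add_left, dotSum, Finset.sum_disjUnion, dotSum, dotSum]

variable [Algebra ℂ A] (S : SergeevSystem r A)

/-! ### The defining relations hold in the representation -/

/-- The superinterchange law holds because the elements by which local webs with disjoint supports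
act commute or anticommute with each other, and with the Young averages on the other support. -/
lemma freeRep_interchange (L : List ℕ) (x : Piece) (M : List ℕ) (y : Piece) (R : List ℕ)
    (h : IsStrands r (L ++ x.bot ++ M ++ y.bot ++ R)) :
    S.freeRep (FreeWeb.piece r (L ++ x.top ++ M) y R * FreeWeb.piece r L x (M ++ y.bot ++ R)) =
      S.freeRep ((-1 : ℂ) ^ (x.parity * y.parity) •
        (FreeWeb.piece r L x (M ++ y.top ++ R) * FreeWeb.piece r (L ++ x.bot ++ M) y R)) := by
  have hxb : ∀ k ∈ x.bot, 0 < k := fun k hk => h.1 k (by simp [hk])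
  have hyb : ∀ k ∈ y.bot, 0 < k := fun k hk => h.1 k (by simp [hk])
  have hz : ∀ (L R : List ℕ) (x : Piece), ¬ (∀ k ∈ x.top, 0 < k) → FreeWeb.piece r L x R = 0 := by
    intro L R x hx
    refine dif_neg fun h' => hx fun k hk => h'.2.1 k (by simp [hk])
  by_cases hxt : ∀ k ∈ x.top, 0 < k
  swap
  · rw [hz L _ x hxt, hz L _ x hxt]
    simp
  by_cases hyt : ∀ k ∈ y.top, 0 < k
  swap
  · rw [hz _ _ y hyt, hz _ _ y hyt]
    simp
  have hsum := h.2
  have e1 := S.actsBy_piece (L := L ++ x.top ++ M) (R := R) hyb hyt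
    (by rw [← hsum]; simp [Piece.sum_top])
  have e2 := S.actsBy_piece (L := L) (R := M ++ y.bot ++ R) hxb hxt (by rw [← hsum]; simp)
  have e3 := S.actsBy_piece (L := L) (R := M ++ y.top ++ R) hxb hxt
    (by rw [← hsum]; simp [Piece.sum_top])
  have e4 := S.actsBy_piece (L := L ++ x.bot ++ M) (R := R) hyb hyt (by rw [← hsum])
  simp only [← List.append_assoc] at e1 e2 e3 e4
  refine (e1.mul e2).freeRep_eq ((e3.mul e4).smul _) ?_
  have hs : (L ++ x.top ++ M).sum = (L ++ x.bot ++ M).sum := by simp [Piece.sum_top]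
  have hs' : (L ++ x.top ++ M).sum = (L ++ [x.strand] ++ M).sum := by
    simp [Piece.sum_top, Piece.sum_bot]
  have hs'' : (L ++ x.bot ++ M).sum = (L ++ [x.strand] ++ M).sum := by simp [Piece.sum_bot]
  -- the idempotents of the two factors
  have i1 : S.youngAvg (L ++ x.top ++ M ++ [y.strand] ++ R) *
      S.youngAvg (L ++ [x.strand] ++ M ++ y.bot ++ R) =
      S.youngAvg (L ++ [x.strand] ++ M ++ [y.strand] ++ R) := by
    have := (S.youngAvg_append (a := L ++ x.top ++ M) (a' := L ++ [x.strand] ++ M)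
      (b := y.bot ++ R) (b' := [y.strand] ++ R) hs' (fun d hd => ?_) fun d hd => ?_).1
    · simpa only [List.append_assoc] using this
    · simp only [isCut_append _ M] at hd ⊢
      have h0 : (L ++ x.top).sum = (L ++ [x.strand]).sum := by simp [Piece.sum_top, Piece.sum_bot]
      rw [h0]
      refine hd.imp_left fun hd => ?_
      have := x.isCut_top (L := L) (R := []) (d := d)
      simp only [List.append_nil] at this
      exact this hd
    · exact y.isCut_bot (L := []) hd
  have i2 : S.youngAvg (L ++ [x.strand] ++ M ++ y.top ++ R) *
      S.youngAvg (L ++ x.bot ++ M ++ [y.strand] ++ R) =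
      S.youngAvg (L ++ [x.strand] ++ M ++ [y.strand] ++ R) := by
    have := (S.youngAvg_append (a := L ++ x.bot ++ M) (a' := L ++ [x.strand] ++ M)
      (b := y.top ++ R) (b' := [y.strand] ++ R) hs'' (fun d hd => ?_) fun d hd => ?_).2
    · simpa only [List.append_assoc] using this
    · simp only [isCut_append _ M] at hd ⊢
      have h0 : (L ++ x.bot).sum = (L ++ [x.strand]).sum := by simp [Piece.sum_bot]
      rw [h0]
      refine hd.imp_left fun hd => ?_
      have := x.isCut_bot (L := L) (R := []) (d := d)
      simp only [List.append_nil] at this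
      exact this hd
    · exact y.isCut_top (L := []) hd
  have c1 := S.pieceFactor_comm (a := L ++ x.top ++ M ++ [y.strand] ++ R) (L := L) (x := x)
    (R := M ++ [y.strand] ++ R) (by cases x <;> simp [Piece.parity, Piece.top, Piece.strand])
  have c2 := S.pieceFactor_comm (a := L ++ [x.strand] ++ M ++ y.top ++ R) (x := y)
    (L := L ++ [x.strand] ++ M) (R := R)
    (by cases y <;> simp [Piece.parity, Piece.top, Piece.strand])
  rw [← hs'', ← hs] at c2
  have c3 : S.pieceFactor (L ++ x.top ++ M).sum y * S.pieceFactor L.sum x =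
      (-1 : ℂ) ^ (x.parity * y.parity) •
        (S.pieceFactor L.sum x * S.pieceFactor (L ++ x.top ++ M).sum y) := by
    cases x <;> cases y <;> simp [pieceFactor, Piece.parity]
    · exact smul_comm _ _ _
    · refine S.dotSum_mul_dotSum (disjoint_block ?_).symm
      simp only [Piece.top, List.sum_cons, List.sum_nil]
      omega
  calc _ = S.pieceFactor (L ++ x.top ++ M).sum y *
        (S.youngAvg (L ++ x.top ++ M ++ [y.strand] ++ R) * S.pieceFactor L.sum x) *
          S.youngAvg (L ++ [x.strand] ++ M ++ y.bot ++ R) := by simp only [mul_assoc]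
    _ = S.pieceFactor (L ++ x.top ++ M).sum y * S.pieceFactor L.sum x *
          S.youngAvg (L ++ [x.strand] ++ M ++ [y.strand] ++ R) := by
        rw [c1, ← i1]; simp only [mul_assoc]
    _ = _ := by
        rw [c3, ← hs, smul_mul_assoc, ← i2]
        simp only [mul_assoc]
        rw [← mul_assoc _ _ (S.youngAvg (L ++ x.bot ++ M ++ [y.strand] ++ R)), ← c2]
        simp only [mul_assoc]

variable {S}

lemma freeRep_assoc_merge (L : List ℕ) (h k l : ℕ) (R : List ℕ)
    (hv : IsStrands r (L ++ [h, k, l] ++ R)) :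
    S.freeRep (FreeWeb.merge r L (h + k) l R * FreeWeb.merge r L h k (l :: R)) =
      S.freeRep (FreeWeb.merge r L h (k + l) R * FreeWeb.merge r (L ++ [h]) k l R) := by
  have hs := hv.2
  simp only [List.append_assoc, List.cons_append, List.nil_append, List.sum_append,
    List.sum_cons] at hs
  have e1 := S.actsBy_merge L (h + k) l R (by simp; omega)
  have e2 := S.actsBy_merge L h k (l :: R) (by simp; omega)
  have e3 := S.actsBy_merge L h (k + l) R (by simp; omega)
  have e4 := S.actsBy_merge (L ++ [h]) k l R (by simp; omega)
  have i1 := S.youngAvg_mul_of_ge (a := L ++ [h + k, l] ++ R) (b := L ++ [h + k + l] ++ R)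
    fun d hd => (isCut_merge _ _ _ _ _).2 (Or.inl hd)
  have i2 := S.youngAvg_mul_of_ge (a := L ++ [h, k + l] ++ R) (b := L ++ [h + (k + l)] ++ R)
    fun d hd => (isCut_merge _ _ _ _ _).2 (Or.inl hd)
  simp only [List.append_assoc, List.cons_append, List.nil_append, add_assoc] at e1 e2 e3 e4 i1 i2
  have e12 := e1.mul e2
  have e34 := e3.mul e4
  rw [smul_mul_smul_comm, i1] at e12
  rw [smul_mul_smul_comm, i2] at e34
  refine e12.freeRep_eq e34 ?_
  congr 1
  have := Nat.choose_mul (n := h + (k + l)) (k := k + l) (s := l) (by omega)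
  rw [show h + (k + l) - l = h + k by omega, show k + l - l = k by omega] at this
  exact_mod_cast this.symm

lemma freeRep_assoc_split (L : List ℕ) (h k l : ℕ) (R : List ℕ)
    (hv : IsStrands r (L ++ [h, k, l] ++ R)) :
    S.freeRep (FreeWeb.split r (L ++ [h]) k l R * FreeWeb.split r L h (k + l) R) =
      S.freeRep (FreeWeb.split r L h k (l :: R) * FreeWeb.split r L (h + k) l R) := by
  have hs := hv.2
  simp only [List.append_assoc, List.cons_append, List.nil_append, List.sum_append,
    List.sum_cons] at hs
  have e1 := S.actsBy_split (L ++ [h]) k l R (by simp; omega)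
  have e2 := S.actsBy_split L h (k + l) R (by simp; omega)
  have e3 := S.actsBy_split L h k (l :: R) (by simp; omega)
  have e4 := S.actsBy_split L (h + k) l R (by simp; omega)
  have i1 := S.youngAvg_mul_of_le (a := L ++ [h, k + l] ++ R) (b := L ++ [h + (k + l)] ++ R)
    fun d hd => (isCut_merge _ _ _ _ _).2 (Or.inl hd)
  have i2 := S.youngAvg_mul_of_le (a := L ++ [h + k, l] ++ R) (b := L ++ [h + k + l] ++ R)
    fun d hd => (isCut_merge _ _ _ _ _).2 (Or.inl hd)
  simp only [List.append_assoc, List.cons_append, List.nil_append, add_assoc] at e1 e2 e3 e4 i1 i2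
  exact (e1.mul e2).freeRep_eq (e3.mul e4) (i1.trans i2.symm)

lemma freeRep_digon (L : List ℕ) (k l : ℕ) (R : List ℕ) (hv : IsStrands r (L ++ [k, l] ++ R)) :
    S.freeRep (FreeWeb.merge r L k l R * FreeWeb.split r L k l R) =
      S.freeRep (((k + l).choose l : ℂ) • FreeWeb.ident r (L ++ [k + l] ++ R)) := by
  have hs := hv.2
  have hs' : (L ++ [k + l] ++ R).sum = r := by rw [← hs]; simp; omega
  refine ((S.actsBy_merge L k l R hs).mul (S.actsBy_split L k l R hs')).freeRep_eq
    ((S.actsBy_ident hs').smul _) ?_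
  rw [smul_mul_assoc, S.youngAvg_mul_self]

lemma isBlock_strand (L : List ℕ) (k : ℕ) (R : List ℕ) : IsBlock (L ++ [k] ++ R) L.sum k := by
  simpa using isBlock_append L k R

lemma freeRep_dot_collision (he : S.e = 1) (L : List ℕ) (k : ℕ) (R : List ℕ)
    (hv : IsStrands r (L ++ [k] ++ R)) :
    S.freeRep (FreeWeb.dot r L k R * FreeWeb.dot r L k R) =
      S.freeRep ((k : ℂ) • FreeWeb.ident r (L ++ [k] ++ R)) := by
  have hs := hv.2
  have e1 := S.actsBy_dot L (hv.1 k (by simp)) R hs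
  refine (e1.cancel e1).freeRep_eq ((S.actsBy_ident hs).smul _) ?_
  have hk : L.sum + k ≤ r := by rw [← hs]; simp
  rw [← mul_assoc, dotSum_mul_self, he, card_block hk, smul_mul_assoc, one_mul]

lemma freeRep_dot_merge (L : List ℕ) (k l : ℕ) (R : List ℕ)
    (hv : IsStrands r (L ++ [k, l] ++ R)) :
    S.freeRep (FreeWeb.dot r L (k + l) R * FreeWeb.merge r L k l R) =
      S.freeRep (FreeWeb.merge r L k l R * FreeWeb.dot r L k (l :: R) +
        FreeWeb.merge r L k l R * FreeWeb.dot r (L ++ [k]) l R) := by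
  have hs := hv.2
  have hs' : (L ++ [k + l] ++ R).sum = r := by rw [← hs]; simp; omega
  have e1 := S.actsBy_dot L (k := k + l) (by have := hv.1 k (by simp); omega) R hs'
  have e2 := S.actsBy_merge L k l R hs
  have e3 := S.actsBy_dot L (hv.1 k (by simp)) (l :: R) (by simpa using hs)
  have e4 := S.actsBy_dot (L ++ [k]) (hv.1 l (by simp)) R (by simpa using hs)
  have i1 := S.youngAvg_mul_of_ge (a := L ++ [k, l] ++ R) (b := L ++ [k + l] ++ R)
    fun d hd => (isCut_merge _ _ _ _ _).2 (Or.inl hd)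
  have c1 := S.youngAvg_mul_dotSum (isBlock_strand L (k + l) R)
  rw [dotSum_block_add] at e1 c1
  simp only [List.append_assoc, List.cons_append, List.nil_append, List.sum_append, List.sum_cons,
    List.sum_nil, add_zero] at e1 e2 e3 e4 i1 c1
  refine (e1.cancel e2).freeRep_eq ((e2.mul e3).add (e2.mul e4)) ?_
  rw [← mul_add, ← add_mul, smul_mul_assoc, ← mul_assoc, c1, mul_assoc, i1, mul_smul_comm]

lemma freeRep_split_dot (L : List ℕ) (k l : ℕ) (R : List ℕ)
    (hv : IsStrands r (L ++ [k, l] ++ R)) :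
    S.freeRep (FreeWeb.split r L k l R * FreeWeb.dot r L (k + l) R) =
      S.freeRep (FreeWeb.dot r L k (l :: R) * FreeWeb.split r L k l R +
        FreeWeb.dot r (L ++ [k]) l R * FreeWeb.split r L k l R) := by
  have hs := hv.2
  have hs' : (L ++ [k + l] ++ R).sum = r := by rw [← hs]; simp; omega
  have e1 := S.actsBy_dot L (k := k + l) (by have := hv.1 k (by simp); omega) R hs'
  have e2 := S.actsBy_split L k l R hs'
  have e3 := S.actsBy_dot L (hv.1 k (by simp)) (l :: R) (by simpa using hs)
  have e4 := S.actsBy_dot (L ++ [k]) (hv.1 l (by simp)) R (by simpa using hs)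
  have c1 := S.youngAvg_mul_dotSum (isBlock_strand L (k + l) R)
  rw [dotSum_block_add] at e1 c1
  simp only [List.append_assoc, List.cons_append, List.nil_append, List.sum_append, List.sum_cons,
    List.sum_nil, add_zero] at e1 e2 e3 e4 c1
  refine (e2.mul e1).freeRep_eq ((e3.cancel e2).add (e4.cancel e2)) ?_
  rw [← add_mul, ← mul_assoc, c1, mul_assoc, S.youngAvg_mul_self]

lemma two_smul_youngAvg {L R : List ℕ} {p q : Fin r} (hp : (p : ℕ) = L.sum)
    (hq : (q : ℕ) = L.sum + 1) :
    (2 : ℂ) • S.youngAvg (L ++ [2] ++ R) =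
      (1 + S.perm (Equiv.swap p q)) * S.youngAvg (L ++ [1, 1] ++ R) := by
  have h := S.youngAvg_rungR (L := L) (R := R) (l := 1) (p := p) hp (by omega)
  have hb : block r L.sum (1 + 1) = insert p {q} := by
    ext x
    simp only [mem_block, Finset.mem_insert, Finset.mem_singleton, Fin.ext_iff]
    omega
  have hpq : p ∉ ({q} : Finset (Fin r)) := by
    rw [Finset.mem_singleton, Fin.ext_iff]; omega
  rw [hb, transvSum_insert hpq] at h
  simpa [transvSum, Equiv.swap_comm, one_add_one_eq_two] using h

lemma freeRep_dumbbell (he : S.e = 1) (L R : List ℕ) (hv : IsStrands r (L ++ [1, 1] ++ R)) :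
    S.freeRep (FreeWeb.split r L 1 1 R * FreeWeb.merge r L 1 1 R -
        FreeWeb.dots r L 1 1 R * FreeWeb.split r L 1 1 R * FreeWeb.merge r L 1 1 R *
          FreeWeb.dots r L 1 1 R) =
      S.freeRep ((2 : ℂ) • FreeWeb.ident r (L ++ [1, 1] ++ R)) := by
  have hs := hv.2
  have hs' := hs
  simp only [List.append_assoc, List.cons_append, List.nil_append, List.sum_append,
    List.sum_cons] at hs'
  obtain ⟨p, hp⟩ : ∃ p : Fin r, (p : ℕ) = L.sum := ⟨⟨L.sum, by omega⟩, rfl⟩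
  obtain ⟨q, hq⟩ : ∃ q : Fin r, (q : ℕ) = L.sum + 1 := ⟨⟨L.sum + 1, by omega⟩, rfl⟩
  have hpq : p ≠ q := fun h => by rw [h] at hp; omega
  have e1 := S.actsBy_split L 1 1 R (by simp; omega)
  have e2 := S.actsBy_merge L 1 1 R hs
  have e3 := S.actsBy_dot L one_pos (1 :: R) (by simpa using hs)
  have e4 := S.actsBy_dot (L ++ [1]) one_pos R (by simpa using hs)
  have e5 := S.actsBy_ident hs
  have h2 := S.two_smul_youngAvg (R := R) hp hq
  have hi : ((1 + 1).choose 1 : ℂ) = 2 := by norm_num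
  have e12 := e1.mul e2
  rw [hi, mul_smul_comm, S.youngAvg_mul_self, one_add_one_eq_two, h2] at e12
  have c1 := S.youngAvg_mul_dot L (1 :: R) hp
  have c2 := S.youngAvg_mul_dot (L ++ [1]) R (p := q) (by simp [hq])
  rw [S.dotSum_singleton p hp] at e3
  rw [S.dotSum_singleton q (by simp [hq])] at e4
  simp only [List.append_assoc, List.cons_append, List.nil_append] at e12 e3 e4 e5 c1 c2
  have e34 := e3.cancel e4
  rw [← mul_assoc] at e34
  have e3412 := e34.cancel e12
  rw [← mul_assoc, ← mul_assoc (S.dot p * S.dot q)] at e3412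
  have e6 := e12.sub (e3412.cancel e34)
  simp only [List.append_assoc, List.cons_append, List.nil_append]
  refine e6.freeRep_eq (e5.smul 2) ?_
  have h3 : S.dot p * S.dot q * (S.dot p * S.dot q) = -1 := by
    rw [mul_assoc, ← mul_assoc (S.dot q), S.dot_mul_dot q p hpq.symm, neg_mul, mul_neg, mul_assoc,
      S.dot_mul_self, ← mul_assoc, S.dot_mul_self, he, one_mul]
  have h4 : S.dot p * S.dot q * (S.perm (Equiv.swap p q) * (S.dot p * S.dot q)) =
      S.perm (Equiv.swap p q) := by
    have h6 : S.perm (Equiv.swap p q) * (S.dot p * S.dot q) =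
        S.dot q * (S.dot p * S.perm (Equiv.swap p q)) := by
      rw [← mul_assoc, perm_mul_dot, Equiv.swap_apply_left, mul_assoc, perm_mul_dot,
        Equiv.swap_apply_right]
    rw [h6, mul_assoc, ← mul_assoc (S.dot q) (S.dot q), S.dot_mul_self, he, one_mul, ← mul_assoc,
      S.dot_mul_self, he, one_mul]
  have h5 : S.dot p * S.dot q * (1 + S.perm (Equiv.swap p q)) *
      (S.dot p * S.dot q * S.youngAvg (L ++ 1 :: 1 :: R)) =
      (-1 + S.perm (Equiv.swap p q)) * S.youngAvg (L ++ 1 :: 1 :: R) := by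
    rw [← mul_assoc, mul_add, add_mul, mul_one, h3, mul_assoc _ _ (S.dot p * S.dot q), h4]
  rw [h5, ← sub_mul, two_smul, add_sub_add_right_eq_sub, sub_neg_eq_add, add_mul, one_mul]

section Ladder

variable (L : List ℕ) (k l : ℕ) (R : List ℕ)

/-- Each rung acts by a coset sum of transpositions, so that the commutators are those of
`transvSum_commutator` and `transvSum_dot_commutator`. -/
lemma freeRep_square_switch (hv : IsStrands r (L ++ [k + 1, l + 1] ++ R)) :
    S.freeRep (FreeWeb.rungL r L k (l + 1) R * FreeWeb.rungR r L k (l + 1) R -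
        FreeWeb.rungR r L (k + 1) l R * FreeWeb.rungL r L (k + 1) l R) =
      S.freeRep (((k : ℂ) - (l : ℂ)) • FreeWeb.ident r (L ++ [k + 1, l + 1] ++ R)) ∧
    S.freeRep (FreeWeb.rungLDot r L k (l + 1) R * FreeWeb.rungR r L k (l + 1) R -
        FreeWeb.rungR r L (k + 1) l R * FreeWeb.rungLDot r L (k + 1) l R) =
      S.freeRep (FreeWeb.dot r L (k + 1) ((l + 1) :: R) -
        FreeWeb.dot r (L ++ [k + 1]) (l + 1) R) ∧
    S.freeRep (FreeWeb.rungL r L k (l + 1) R * FreeWeb.rungRDot r L k (l + 1) R -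
        FreeWeb.rungRDot r L (k + 1) l R * FreeWeb.rungL r L (k + 1) l R) =
      S.freeRep (FreeWeb.dot r L (k + 1) ((l + 1) :: R) -
        FreeWeb.dot r (L ++ [k + 1]) (l + 1) R) := by
  have hs := hv.2
  simp only [List.append_assoc, List.cons_append, List.nil_append, List.sum_append,
    List.sum_cons] at hs
  obtain ⟨p, hp⟩ : ∃ p : Fin r, (p : ℕ) = L.sum + k := ⟨⟨L.sum + k, by omega⟩, rfl⟩
  obtain ⟨q, hq⟩ : ∃ q : Fin r, (q : ℕ) = L.sum + k + 1 := ⟨⟨L.sum + k + 1, by omega⟩, rfl⟩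
  let B := L ++ (k + 1) :: (l + 1) :: R
  let M := L ++ k :: (l + 2) :: R
  let N := L ++ (k + 2) :: l :: R
  have hB : B.sum = r := by simp [B]; omega
  have hM : M.sum = r := by simp [M]; omega
  have hN : N.sum = r := by simp [N]; omega
  let X := block r L.sum (k + 1)
  let Y := block r (L.sum + (k + 1)) (l + 1)
  have hpY : block r (L.sum + k) (l + 1 + 1) = insert p Y := (insert_block_right hp).symm
  have hqX : block r L.sum (k + 1 + 1) = insert q X :=
    (insert_block_left (hq.trans (add_assoc _ _ _))).symm
  have e1 := S.actsBy_rungL (T := B) (B := M) (l := l + 1) (R := R) hp hM rfl rfl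
  have e1' := S.actsBy_rungLDot (T := B) (B := M) (l := l + 1) (R := R) hp hM rfl rfl
  have e2 := S.actsBy_rungR (T := M) (B := B) (l := l + 1) (R := R) hp hB rfl rfl
  have e2' := S.actsBy_rungRDot (T := M) (B := B) (l := l + 1) (R := R) hp hB rfl rfl
  have e3 := S.actsBy_rungL (T := N) (B := B) (k := k + 1) (l := l) (R := R) hq hB rfl rfl
  have e3' := S.actsBy_rungLDot (T := N) (B := B) (k := k + 1) (l := l) (R := R) hq hB rfl rfl
  have e4 := S.actsBy_rungR (T := B) (B := N) (k := k + 1) (l := l) (R := R) hq hN rfl rfl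
  have e4' := S.actsBy_rungRDot (T := B) (B := N) (k := k + 1) (l := l) (R := R) hq hN rfl rfl
  have e5 : S.ActsBy (FreeWeb.ident r (L ++ [k + 1, l + 1] ++ R)) B B (S.youngAvg B) := by
    have := S.actsBy_ident hv.2
    simpa only [List.append_assoc, List.cons_append, List.nil_append] using this
  have e6 : S.ActsBy (FreeWeb.dot r L (k + 1) ((l + 1) :: R)) B B (S.dotSum X * S.youngAvg B) := by
    have := S.actsBy_dot L k.succ_pos ((l + 1) :: R) (by simpa using hv.2)
    simpa only [List.append_assoc, List.cons_append, List.nil_append] using this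
  have e7 : S.ActsBy (FreeWeb.dot r (L ++ [k + 1]) (l + 1) R) B B
      (S.dotSum Y * S.youngAvg B) := by
    have := S.actsBy_dot (L ++ [k + 1]) l.succ_pos R (by simpa using hv.2)
    simpa only [List.append_assoc, List.cons_append, List.nil_append, List.sum_append,
      List.sum_cons, List.sum_nil, add_zero] using this
  rw [hpY] at e2 e2'
  rw [hqX] at e3 e3'
  have hXY : Disjoint X Y := disjoint_block le_rfl
  have hpX : p ∈ X := by simp only [X, mem_block]; omega
  have hqY : q ∈ Y := by simp only [Y, mem_block]; omega
  have hX := S.perm_swap_mul_youngAvg (isBlock_append L (k + 1) ((l + 1) :: R))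
  have hY : ∀ i ∈ Y, ∀ j ∈ Y, S.perm (Equiv.swap i j) * S.youngAvg B = S.youngAvg B := by
    have := isBlock_append (L ++ [k + 1]) (l + 1) R
    simp only [List.append_assoc, List.cons_append, List.nil_append, List.sum_append,
      List.sum_cons, List.sum_nil, add_zero] at this
    exact S.perm_swap_mul_youngAvg this
  have hcX : X.card = k + 1 := card_block (by omega)
  have hcY : Y.card = l + 1 := card_block (by omega)
  refine ⟨((e1.cancel e2).sub (e4.cancel e3)).freeRep_eq (e5.smul _) ?_,
    ((e1'.cancel e2).sub (e4.cancel e3')).freeRep_eq (e6.sub e7) ?_,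
    ((e1.cancel e2').sub (e4'.cancel e3)).freeRep_eq (e6.sub e7) ?_⟩
  · refine (transvSum_commutator hXY hpX hqY hX hY).trans ?_
    rw [hcX, hcY]
    congr 1
    push_cast
    ring
  · have := transvSum_dot_commutator hXY hpX hqY hX hY
    simpa only [mul_assoc] using this
  · have := transvSum_dot_commutator hXY.symm hqY hpX hY hX
    rw [← neg_sub (_ * S.youngAvg B), ← this, neg_sub]
    simp only [mul_assoc]
    rfl

/-- With `I` and `J` the first two of the three blocks at the top, the identities between the actions
of the rungs are `transvSum_double_dots` and `transvSum_double_dot`. -/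
lemma freeRep_double_rungs (he : S.e = 1) (h k l : ℕ)
    (hv : IsStrands r (L ++ [h + 1, k + 1, l + 1] ++ R)) :
    S.freeRep (FreeWeb.rungL r L (h + 1) (k + 1) (l :: R) *
          FreeWeb.rungL r (L ++ [h + 1]) (k + 1) l R -
        FreeWeb.rungL r (L ++ [h + 2]) k l R * FreeWeb.rungL r L (h + 1) k ((l + 1) :: R)) =
      S.freeRep (FreeWeb.rungLDot r L (h + 1) (k + 1) (l :: R) *
          FreeWeb.rungLDot r (L ++ [h + 1]) (k + 1) l R +
        FreeWeb.rungLDot r (L ++ [h + 2]) k l R * FreeWeb.rungLDot r L (h + 1) k ((l + 1) :: R)) ∧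
    S.freeRep (FreeWeb.rungL r L (h + 1) (k + 1) (l :: R) *
          FreeWeb.rungLDot r (L ++ [h + 1]) (k + 1) l R -
        FreeWeb.rungLDot r (L ++ [h + 2]) k l R * FreeWeb.rungL r L (h + 1) k ((l + 1) :: R)) =
      S.freeRep (FreeWeb.rungLDot r L (h + 1) (k + 1) (l :: R) *
          FreeWeb.rungL r (L ++ [h + 1]) (k + 1) l R -
        FreeWeb.rungL r (L ++ [h + 2]) k l R * FreeWeb.rungLDot r L (h + 1) k ((l + 1) :: R)) := by
  have hs := hv.2
  simp only [List.append_assoc, List.cons_append, List.nil_append, List.sum_append,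
    List.sum_cons] at hs
  obtain ⟨p, hp⟩ : ∃ p : Fin r, (p : ℕ) = L.sum + (h + 1) := ⟨⟨L.sum + (h + 1), by omega⟩, rfl⟩
  obtain ⟨q, hq⟩ : ∃ q : Fin r, (q : ℕ) = L.sum + (h + 1) + (k + 1) :=
    ⟨⟨L.sum + (h + 1) + (k + 1), by omega⟩, rfl⟩
  let B := L ++ (h + 1) :: (k + 1) :: (l + 1) :: R
  let M := L ++ (h + 1) :: (k + 2) :: l :: R
  let N := L ++ (h + 2) :: k :: (l + 1) :: R
  let T := L ++ (h + 2) :: (k + 1) :: l :: R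
  have hB : B.sum = r := by simp [B]; omega
  have hM : M.sum = r := by simp [M]; omega
  have hN : N.sum = r := by simp [N]; omega
  let I := block r L.sum (h + 2)
  let J := block r (L.sum + (h + 2)) (k + 1)
  have h1 : (L ++ [h + 1]).sum = L.sum + (h + 1) := by simp
  have h2 : (L ++ [h + 2]).sum = L.sum + (h + 2) := by simp
  have hpJ : block r (L.sum + (h + 1)) (k + 1 + 1) = insert p J := (insert_block_right hp).symm
  have e1 := S.actsBy_rungL (T := T) (B := M) (l := k + 1) (R := l :: R) hp hM rfl rfl
  have e1' := S.actsBy_rungLDot (T := T) (B := M) (l := k + 1) (R := l :: R) hp hM rfl rfl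
  have e2 := S.actsBy_rungL (L := L ++ [h + 1]) (T := M) (B := B) (k := k + 1) (l := l) (R := R)
    (p := q) (by rw [h1, hq]) hB (by simp [M]) (by simp [B])
  have e2' := S.actsBy_rungLDot (L := L ++ [h + 1]) (T := M) (B := B) (k := k + 1) (l := l) (R := R)
    (p := q) (by rw [h1, hq]) hB (by simp [M]) (by simp [B])
  have e3 := S.actsBy_rungL (L := L ++ [h + 2]) (T := T) (B := N) (k := k) (l := l) (R := R)
    (p := q) (by rw [h2, hq]; omega) hN (by simp [T]) (by simp [N])
  have e3' := S.actsBy_rungLDot (L := L ++ [h + 2]) (T := T) (B := N) (k := k) (l := l) (R := R)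
    (p := q) (by rw [h2, hq]; omega) hN (by simp [T]) (by simp [N])
  have e4 := S.actsBy_rungL (T := N) (B := B) (l := k) (R := (l + 1) :: R) hp hB rfl rfl
  have e4' := S.actsBy_rungLDot (T := N) (B := B) (l := k) (R := (l + 1) :: R) hp hB rfl rfl
  rw [h1, hpJ] at e2 e2'
  rw [h2] at e3 e3'
  have hIJ : Disjoint I J := disjoint_block le_rfl
  have hpI : p ∈ I := by simp only [I, mem_block]; omega
  have hqJ : q ∈ J := by simp only [J, mem_block]; omega
  refine ⟨((e1.cancel e2).sub (e3.cancel e4)).freeRep_eq ((e1'.cancel e2').add (e3'.cancel e4')) ?_,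
    ((e1.cancel e2').sub (e3'.cancel e4)).freeRep_eq ((e1'.cancel e2).sub (e3.cancel e4')) ?_⟩
  · simp only [← mul_assoc _ _ (S.youngAvg B), ← sub_mul, ← add_mul]
    congr 1
    exact transvSum_double_dots hIJ hpI hqJ he
  · simp only [← mul_assoc _ _ (S.youngAvg B), ← sub_mul]
    congr 1
    exact transvSum_double_dot hIJ hpI hqJ

lemma freeRep_double_rungs_reversed (he : S.e = 1) (h k l : ℕ)
    (hv : IsStrands r (L ++ [h + 1, k + 1, l + 1] ++ R)) :
    S.freeRep (FreeWeb.rungR r (L ++ [h]) (k + 1) (l + 1) R *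
          FreeWeb.rungR r L h (k + 1) ((l + 1) :: R) -
        FreeWeb.rungR r L h k ((l + 2) :: R) * FreeWeb.rungR r (L ++ [h + 1]) k (l + 1) R) =
      S.freeRep (FreeWeb.rungRDot r (L ++ [h]) (k + 1) (l + 1) R *
          FreeWeb.rungRDot r L h (k + 1) ((l + 1) :: R) +
        FreeWeb.rungRDot r L h k ((l + 2) :: R) * FreeWeb.rungRDot r (L ++ [h + 1]) k (l + 1) R) ∧
    S.freeRep (FreeWeb.rungRDot r (L ++ [h]) (k + 1) (l + 1) R *
          FreeWeb.rungR r L h (k + 1) ((l + 1) :: R) -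
        FreeWeb.rungR r L h k ((l + 2) :: R) * FreeWeb.rungRDot r (L ++ [h + 1]) k (l + 1) R) =
      S.freeRep (FreeWeb.rungR r (L ++ [h]) (k + 1) (l + 1) R *
          FreeWeb.rungRDot r L h (k + 1) ((l + 1) :: R) -
        FreeWeb.rungRDot r L h k ((l + 2) :: R) * FreeWeb.rungR r (L ++ [h + 1]) k (l + 1) R) := by
  have hs := hv.2
  simp only [List.append_assoc, List.cons_append, List.nil_append, List.sum_append,
    List.sum_cons] at hs
  obtain ⟨p, hp⟩ : ∃ p : Fin r, (p : ℕ) = L.sum + h := ⟨⟨L.sum + h, by omega⟩, rfl⟩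
  obtain ⟨q, hq⟩ : ∃ q : Fin r, (q : ℕ) = L.sum + h + (k + 1) :=
    ⟨⟨L.sum + h + (k + 1), by omega⟩, rfl⟩
  let B := L ++ (h + 1) :: (k + 1) :: (l + 1) :: R
  let M := L ++ h :: (k + 2) :: (l + 1) :: R
  let N := L ++ (h + 1) :: k :: (l + 2) :: R
  let T := L ++ h :: (k + 1) :: (l + 2) :: R
  have hB : B.sum = r := by simp [B]; omega
  have hM : M.sum = r := by simp [M]; omega
  have hN : N.sum = r := by simp [N]; omega
  let I := block r (L.sum + h + (k + 1)) (l + 2)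
  let J := block r (L.sum + h) (k + 1)
  have h1 : (L ++ [h]).sum + (k + 1) = L.sum + h + (k + 1) := by simp
  have h2 : (L ++ [h + 1]).sum + k = L.sum + h + (k + 1) := by simp; omega
  have hqJ : block r (L.sum + h) (k + 1 + 1) = insert q J := (insert_block_left hq).symm
  have e1 := S.actsBy_rungR (L := L ++ [h]) (T := T) (B := M) (k := k + 1) (l := l + 1) (R := R)
    (p := q) (by rw [h1, hq]) hM (by simp [T]) (by simp [M])
  have e1' := S.actsBy_rungRDot (L := L ++ [h]) (T := T) (B := M) (k := k + 1) (l := l + 1) (R := R)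
    (p := q) (by rw [h1, hq]) hM (by simp [T]) (by simp [M])
  have e2 := S.actsBy_rungR (T := M) (B := B) (l := k + 1) (R := (l + 1) :: R) hp hB rfl rfl
  have e2' := S.actsBy_rungRDot (T := M) (B := B) (l := k + 1) (R := (l + 1) :: R) hp hB rfl rfl
  have e3 := S.actsBy_rungR (T := T) (B := N) (l := k) (R := (l + 2) :: R) hp hN rfl rfl
  have e3' := S.actsBy_rungRDot (T := T) (B := N) (l := k) (R := (l + 2) :: R) hp hN rfl rfl
  have e4 := S.actsBy_rungR (L := L ++ [h + 1]) (T := N) (B := B) (k := k) (l := l + 1) (R := R)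
    (p := q) (by rw [h2, hq]) hB (by simp [N]) (by simp [B])
  have e4' := S.actsBy_rungRDot (L := L ++ [h + 1]) (T := N) (B := B) (k := k) (l := l + 1) (R := R)
    (p := q) (by rw [h2, hq]) hB (by simp [N]) (by simp [B])
  rw [h1] at e1 e1'
  rw [hqJ] at e2 e2'
  rw [h2] at e4 e4'
  have hIJ : Disjoint I J := (disjoint_block le_rfl).symm
  have hqI : q ∈ I := by simp only [I, mem_block]; omega
  have hpJ : p ∈ J := by simp only [J, mem_block]; omega
  refine ⟨((e1.cancel e2).sub (e3.cancel e4)).freeRep_eq ((e1'.cancel e2').add (e3'.cancel e4')) ?_,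
    ((e1'.cancel e2).sub (e3.cancel e4')).freeRep_eq ((e1.cancel e2').sub (e3'.cancel e4)) ?_⟩
  · simp only [← mul_assoc _ _ (S.youngAvg B), ← sub_mul, ← add_mul]
    congr 1
    exact transvSum_double_dots hIJ hqI hpJ he
  · simp only [← mul_assoc _ _ (S.youngAvg B), ← sub_mul]
    congr 1
    exact (transvSum_double_dot hIJ hqI hpJ).symm

end Ladder

lemma freeRep_sum_ident : S.freeRep (∑ a : Composition r, FreeWeb.ident r a.blocks) = 1 := by
  refine Subtype.ext ?_
  have hval : ∀ s : Finset (Composition r), (S.freeRep (∑ a ∈ s, FreeWeb.ident r a.blocks)).1 =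
      ∑ a ∈ s, matUnit r a.blocks a.blocks (S.youngAvg a.blocks) := by
    intro s
    induction s using Finset.induction_on with
    | empty => rw [Finset.sum_empty, Finset.sum_empty, map_zero]; rfl
    | insert a s ha ih =>
      rw [Finset.sum_insert ha, Finset.sum_insert ha, map_add, ← ih,
        ← (S.actsBy_ident a.blocks_sum).eq]
      rfl
  rw [hval]
  change _ = S.youngDiag
  ext i j
  rw [Matrix.sum_apply, youngDiag, Matrix.diagonal_apply, Finset.sum_eq_single i]
  · have hi : FreeWeb.erase i.blocks = i.blocks := FreeWeb.erase_eq_self fun _ h => i.blocks_pos h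
    simp only [matUnit, hi, true_and, eq_comm (a := j.blocks), ← Composition.ext_iff]
  · intro c _ hc
    have hc' : FreeWeb.erase c.blocks = c.blocks := FreeWeb.erase_eq_self fun _ h => c.blocks_pos h
    have : ¬ i.blocks = c.blocks := fun h => hc (Composition.ext h.symm)
    simp [matUnit, hc', this]
  · simp

/-- The matrices satisfy the defining relations of the web superalgebra. -/
theorem freeRep_rel (he : S.e = 1) {x y : FreeAlgebra ℂ (WebGen r)} (h : WebRel r x y) :
    S.freeRep x = S.freeRep y := by
  cases h with
  | compat g g' h =>
    refine Subtype.ext ?_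
    rw [map_mul, map_zero]
    change (S.freeRep _).1 * (S.freeRep _).1 = 0
    rw [freeRep_ι, freeRep_ι]
    refine matUnit_mul_of_ne ?_
    rwa [g.isStrands_bot.erase_eq, g'.isStrands_top.erase_eq]
  | ident_mul g =>
    exact ((S.actsBy_ident g.isStrands_top.2).mul (S.actsBy_gen g)).freeRep_eq (S.actsBy_gen g)
      (S.youngAvg_mul_genValue g)
  | mul_ident g =>
    exact ((S.actsBy_gen g).mul (S.actsBy_ident g.isStrands_bot.2)).freeRep_eq (S.actsBy_gen g)
      (S.genValue_mul_youngAvg g)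
  | sum_ident => rw [freeRep_sum_ident, map_one]
  | superinterchange L x M y R h => exact S.freeRep_interchange L x M y R h
  | assoc_merge L h k l R hv => exact freeRep_assoc_merge L h k l R hv
  | assoc_split L h k l R hv => exact freeRep_assoc_split L h k l R hv
  | digon L k l R hv => exact freeRep_digon L k l R hv
  | dot_collision L k R hv => exact freeRep_dot_collision he L k R hv
  | dot_merge L k R hv => exact freeRep_dot_merge L 1 k R hv
  | dot_merge_reflected L k R hv => exact freeRep_dot_merge L k 1 R hv
  | split_dot L k R hv => exact freeRep_split_dot L 1 k R hv
  | split_dot_reflected L k R hv => exact freeRep_split_dot L k 1 R hv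
  | dumbbell L R hv => exact freeRep_dumbbell he L R hv
  | square_switch L k l R hv => exact (freeRep_square_switch L k l R hv).1
  | square_switch_dot_top L k l R hv => exact (freeRep_square_switch L k l R hv).2.1
  | square_switch_dot_bot L k l R hv => exact (freeRep_square_switch L k l R hv).2.2
  | double_rungs L h k l R hv => exact (freeRep_double_rungs L R he h k l hv).1
  | double_rungs_dot L h k l R hv => exact (freeRep_double_rungs L R he h k l hv).2
  | double_rungs_reversed L h k l R hv => exact (freeRep_double_rungs_reversed L R he h k l hv).1
  | double_rungs_dot_reversed L h k l R hv =>
    exact (freeRep_double_rungs_reversed L R he h k l hv).2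

/-- The representation of the web superalgebra attached to a Sergeev system whose idempotent is
the unit. -/
noncomputable def webRep (he : S.e = 1) : Web r →ₐ[ℂ] S.WebTarget :=
  RingQuot.liftAlgHom ℂ ⟨S.freeRep, fun _ _ h => freeRep_rel he h⟩

lemma webRep_mk (he : S.e = 1) (w : FreeAlgebra ℂ (WebGen r)) :
    webRep he (Web.mk r w) = S.freeRep w :=
  RingQuot.liftAlgHom_mkAlgHom_apply ℂ _ _ w

end SergeevSystem

/-! ### The action of the complete merges, the complete splits and the Sergeev diagrams -/

lemma isCut_ones (k d : ℕ) : IsCut (List.replicate k 1) d ↔ d ≤ k := by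
  refine ⟨fun h => by simpa using isCut_le_sum h, ?_⟩
  induction k generalizing d with
  | zero => intro h; obtain rfl : d = 0 := by omega
            rfl
  | succ k ih =>
    intro h
    rw [List.replicate_succ, isCut_cons]
    rcases Nat.eq_zero_or_pos d with h0 | h0
    · exact Or.inl h0
    · exact Or.inr ⟨h0, ih _ (by omega)⟩

lemma isCut_replace_ones {L R : List ℕ} {k d : ℕ} (h : IsCut (L ++ k :: R) d) :
    IsCut (L ++ List.replicate k 1 ++ R) d := by
  rw [List.append_assoc, isCut_append] at *
  refine h.imp_right (And.imp_right fun h => ?_)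
  rw [isCut_append, List.sum_replicate, smul_eq_mul, mul_one]
  rcases (isCut_cons _ _ _).1 h with h | h
  · exact Or.inl (h ▸ isCut_zero _)
  · exact Or.inr h

lemma young_ones (r : ℕ) : young r (List.replicate r 1) = ⊥ := by
  rw [eq_bot_iff]
  intro σ hσ
  rw [Subgroup.mem_bot]
  ext p
  have h1 := hσ p p ((isCut_ones _ _).2 p.2.le)
  have h2 := hσ p (p + 1) ((isCut_ones _ _).2 p.2)
  rw [Equiv.Perm.one_apply]
  omega

namespace SergeevSystem

variable {r : ℕ} {A : Type*} [Ring A] [Algebra ℂ A] (S : SergeevSystem r A)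

lemma youngAvg_ones : S.youngAvg (List.replicate r 1) = 1 := by
  have := S.mul_avg_eq (H := young r (List.replicate r 1)) (x := 1) (y := 1) fun σ hσ => by
    rw [young_ones, Subgroup.mem_bot] at hσ
    rw [hσ, map_one, one_mul]
  rwa [one_mul] at this

/-- The web `w` acts from the strands `a` to the strands `b`, by `x`. -/
def Acts (w : Web r) (b a : List ℕ) (x : A) : Prop :=
  ∃ w', Web.mk r w' = w ∧ S.ActsBy w' b a x

namespace Acts

variable {S} {w w' : Web r} {a a' b b' c : List ℕ} {x y : A}

lemma webRep_eq (h : S.Acts w b a x) (he : S.e = 1) : (webRep he w).1 = matUnit r b a x := by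
  obtain ⟨w, rfl, h⟩ := h
  rw [webRep_mk, h.eq]

lemma mul (h : S.Acts w c b x) (h' : S.Acts w' b a y) : S.Acts (w * w') c a (x * y) := by
  obtain ⟨w, rfl, h⟩ := h
  obtain ⟨w', rfl, h'⟩ := h'
  exact ⟨w * w', map_mul _ _ _, h.mul h'⟩

lemma sub (h : S.Acts w b a x) (h' : S.Acts w' b a y) : S.Acts (w - w') b a (x - y) := by
  obtain ⟨w, rfl, h⟩ := h
  obtain ⟨w', rfl, h'⟩ := h'
  exact ⟨w - w', map_sub _ _ _, h.sub h'⟩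

lemma congr (h : S.Acts w b a x) (hb : FreeWeb.erase b = FreeWeb.erase b')
    (ha : FreeWeb.erase a = FreeWeb.erase a') : S.Acts w b' a' x := by
  obtain ⟨w, rfl, h⟩ := h
  refine ⟨w, rfl, ?_, ?_, ?_, ?_⟩
  · rw [← h.sum_bot, ← FreeWeb.sum_erase, ← ha, FreeWeb.sum_erase]
  · rw [h.eq, matUnit_congr hb ha]
  · rw [← S.youngAvg_erase, ← hb, S.youngAvg_erase, h.left]
  · rw [← S.youngAvg_erase, ← ha, S.youngAvg_erase, h.right]

end Acts

lemma acts_ident {a : List ℕ} (h : a.sum = r) : S.Acts (Web.ident r a) a a (S.youngAvg a) :=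
  ⟨_, rfl, S.actsBy_ident h⟩

lemma youngAvg_strand_zero (L R : List ℕ) : S.youngAvg (L ++ 0 :: R) = S.youngAvg (L ++ R) := by
  rw [← S.youngAvg_erase, FreeWeb.erase_append, FreeWeb.erase_zero_cons, ← FreeWeb.erase_append,
    S.youngAvg_erase]

lemma exists_acts_mergeStrand (L : List ℕ) (k : ℕ) (R : List ℕ) (h : (L ++ k :: R).sum = r) :
    ∃ z : ℂ, z ≠ 0 ∧ S.Acts (Web.mergeStrand r L k R) (L ++ k :: R)
      (L ++ List.replicate k 1 ++ R) (z • S.youngAvg (L ++ k :: R)) := by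
  induction k generalizing L with
  | zero =>
    refine ⟨1, one_ne_zero, ?_⟩
    rw [one_smul, youngAvg_strand_zero]
    refine (S.acts_ident (a := L ++ R) (by simpa using h)).congr ?_ ?_
    · simp [FreeWeb.erase_append]
    · simp
  | succ k ih =>
    obtain ⟨z, hz, hk⟩ := ih (L ++ [1]) (by rw [← h]; simp; omega)
    have h1 : S.Acts (Web.merge r L 1 k R) _ _ _ :=
      ⟨_, rfl, S.actsBy_merge L 1 k R (by rw [← h]; simp; omega)⟩
    refine ⟨((1 + k).choose k : ℂ) * z, mul_ne_zero ?_ hz, ?_⟩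
    · exact Nat.cast_ne_zero.2 (Nat.choose_pos (by omega)).ne'
    · have i1 := S.youngAvg_mul_of_ge (a := L ++ [1, k] ++ R) (b := L ++ [1 + k] ++ R)
        fun d hd => (isCut_merge _ _ _ _ _).2 (Or.inl hd)
      simp only [List.append_assoc, List.cons_append, List.nil_append] at hk h1 i1
      have := h1.mul hk
      rw [smul_mul_smul_comm, i1] at this
      rw [Web.mergeStrand, List.replicate_succ, add_comm k 1]
      simpa only [List.append_assoc, List.cons_append] using this

lemma acts_splitStrand (L : List ℕ) (k : ℕ) (R : List ℕ) (h : (L ++ k :: R).sum = r) :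
    S.Acts (Web.splitStrand r L k R) (L ++ List.replicate k 1 ++ R) (L ++ k :: R)
      (S.youngAvg (L ++ k :: R)) := by
  induction k generalizing L with
  | zero =>
    rw [youngAvg_strand_zero]
    refine (S.acts_ident (a := L ++ R) (by simpa using h)).congr ?_ ?_
    · simp
    · simp [FreeWeb.erase_append]
  | succ k ih =>
    have hk := ih (L ++ [1]) (by rw [← h]; simp; omega)
    have h1 : S.Acts (Web.split r L 1 k R) _ _ _ :=
      ⟨_, rfl, S.actsBy_split L 1 k R (by rw [← h]; simp; omega)⟩
    have i1 := S.youngAvg_mul_of_le (a := L ++ [1, k] ++ R) (b := L ++ [1 + k] ++ R)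
      fun d hd => (isCut_merge _ _ _ _ _).2 (Or.inl hd)
    simp only [List.append_assoc, List.cons_append, List.nil_append] at hk h1 i1
    have := hk.mul h1
    rw [i1] at this
    rw [Web.splitStrand, List.replicate_succ, add_comm k 1]
    simpa only [List.append_assoc, List.cons_append] using this

lemma exists_acts_mergeAll (L a : List ℕ) (h : (L ++ a).sum = r) :
    ∃ z : ℂ, z ≠ 0 ∧ S.Acts (Web.mergeAll r L a) (L ++ a) (L ++ List.replicate a.sum 1)
      (z • S.youngAvg (L ++ a)) := by
  induction a generalizing L with
  | nil =>
    refine ⟨1, one_ne_zero, ?_⟩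
    have := S.acts_ident (a := L) (by simpa using h)
    simpa [Web.mergeAll] using this
  | cons k R ih =>
    obtain ⟨z, hz, h1⟩ := S.exists_acts_mergeStrand L k R h
    obtain ⟨z', hz', h2⟩ := ih (L ++ List.replicate k 1) (by rw [← h]; simp)
    refine ⟨z * z', mul_ne_zero hz hz', ?_⟩
    have := h1.mul h2
    rw [smul_mul_smul_comm, S.youngAvg_mul_of_ge fun d => isCut_replace_ones] at this
    rw [Web.mergeAll, List.sum_cons, List.replicate_add, ← List.append_assoc]
    exact this

lemma acts_splitAll (L a : List ℕ) (h : (L ++ a).sum = r) :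
    S.Acts (Web.splitAll r L a) (L ++ List.replicate a.sum 1) (L ++ a)
      (S.youngAvg (L ++ a)) := by
  induction a generalizing L with
  | nil =>
    have := S.acts_ident (a := L) (by simpa using h)
    simpa [Web.splitAll] using this
  | cons k R ih =>
    have h1 := S.acts_splitStrand L k R h
    have h2 := ih (L ++ List.replicate k 1) (by rw [← h]; simp)
    have := h2.mul h1
    rw [S.youngAvg_mul_of_le fun d => isCut_replace_ones] at this
    rw [Web.splitAll, List.sum_cons, List.replicate_add, ← List.append_assoc]
    exact this

lemma acts_ident_ones :
    S.Acts (Web.ident r (List.replicate r 1)) (List.replicate r 1) (List.replicate r 1) 1 := by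
  simpa [S.youngAvg_ones] using S.acts_ident (a := List.replicate r 1) (by simp)

lemma acts_crossing (i : Fin (r - 1)) :
    S.Acts (Web.crossing r i) (List.replicate r 1) (List.replicate r 1)
      (S.perm (Web.simpleSwap r i)) := by
  have hi := i.2
  have hl : List.replicate (i : ℕ) 1 ++ [1, 1] ++ List.replicate (r - 2 - i) 1 =
      List.replicate r 1 := by
    rw [show ([1, 1] : List ℕ) = List.replicate 2 1 from rfl, List.replicate_append_replicate,
      List.replicate_append_replicate]
    congr 1
    omega
  have h1 : S.Acts (Web.split r (List.replicate i 1) 1 1 (List.replicate (r - 2 - i) 1)) _ _ _ :=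
    ⟨_, rfl, S.actsBy_split (List.replicate i 1) 1 1 (List.replicate (r - 2 - i) 1)
      (by simp; omega)⟩
  have h2 : S.Acts (Web.merge r (List.replicate i 1) 1 1 (List.replicate (r - 2 - i) 1)) _ _ _ :=
    ⟨_, rfl, S.actsBy_merge (List.replicate i 1) 1 1 (List.replicate (r - 2 - i) 1)
      (by rw [hl]; simp)⟩
  have h3 := S.two_smul_youngAvg (L := List.replicate i 1) (R := List.replicate (r - 2 - i) 1)
    (p := ⟨i, by omega⟩) (q := ⟨i + 1, by omega⟩) (by simp) (by simp)
  have h4 := h1.mul h2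
  have hc : ((1 + 1).choose 1 : ℂ) = 2 := by norm_num
  rw [hc, mul_smul_comm, S.youngAvg_mul_self, one_add_one_eq_two, h3, hl, S.youngAvg_ones,
    mul_one] at h4
  have h5 := h4.sub S.acts_ident_ones
  rwa [add_sub_cancel_left] at h5

lemma acts_strandDot (j : Fin r) :
    S.Acts (Web.strandDot r j) (List.replicate r 1) (List.replicate r 1) (S.dot j) := by
  have hj := j.2
  have hl : List.replicate (j : ℕ) 1 ++ [1] ++ List.replicate (r - 1 - j) 1 =
      List.replicate r 1 := by
    rw [show ([1] : List ℕ) = List.replicate 1 1 from rfl, List.replicate_append_replicate,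
      List.replicate_append_replicate]
    congr 1
    omega
  have h1 := S.actsBy_dot (List.replicate j 1) one_pos (List.replicate (r - 1 - j) 1)
    (by rw [hl]; simp)
  rw [hl, S.youngAvg_ones, mul_one, S.dotSum_singleton j (by simp)] at h1
  exact ⟨_, rfl, h1⟩

open Classical in
lemma acts_sergeev (a : Set (Fin r)) (σ : Equiv.Perm (Fin r)) :
    S.Acts (Web.sergeev r a σ) (List.replicate r 1) (List.replicate r 1)
      (S.dots ((List.finRange r).filter (· ∈ a)) * S.perm σ) := by
  have h1 : ∀ l : List (Fin r), S.Acts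
      ((l.map fun j => if j ∈ a then Web.strandDot r j else 1).prod *
        Web.ident r (List.replicate r 1)) (List.replicate r 1) (List.replicate r 1)
      (S.dots (l.filter (· ∈ a))) := by
    intro l
    induction l with
    | nil => simpa using S.acts_ident_ones
    | cons i l ih =>
      by_cases hi : i ∈ a
      · simpa [hi, mul_assoc] using (S.acts_strandDot i).mul ih
      · simpa [hi] using ih
  have h2 : ∀ w : List (Fin (r - 1)), S.Acts
      (Web.ident r (List.replicate r 1) * (w.map (Web.crossing r)).prod) (List.replicate r 1)
      (List.replicate r 1) (S.perm (w.map (Web.simpleSwap r)).prod) := by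
    intro w
    induction w using List.reverseRecOn with
    | nil => simpa using S.acts_ident_ones
    | append_singleton w i ih => simpa [mul_assoc] using ih.mul (S.acts_crossing i)
  have h3 : ((Web.word r σ).map (Web.simpleSwap r)).prod = σ := (Web.exists_word r σ).choose_spec
  have := (h1 (List.finRange r)).mul (h2 (Web.word r σ))
  rw [h3, ← mul_assoc, mul_assoc _ _ (Web.ident r _), Web.ident_mul_ident_self] at this
  exact this

end SergeevSystem

open Classical in
/-- The element by which the webs `θ_T` act. -/
lemma exists_acts_theta {r : ℕ} {A : Type*} [Ring A] [Algebra ℂ A] (S : SergeevSystem r A)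
    (lam mu : TrailingComposition r) :
    ∃ z : ℂ, z ≠ 0 ∧ ∀ T : Supertabloid lam mu,
      S.Acts T.theta (List.ofFn mu.parts) (List.ofFn lam.parts)
        (z • (S.youngAvg (List.ofFn mu.parts) *
          (S.dots ((List.finRange r).filter (· ∈ T.dotted)) * S.perm T.strandPerm) *
          S.youngAvg (List.ofFn lam.parts))) := by
  have hs : ∀ a : TrailingComposition r, (List.ofFn a.parts).sum = r := fun a => by
    rw [List.sum_ofFn, a.sum_parts]
  obtain ⟨z, hz, h⟩ := S.exists_acts_mergeAll [] (List.ofFn mu.parts) (hs mu)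
  refine ⟨z, hz, fun T => ?_⟩
  have h' := S.acts_splitAll [] (List.ofFn lam.parts) (hs lam)
  rw [hs] at h h'
  have := (h.mul (S.acts_sergeev T.dotted T.strandPerm)).mul h'
  rwa [smul_mul_assoc, smul_mul_assoc] at this

/-! ### A faithful Sergeev system -/

namespace Fock

variable {r : ℕ}

/-- The sign `(-1) ^ #{i ∈ s | i < j}`. -/
def sign (s : Finset (Fin r)) (j : Fin r) : ℂ := ∏ i ∈ s, if i < j then -1 else 1

lemma sign_symmDiff (s : Finset (Fin r)) (i j : Fin r) :
    sign (symmDiff s {i}) j = sign s j * if i < j then -1 else 1 := by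
  by_cases hi : i ∈ s
  · have h1 : symmDiff s {i} = s.erase i := by
      ext k
      simp only [Finset.mem_symmDiff, Finset.mem_singleton, Finset.mem_erase]
      by_cases hk : k = i <;> simp [hk, hi]
    rw [h1, sign, sign, ← Finset.mul_prod_erase s _ hi]
    split_ifs <;> simp
  · have h1 : symmDiff s {i} = insert i s := by
      ext k
      simp only [Finset.mem_symmDiff, Finset.mem_singleton, Finset.mem_insert]
      by_cases hk : k = i <;> simp [hk, hi]
    rw [h1, sign, sign, Finset.prod_insert hi, mul_comm]

lemma sign_mul_self (s : Finset (Fin r)) (j : Fin r) : sign s j * sign s j = 1 := by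
  rw [sign, ← Finset.prod_mul_distrib]
  refine Finset.prod_eq_one fun i _ => ?_
  split_ifs <;> simp

lemma sign_ne_zero (s : Finset (Fin r)) (j : Fin r) : sign s j ≠ 0 :=
  left_ne_zero_of_mul_eq_one (sign_mul_self s j)

/-- The generators of the Clifford algebra, acting on functions on the subsets of `Fin r`. -/
noncomputable def gamma (j : Fin r) : Module.End ℂ (Finset (Fin r) → ℂ) where
  toFun f s := sign s j * f (symmDiff s {j})
  map_add' f g := by ext s; simp [mul_add]
  map_smul' z f := by ext s; simp [mul_left_comm]

lemma gamma_apply (j : Fin r) (f : Finset (Fin r) → ℂ) (s : Finset (Fin r)) :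
    gamma j f s = sign s j * f (symmDiff s {j}) := rfl

lemma gamma_gamma_self (j : Fin r) (f : Finset (Fin r) → ℂ) : gamma j (gamma j f) = f := by
  ext s
  rw [gamma_apply, gamma_apply, sign_symmDiff, symmDiff_symmDiff_cancel_right, if_neg (lt_irrefl j),
    mul_one, ← mul_assoc, sign_mul_self, one_mul]

lemma gamma_gamma (i j : Fin r) (hij : i ≠ j) (f : Finset (Fin r) → ℂ) :
    gamma i (gamma j f) = -gamma j (gamma i f) := by
  ext s
  rw [Pi.neg_apply, gamma_apply, gamma_apply, gamma_apply, gamma_apply, sign_symmDiff,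
    sign_symmDiff, symmDiff_right_comm s {j}]
  rcases lt_or_gt_of_ne hij with h | h
  · rw [if_pos h, if_neg h.not_gt]; ring
  · rw [if_pos h, if_neg h.not_gt]; ring

/-- The Sergeev system induced from the Clifford algebra: the permutations act by translation on
functions on the symmetric group, with values in the Clifford module. -/
noncomputable def system (r : ℕ) :
    SergeevSystem r (Module.End ℂ (Equiv.Perm (Fin r) → Finset (Fin r) → ℂ)) where
  e := 1
  perm :=
    { toFun := fun σ =>
        { toFun := fun f τ => f (τ * σ)
          map_add' := fun _ _ => rfl
          map_smul' := fun _ _ => rfl }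
      map_one' := by ext; simp
      map_mul' := fun σ σ' => by
        refine LinearMap.ext fun f => funext fun τ => ?_
        change f (τ * (σ * σ')) = f (τ * σ * σ')
        rw [mul_assoc] }
  dot i :=
    { toFun := fun f τ => gamma (τ i) (f τ)
      map_add' := fun f g => funext fun τ => (gamma (τ i)).map_add (f τ) (g τ)
      map_smul' := fun z f => funext fun τ => (gamma (τ i)).map_smul z (f τ) }
  e_mul_e := mul_one 1
  perm_mul_e σ := by rw [mul_one, one_mul]
  e_mul_dot i := one_mul _
  dot_mul_e i := mul_one _
  dot_mul_self i := LinearMap.ext fun f => funext fun τ => gamma_gamma_self (τ i) (f τ)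
  dot_mul_dot i j hij := LinearMap.ext fun f => funext fun τ =>
    gamma_gamma (τ i) (τ j) (τ.injective.ne hij) (f τ)
  perm_mul_dot σ i := rfl

/-- The coefficient of the dots at the positions `s` times the permutation `σ`, up to a sign. -/
noncomputable def coeff (s : Finset (Fin r)) (σ : Equiv.Perm (Fin r)) :
    Module.End ℂ (Equiv.Perm (Fin r) → Finset (Fin r) → ℂ) →ₗ[ℂ] ℂ where
  toFun X := X (Pi.single σ (Pi.single ∅ 1)) 1 s
  map_add' _ _ := rfl
  map_smul' _ _ := rfl

lemma exists_dots_apply {l : List (Fin r)} (hl : l.Nodup)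
    (f : Equiv.Perm (Fin r) → Finset (Fin r) → ℂ) (hf : f 1 = Pi.single ∅ 1) :
    ∃ z : ℂ, z ≠ 0 ∧ (system r).dots l f 1 = Pi.single l.toFinset z := by
  induction l with
  | nil => exact ⟨1, one_ne_zero, hf⟩
  | cons i l ih =>
    obtain ⟨hi, hl⟩ := List.nodup_cons.1 hl
    obtain ⟨z, hz, h⟩ := ih hl
    refine ⟨sign (insert i l.toFinset) i * z, mul_ne_zero (sign_ne_zero _ _) hz, ?_⟩
    rw [SergeevSystem.dots_cons]
    change gamma i ((system r).dots l f 1) = _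
    rw [h]
    have hi' : symmDiff (insert i l.toFinset) {i} = l.toFinset := by
      ext k
      simp only [Finset.mem_symmDiff, Finset.mem_singleton, Finset.mem_insert, List.mem_toFinset]
      by_cases hk : k = i <;> simp [hk, hi]
    ext s
    rw [gamma_apply, List.toFinset_cons]
    by_cases hs : s = insert i l.toFinset
    · rw [hs, hi', Pi.single_eq_same, Pi.single_eq_same]
    · have : symmDiff s {i} ≠ l.toFinset := fun h' => hs <| by
        rw [← symmDiff_symmDiff_cancel_right {i} s, h']
        nth_rewrite 1 [← hi']
        exact symmDiff_symmDiff_cancel_right _ _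
      rw [Pi.single_eq_of_ne hs, Pi.single_eq_of_ne this, mul_zero]

lemma coeff_ne_zero {l : List (Fin r)} (hl : l.Nodup) (σ : Equiv.Perm (Fin r)) :
    coeff l.toFinset σ ((system r).dots l * (system r).perm σ) ≠ 0 := by
  obtain ⟨z, hz, h⟩ := exists_dots_apply hl
    ((system r).perm σ (Pi.single σ (Pi.single ∅ 1))) (by
      change (Pi.single σ (Pi.single ∅ 1) : Equiv.Perm (Fin r) → Finset (Fin r) → ℂ) (1 * σ) = _
      rw [one_mul, Pi.single_eq_same])
  change (system r).dots l ((system r).perm σ (Pi.single σ (Pi.single ∅ 1))) 1 l.toFinset ≠ 0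
  rwa [h, Pi.single_eq_same]

lemma coeff_eq_zero_of_ne {σ τ : Equiv.Perm (Fin r)} (h : τ ≠ σ) (s : Finset (Fin r))
    (l : List (Fin r)) : coeff s σ ((system r).dots l * (system r).perm τ) = 0 := by
  have hd : ∀ (l : List (Fin r)) (f : Equiv.Perm (Fin r) → Finset (Fin r) → ℂ), f 1 = 0 →
      (system r).dots l f 1 = 0 := by
    intro l
    induction l with
    | nil => exact fun f hf => hf
    | cons i l ih =>
      intro f hf
      rw [SergeevSystem.dots_cons]
      change gamma i ((system r).dots l f 1) = _
      rw [ih f hf, map_zero]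
  refine congrFun (hd l ((system r).perm τ (Pi.single σ (Pi.single ∅ 1))) ?_) s
  change (Pi.single σ (Pi.single ∅ 1) : Equiv.Perm (Fin r) → Finset (Fin r) → ℂ) (1 * τ) = _
  rw [one_mul, Pi.single_eq_of_ne h]

lemma coeff_eq_zero_of_toFinset_ne {l : List (Fin r)} (hl : l.Nodup) {s : Finset (Fin r)}
    (hs : s ≠ l.toFinset) (σ : Equiv.Perm (Fin r)) :
    coeff s σ ((system r).dots l * (system r).perm σ) = 0 := by
  obtain ⟨z, hz, h⟩ := exists_dots_apply hl
    ((system r).perm σ (Pi.single σ (Pi.single ∅ 1))) (by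
      change (Pi.single σ (Pi.single ∅ 1) : Equiv.Perm (Fin r) → Finset (Fin r) → ℂ) (1 * σ) = _
      rw [one_mul, Pi.single_eq_same])
  change (system r).dots l ((system r).perm σ (Pi.single σ (Pi.single ∅ 1))) 1 s = 0
  rw [h, Pi.single_eq_of_ne hs]

end Fock

/-! ### The rows of a composition -/

/-- Functions with fibres of the same sizes differ by a permutation of the arguments. -/
lemma exists_perm_of_card_fiber_eq {n : ℕ} {β : Type*} [DecidableEq β] {f g : Fin n → β}
    (h : ∀ x, (Finset.univ.filter fun p => f p = x).card =
      (Finset.univ.filter fun p => g p = x).card) : ∃ v : Equiv.Perm (Fin n), ∀ p, g (v p) = f p := by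
  have e : ∀ x, Nonempty ({p // f p = x} ≃ {p // g p = x}) := fun x => by
    refine Fintype.card_eq.1 ?_
    rw [Fintype.card_subtype, Fintype.card_subtype, h]
  exact ⟨Equiv.ofFiberEquiv fun x => (e x).some, fun p => Equiv.ofFiberEquiv_map _ p⟩

lemma eq_of_monotone_of_card_fiber_eq {n : ℕ} {β : Type*} [LinearOrder β] {f g : Fin n → β}
    (hf : Monotone f) (hg : Monotone g) (h : ∀ x, (Finset.univ.filter fun p => f p = x).card =
      (Finset.univ.filter fun p => g p = x).card) : f = g := by
  obtain ⟨v, hv⟩ := exists_perm_of_card_fiber_eq h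
  have hv' : g ∘ v = f := funext hv
  have := Tuple.unique_monotone (f := g) (σ := v) (τ := 1) (by rwa [hv']) hg
  rw [← hv', this]
  rfl

/-- An initial segment of `Fin n` is determined by its size. -/
lemma Fin.mem_iff_lt_card {n : ℕ} {s : Finset (Fin n)} (h : ∀ p ∈ s, ∀ q ≤ p, q ∈ s) (p : Fin n) :
    p ∈ s ↔ (p : ℕ) < s.card := by
  constructor
  · intro hp
    have : Finset.Iic p ⊆ s := fun q hq => h p hp q (Finset.mem_Iic.1 hq)
    have := Finset.card_le_card this
    rw [Fin.card_Iic] at this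
    omega
  · intro hp
    by_contra hps
    have : s ⊆ Finset.Iio p := fun q hq => Finset.mem_Iio.2 <| by
      by_contra hqp
      exact hps (h q hq p (not_lt.1 hqp))
    have := Finset.card_le_card this
    rw [Fin.card_Iio] at this
    omega

lemma isCut_iff_exists_take (a : List ℕ) (d : ℕ) :
    IsCut a d ↔ ∃ i ≤ a.length, d = (a.take i).sum := by
  induction a generalizing d with
  | nil =>
    refine ⟨fun h => ⟨0, le_rfl, by rw [show d = 0 from h]; rfl⟩, ?_⟩
    rintro ⟨i, _, rfl⟩
    simpa using isCut_zero []
  | cons k a ih =>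
    rw [isCut_cons, ih]
    constructor
    · rintro (rfl | ⟨h, i, hi, h'⟩)
      · exact ⟨0, by simp, by simp⟩
      · exact ⟨i + 1, by simpa using hi, by rw [List.take_succ_cons, List.sum_cons, ← h']; omega⟩
    · rintro ⟨i, hi, rfl⟩
      cases i with
      | zero => exact Or.inl (by simp)
      | succ i => exact Or.inr ⟨by simp, i, by simpa using hi, by simp⟩

namespace TrailingComposition

variable {r : ℕ} (c : TrailingComposition r)

/-- The list with `c.parts i` many entries `i`, for all `i`. -/
def rowList : List (Fin r) := (List.finRange r).flatMap fun i => List.replicate (c.parts i) i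

lemma length_rowList : c.rowList.length = r := by
  rw [rowList, List.length_flatMap]
  simp only [List.length_replicate]
  rw [← List.ofFn_eq_map, List.sum_ofFn, c.sum_parts]

/-- The row that contains the position `p`. -/
def rowOf (p : Fin r) : Fin r := c.rowList.get (p.cast c.length_rowList.symm)

lemma sum_finRange_ite {M : Type*} [AddCommMonoid M] (i : Fin r) (f : Fin r → M) :
    ((List.finRange r).map fun j => if j = i then f j else 0).sum = f i := by
  rw [← List.ofFn_eq_map, List.sum_ofFn]
  simp

lemma rowOf_monotone : Monotone c.rowOf := by
  have h : c.rowList.Pairwise (· ≤ ·) := by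
    rw [rowList, List.pairwise_flatMap]
    refine ⟨fun i _ => List.pairwise_replicate.2 (Or.inr le_rfl), ?_⟩
    refine List.Pairwise.imp ?_ (List.pairwise_lt_finRange r)
    intro i j hij x hx y hy
    rw [List.eq_of_mem_replicate hx, List.eq_of_mem_replicate hy]
    exact hij.le
  intro p q hpq
  rcases hpq.eq_or_lt with rfl | hlt
  · exact le_rfl
  · exact List.pairwise_iff_get.1 h _ _ hlt

lemma map_rowOf : (List.finRange r).map c.rowOf = c.rowList := by
  refine List.ext_get (by simp [length_rowList]) fun n h1 h2 => ?_
  simp [rowOf]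

lemma card_rowOf (i : Fin r) : (Finset.univ.filter fun p => c.rowOf p = i).card = c.parts i := by
  have h1 : c.rowList.count i = c.parts i := by
    rw [rowList, List.count_flatMap]
    simp only [Function.comp_def, List.count_replicate, beq_iff_eq]
    exact sum_finRange_ite i c.parts
  rw [← h1, ← map_rowOf, ← Multiset.coe_count, ← Multiset.map_coe, Multiset.count_map,
    Finset.card_def, Finset.filter_val]
  simp only [eq_comm (a := i)]
  rfl

lemma isCut_iff (d : ℕ) : IsCut (List.ofFn c.parts) d ↔
    ∃ i ≤ r, d = (Finset.univ.filter fun p => (c.rowOf p : ℕ) < i).card := by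
  rw [isCut_iff_exists_take, List.length_ofFn]
  refine exists_congr fun i => and_congr_right fun _ => ?_
  rw [List.sum_take_ofFn]
  have : (Finset.univ.filter fun p => (c.rowOf p : ℕ) < i).card =
      ∑ j ∈ Finset.univ.filter (fun j : Fin r => (j : ℕ) < i),
        (Finset.univ.filter fun p => c.rowOf p = j).card := by
    rw [Finset.card_eq_sum_card_fiberwise (f := c.rowOf)
      (t := Finset.univ.filter fun j : Fin r => (j : ℕ) < i)]
    · refine Finset.sum_congr rfl fun j hj => ?_
      rw [Finset.filter_filter]
      congr 1
      ext p
      simp only [Finset.mem_filter, Finset.mem_univ, true_and] at hj ⊢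
      exact ⟨fun h => h.2, fun h => ⟨h ▸ hj, h⟩⟩
    · intro p hp
      simpa using hp
  rw [this]
  simp only [card_rowOf]

lemma sameBlock_iff (p q : Fin r) :
    SameBlock (List.ofFn c.parts) p q ↔ c.rowOf p = c.rowOf q := by
  have key : ∀ (i : ℕ) (p : Fin r), (c.rowOf p : ℕ) < i ↔
      (p : ℕ) < (Finset.univ.filter fun p => (c.rowOf p : ℕ) < i).card := by
    intro i p
    rw [← Fin.mem_iff_lt_card]
    · simp
    · intro p hp q hq
      simp only [Finset.mem_filter, Finset.mem_univ, true_and] at hp ⊢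
      exact lt_of_le_of_lt (c.rowOf_monotone hq) hp
  constructor
  · intro h
    have h' : ∀ i ≤ r, (c.rowOf p : ℕ) < i ↔ (c.rowOf q : ℕ) < i := fun i hi => by
      rw [key i p, key i q]
      exact h _ ((c.isCut_iff _).2 ⟨i, hi, rfl⟩)
    have h1 := h' (c.rowOf p) (c.rowOf p).2.le
    have h2 := h' (c.rowOf q) (c.rowOf q).2.le
    exact Fin.ext (by omega)
  · intro h d hd
    obtain ⟨i, _, rfl⟩ := (c.isCut_iff d).1 hd
    rw [← key, ← key, h]

lemma mem_young_iff {σ : Equiv.Perm (Fin r)} :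
    σ ∈ young r (List.ofFn c.parts) ↔ ∀ p, c.rowOf (σ p) = c.rowOf p :=
  forall_congr' fun p => (c.sameBlock_iff p (σ p)).trans eq_comm

end TrailingComposition

/-! ### Supertabloids and double cosets -/

lemma Letter.ext_iff {r : ℕ} {x y : Letter r} :
    x = y ↔ x.index = y.index ∧ (x.IsPrimed ↔ y.IsPrimed) := by
  obtain ⟨i, b⟩ := x
  obtain ⟨j, b'⟩ := y
  constructor
  · rintro h
    rw [h]
    exact ⟨rfl, Iff.rfl⟩
  · rintro ⟨rfl : i = j, h⟩
    change b = false ↔ b' = false at h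
    congr 1
    cases b <;> cases b' <;> simp_all

lemma Letter.eq_primed {r : ℕ} {x : Letter r} (h : x.IsPrimed) : x = Letter.primed x.index :=
  Letter.ext_iff.2 ⟨rfl, iff_of_true h rfl⟩

namespace Supertabloid

variable {r : ℕ} {lam mu : TrailingComposition r}

/-- The rows consist of the entries at their positions. -/
lemma count_row (T : Supertabloid lam mu) (i : Fin r) (x : Letter r) :
    (T.row i).count x = (Finset.univ.filter fun p => lam.rowOf p = i ∧ T.entry p = x).card := by
  let Z : List (Fin r × Letter r) :=
    (List.finRange r).flatMap fun i => ((T.row i).sort (· ≤ ·)).map (Prod.mk i)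
  have h1 : Z.map Prod.fst = lam.rowList := by
    simp only [Z, List.map_flatMap, List.map_map, Function.comp_def, List.map_const',
      Multiset.length_sort, T.shape]
    rfl
  have h2 : Z.map Prod.snd = T.reading := by
    simp only [Z, List.map_flatMap, List.map_map, Function.comp_def, List.map_id']
    rfl
  have h3 : (List.finRange r).map (fun p => (lam.rowOf p, T.entry p)) = Z := by
    have hl : Z.length = r := by rw [← List.length_map (f := Prod.fst), h1, lam.length_rowList]
    refine List.ext_get (by simp [hl]) fun n hn1 hn2 => ?_
    have e1 : (lam.rowList.get ⟨n, by rw [lam.length_rowList, ← hl]; exact hn2⟩) =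
        (Z.get ⟨n, hn2⟩).1 := by simp [← h1]
    have e2 : (T.reading.get ⟨n, by rw [T.length_reading, ← hl]; exact hn2⟩) =
        (Z.get ⟨n, hn2⟩).2 := by simp [← h2]
    refine Eq.trans ?_ (Prod.ext e1 e2 : (_, _) = Z.get ⟨n, hn2⟩)
    simp [TrailingComposition.rowOf, entry]
  have h4 : (Z : Multiset (Fin r × Letter r)).count (i, x) = (T.row i).count x := by
    have h5 : ∀ j, (((T.row j).sort (· ≤ ·)).map (Prod.mk j) : Multiset (Fin r × Letter r)).count
        (i, x) = if j = i then (T.row j).count x else 0 := by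
      intro j
      rw [← Multiset.map_coe, Multiset.sort_eq]
      split_ifs with h
      · subst h
        exact Multiset.count_map_eq_count' _ _ (Prod.mk_right_injective j) x
      · refine Multiset.count_eq_zero.2 fun hm => ?_
        obtain ⟨y, _, hy⟩ := Multiset.mem_map.1 hm
        exact h (Prod.ext_iff.1 hy).1
    rw [← Multiset.coe_bind, Multiset.count_bind]
    simp only [h5, Multiset.map_coe, Multiset.sum_coe]
    exact TrailingComposition.sum_finRange_ite i fun j => (T.row j).count x
  rw [← h4, ← h3, ← Multiset.map_coe, Multiset.count_map, Finset.card_def, Finset.filter_val]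
  simp only [Prod.mk.injEq, eq_comm (a := i), eq_comm (a := x)]
  rfl

lemma map_entry (T : Supertabloid lam mu) :
    Finset.univ.val.map T.entry = ∑ i, T.row i := by
  ext x
  rw [Multiset.count_sum', Multiset.count_map]
  simp only [count_row]
  rw [← Finset.filter_val, ← Finset.card_def,
    Finset.card_eq_sum_card_fiberwise (f := lam.rowOf) (t := Finset.univ) (by simp)]
  refine Finset.sum_congr rfl fun i _ => ?_
  rw [Finset.filter_filter]
  congr 1
  ext p
  simp only [Finset.mem_filter, Finset.mem_univ, true_and, eq_comm (a := x), and_comm]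

lemma card_index (T : Supertabloid lam mu) (j : Fin r) :
    (Finset.univ.filter fun p => (T.entry p).index = j).card = mu.parts j := by
  rw [← T.type j, ← map_entry, Multiset.countP_map, Finset.card_def, Finset.filter_val]

/-- The groupings of the upper positions correspond to the entries without primes. -/
lemma rowOf_strandPerm (T : Supertabloid lam mu) (p : Fin r) :
    mu.rowOf (T.strandPerm p) = (T.entry p).index := by
  have h1 : Monotone ((fun p => (T.entry p).index) ∘ Tuple.sort fun p => (T.entry p).index) :=
    Tuple.monotone_sort _
  have h2 := eq_of_monotone_of_card_fiber_eq h1 mu.rowOf_monotone fun j => by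
    rw [mu.card_rowOf, ← T.card_index j]
    refine Finset.card_bij (fun p _ => Tuple.sort (fun p => (T.entry p).index) p) ?_ ?_ ?_
    · intro p hp; simpa using hp
    · intro p _ q _ h; exact Equiv.injective _ h
    · intro p hp
      exact ⟨T.strandPerm p, by simpa [strandPerm] using hp, by simp [strandPerm]⟩
  rw [← h2]
  simp [strandPerm]

lemma mem_dotted (T : Supertabloid lam mu) (p : Fin r) :
    T.strandPerm p ∈ T.dotted ↔ (T.entry p).IsPrimed := by
  simp [dotted]

/-- The supertabloid with given entries. -/
def ofEntries (e : Fin r → Letter r)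
    (he : ∀ j, (Finset.univ.filter fun p => (e p).index = j).card = mu.parts j) :
    Supertabloid lam mu where
  row i := (Finset.univ.filter fun p => lam.rowOf p = i).val.map e
  shape i := by rw [Multiset.card_map, Finset.card_val, lam.card_rowOf]
  type j := by
    have : ∑ i, (Finset.univ.filter fun p => lam.rowOf p = i).val.map e =
        Finset.univ.val.map e := by
      ext x
      rw [Multiset.count_sum']
      simp only [Multiset.count_map]
      simp only [← Finset.filter_val, ← Finset.card_def]
      rw [Finset.card_eq_sum_card_fiberwise (f := lam.rowOf) (t := Finset.univ) (by simp)]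
      refine Finset.sum_congr rfl fun i _ => ?_
      rw [Finset.filter_filter, Finset.filter_filter]
      simp only [and_comm]
    rw [this, Multiset.countP_map, ← Finset.filter_val, ← Finset.card_def, he]

/-- Each Sergeev diagram belongs to the double coset of a diagram `w_T`, up to a sign. -/
lemma exists_of_diagram (lam mu : TrailingComposition r) (s : Set (Fin r))
    (σ : Equiv.Perm (Fin r)) :
    ∃ (T : Supertabloid lam mu), ∃ u ∈ young r (List.ofFn mu.parts),
      ∃ v ∈ young r (List.ofFn lam.parts), σ = u * T.strandPerm * v ∧
        ∀ q, u q ∈ s ↔ q ∈ T.dotted := by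
  classical
  let e : Fin r → Letter r := fun p => toLex (mu.rowOf (σ p), decide (σ p ∉ s))
  have he : ∀ p, (e p).index = mu.rowOf (σ p) := fun p => rfl
  have he' : ∀ p, (e p).IsPrimed ↔ σ p ∈ s := fun p => by
    simp [e, Letter.IsPrimed]
  let T : Supertabloid lam mu := ofEntries e fun j => by
    rw [← mu.card_rowOf j]
    refine Finset.card_bij (fun p _ => σ p) (fun p hp => by simpa [he] using hp)
      (fun p _ q _ h => σ.injective h) fun p hp => ⟨σ⁻¹ p, ?_, by simp⟩
    simpa [he] using hp
  obtain ⟨v, hv⟩ := exists_perm_of_card_fiber_eq (f := fun p => (lam.rowOf p, e p))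
    (g := fun p => (lam.rowOf p, T.entry p)) fun x => by
      have h1 := T.count_row x.1 x.2
      have h2 : (T.row x.1).count x.2 =
          (Finset.univ.filter fun p => lam.rowOf p = x.1 ∧ e p = x.2).card := by
        change ((Finset.univ.filter fun p => lam.rowOf p = x.1).val.map e).count x.2 = _
        rw [Multiset.count_map, ← Finset.filter_val, ← Finset.card_def, Finset.filter_filter]
        simp only [eq_comm (a := x.2)]
      simp only [Prod.ext_iff]
      rw [← h2, h1]
  simp only [Prod.mk.injEq] at hv
  have hu : ∀ p, (σ * v⁻¹ * T.strandPerm⁻¹) (T.strandPerm (v p)) = σ p := fun p => by simp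
  have hsurj : ∀ q, ∃ p, q = T.strandPerm (v p) := fun q => ⟨v⁻¹ (T.strandPerm⁻¹ q), by simp⟩
  refine ⟨T, σ * v⁻¹ * T.strandPerm⁻¹, ?_, v, ?_, by simp [mul_assoc], ?_⟩
  · refine mu.mem_young_iff.2 fun q => ?_
    obtain ⟨p, rfl⟩ := hsurj q
    rw [hu, rowOf_strandPerm, (hv p).2, he]
  · exact lam.mem_young_iff.2 fun p => (hv p).1
  · intro q
    obtain ⟨p, rfl⟩ := hsurj q
    rw [hu, mem_dotted, (hv p).2, he']

section DoubleCoset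

variable {T T' : Supertabloid lam mu} {u v : Equiv.Perm (Fin r)}
  (hu : u ∈ young r (List.ofFn mu.parts)) (hv : v ∈ young r (List.ofFn lam.parts))
  (h : u * T.strandPerm * v = T'.strandPerm) (hd : ∀ q, u q ∈ T'.dotted ↔ q ∈ T.dotted)

include hu h hd in
lemma entry_eq_of_diagram (p : Fin r) : T'.entry p = T.entry (v p) := by
  have hp : T'.strandPerm p = u (T.strandPerm (v p)) := by rw [← h]; rfl
  refine Letter.ext_iff.2 ⟨?_, ?_⟩
  · rw [← rowOf_strandPerm, ← rowOf_strandPerm, hp, mu.mem_young_iff.1 hu]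
  · rw [← mem_dotted, ← mem_dotted, hp, hd]

include hu hv h hd in
/-- The diagrams `w_T` belong to different double cosets. -/
lemma eq_of_diagram : T = T' := by
  refine Supertabloid.ext (funext fun i => Multiset.ext.2 fun x => ?_)
  rw [count_row, count_row]
  refine (Finset.card_bij (fun p _ => v p) ?_ (fun p _ q _ h => v.injective h) ?_).symm
  · intro p hp
    simp only [Finset.mem_filter, Finset.mem_univ, true_and] at hp ⊢
    rw [lam.mem_young_iff.1 hv, ← entry_eq_of_diagram hu h hd]
    exact hp
  · intro p hp
    refine ⟨v⁻¹ p, ?_, by simp⟩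
    simp only [Finset.mem_filter, Finset.mem_univ, true_and] at hp ⊢
    rw [entry_eq_of_diagram hu h hd, ← lam.mem_young_iff.1 hv]
    simpa using hp

end DoubleCoset

/-- In a restricted supertabloid the primed entries are determined by their row. -/
lemma IsRestricted.eq_of_entry_eq {T : Supertabloid lam mu} (hT : T.IsRestricted) {p q : Fin r}
    (hrow : lam.rowOf p = lam.rowOf q) (hp : (T.entry p).IsPrimed) (h : T.entry p = T.entry q) :
    p = q := by
  have h1 := hT (lam.rowOf p) (T.entry p).index
  rw [count_row, ← Letter.eq_primed hp] at h1
  exact Finset.card_le_one.1 h1 p (by simp) q (by simp [hrow, h])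

/-- The stabilizer of a diagram that belongs to a restricted supertabloid fixes its dots. -/
lemma IsRestricted.apply_eq {T : Supertabloid lam mu} (hT : T.IsRestricted)
    {u v : Equiv.Perm (Fin r)} (hu : u ∈ young r (List.ofFn mu.parts))
    (hv : v ∈ young r (List.ofFn lam.parts)) (h : u * T.strandPerm * v = T.strandPerm)
    (hd : ∀ q, u q ∈ T.dotted ↔ q ∈ T.dotted) {q : Fin r} (hq : q ∈ T.dotted) : u q = q := by
  obtain ⟨p, rfl⟩ : ∃ p, q = T.strandPerm (v p) := ⟨v⁻¹ (T.strandPerm⁻¹ q), by simp⟩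
  have h1 := entry_eq_of_diagram hu h hd p
  have h2 : v p = p := hT.eq_of_entry_eq (lam.mem_young_iff.1 hv p) ((T.mem_dotted _).1 hq) h1.symm
  have h3 : T.strandPerm p = u (T.strandPerm (v p)) := by
    conv_lhs => rw [← h]
    rfl
  rw [← h3, h2]

/-- If a supertabloid is not restricted, some transposition stabilizes its diagram and interchanges
two dots. -/
lemma exists_swap_of_not_isRestricted {T : Supertabloid lam mu} (hT : ¬ T.IsRestricted) :
    ∃ p q : Fin r, p ≠ q ∧ lam.rowOf p = lam.rowOf q ∧
      mu.rowOf (T.strandPerm p) = mu.rowOf (T.strandPerm q) ∧ T.strandPerm p ∈ T.dotted ∧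
        T.strandPerm q ∈ T.dotted := by
  simp only [IsRestricted, not_forall, not_le] at hT
  obtain ⟨i, j, h⟩ := hT
  rw [count_row, Finset.one_lt_card] at h
  obtain ⟨p, hp, q, hq, hpq⟩ := h
  simp only [Finset.mem_filter, Finset.mem_univ, true_and] at hp hq
  refine ⟨p, q, hpq, hp.1.trans hq.1.symm, ?_, ?_, ?_⟩
  · rw [rowOf_strandPerm, rowOf_strandPerm, hp.2, hq.2]
  · rw [mem_dotted, hp.2]; rfl
  · rw [mem_dotted, hq.2]; rfl

end Supertabloid

/-! ### The webs of supertabloids span -/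

namespace Web

variable {r : ℕ}

lemma mergeAll_erase {L a : List ℕ} (hL : ∀ x ∈ L, 0 < x) (h : (L ++ a).sum = r) :
    mergeAll r L (FreeWeb.erase a) = mergeAll r L a := by
  induction a generalizing L with
  | nil => rfl
  | cons k R ih =>
    rcases Nat.eq_zero_or_pos k with rfl | hk
    · have hs : IsStrands r (L ++ FreeWeb.erase R) := by
        refine ⟨fun x hx => (List.mem_append.1 hx).elim (hL x) (FreeWeb.erase_pos R x), ?_⟩
        rw [List.sum_append, FreeWeb.sum_erase, ← h]; simp
      have h1 : ident r (L ++ R) = ident r (L ++ FreeWeb.erase R) :=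
        ident_congr (by simp only [FreeWeb.erase_append, FreeWeb.erase_erase])
      rw [FreeWeb.erase_zero_cons, mergeAll, mergeStrand, List.replicate_zero, List.append_nil,
        ← ih hL (by simpa using h), h1, ident_mul_mergeAll hs]
    · rw [FreeWeb.erase_cons_of_pos hk, mergeAll, mergeAll, mergeStrand_congr k rfl
        (FreeWeb.erase_erase R), ih]
      · intro x hx
        rcases List.mem_append.1 hx with hx | hx
        · exact hL x hx
        · rw [List.eq_of_mem_replicate hx]; exact one_pos
      · rw [← h]; simp

lemma splitAll_erase {L a : List ℕ} (hL : ∀ x ∈ L, 0 < x) (h : (L ++ a).sum = r) :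
    splitAll r L (FreeWeb.erase a) = splitAll r L a := by
  induction a generalizing L with
  | nil => rfl
  | cons k R ih =>
    rcases Nat.eq_zero_or_pos k with rfl | hk
    · have hs : IsStrands r (L ++ FreeWeb.erase R) := by
        refine ⟨fun x hx => (List.mem_append.1 hx).elim (hL x) (FreeWeb.erase_pos R x), ?_⟩
        rw [List.sum_append, FreeWeb.sum_erase, ← h]; simp
      have h1 : ident r (L ++ R) = ident r (L ++ FreeWeb.erase R) :=
        ident_congr (by simp only [FreeWeb.erase_append, FreeWeb.erase_erase])
      rw [FreeWeb.erase_zero_cons, splitAll, splitStrand, List.replicate_zero, List.append_nil,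
        ← ih hL (by simpa using h), h1, splitAll_mul_ident hs]
    · rw [FreeWeb.erase_cons_of_pos hk, splitAll, splitAll, splitStrand_congr k rfl
        (FreeWeb.erase_erase R), ih]
      · intro x hx
        rcases List.mem_append.1 hx with hx | hx
        · exact hL x hx
        · rw [List.eq_of_mem_replicate hx]; exact one_pos
      · rw [← h]; simp

end Web

namespace TrailingComposition

variable {r : ℕ} (lam mu : TrailingComposition r)

lemma sum_ofFn : (List.ofFn mu.parts).sum = r := by rw [List.sum_ofFn, mu.sum_parts]

lemma isStrands : IsStrands r (FreeWeb.erase (List.ofFn mu.parts)) := by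
  have := FreeWeb.isStrands_erase (List.ofFn mu.parts)
  rwa [mu.sum_ofFn] at this

/-- The complete merges onto the strands of a composition. -/
noncomputable def mergeWeb : Web r := Web.mergeAll r [] (List.ofFn mu.parts)

/-- The complete splits of the strands of a composition. -/
noncomputable def splitWeb : Web r := Web.splitAll r [] (List.ofFn mu.parts)

lemma mergeWeb_eq : mu.mergeWeb = Web.mergeAll r [] (FreeWeb.erase (List.ofFn mu.parts)) :=
  (Web.mergeAll_erase (by simp) mu.sum_ofFn).symm

lemma splitWeb_eq : mu.splitWeb = Web.splitAll r [] (FreeWeb.erase (List.ofFn mu.parts)) :=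
  (Web.splitAll_erase (by simp) mu.sum_ofFn).symm

lemma idWeb_eq : mu.idWeb = Web.ident r (FreeWeb.erase (List.ofFn mu.parts)) :=
  (Web.ident_erase _).symm

lemma idWeb_mul_mergeWeb : mu.idWeb * mu.mergeWeb = mu.mergeWeb := by
  rw [mergeWeb_eq, idWeb_eq]
  exact Web.ident_mul_mergeAll (K := []) mu.isStrands

lemma splitWeb_mul_idWeb : mu.splitWeb * mu.idWeb = mu.splitWeb := by
  rw [splitWeb_eq, idWeb_eq]
  exact Web.splitAll_mul_ident (K := []) mu.isStrands

lemma mergeWeb_mul_perm {σ : Equiv.Perm (Fin r)} (h : σ ∈ young r (List.ofFn mu.parts)) :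
    mu.mergeWeb * (Web.sergeevSystem r).perm σ = mu.mergeWeb := by
  rw [mergeWeb_eq]
  exact Web.mergeAll_mul_perm mu.isStrands (by rwa [← young_congr (isCut_erase _)])

lemma perm_mul_splitWeb {σ : Equiv.Perm (Fin r)} (h : σ ∈ young r (List.ofFn mu.parts)) :
    (Web.sergeevSystem r).perm σ * mu.splitWeb = mu.splitWeb := by
  rw [splitWeb_eq]
  exact Web.perm_mul_splitAll mu.isStrands (by rwa [← young_congr (isCut_erase _)])

/-- The web of the Sergeev diagram with permutation `σ` and dots in the order of the list `l`,
between the complete splits and the complete merges. -/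
noncomputable def diagramWeb (l : List (Fin r)) (σ : Equiv.Perm (Fin r)) : Web r :=
  mu.mergeWeb * ((Web.sergeevSystem r).dots l * (Web.sergeevSystem r).perm σ *
    (Web.sergeevSystem r).e) * lam.splitWeb

/-- The splits and merges absorb permutations of their strands. -/
lemma diagramWeb_map {u v : Equiv.Perm (Fin r)} (hu : u ∈ young r (List.ofFn mu.parts))
    (hv : v ∈ young r (List.ofFn lam.parts)) (l : List (Fin r)) (σ : Equiv.Perm (Fin r)) :
    diagramWeb lam mu (l.map u) (u * σ * v) = diagramWeb lam mu l σ := by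
  let S := Web.sergeevSystem r
  have h1 : S.dots (l.map u) * S.perm (u * σ * v) = S.perm u * (S.dots l * S.perm σ) * S.perm v := by
    rw [map_mul, map_mul, ← mul_assoc (S.perm u), S.perm_mul_dots]
    simp only [mul_assoc]
  have h2 : S.perm v * S.e * lam.splitWeb = S.e * lam.splitWeb := by
    rw [S.perm_mul_e, mul_assoc, lam.perm_mul_splitWeb hv]
  change mu.mergeWeb * (S.dots (l.map u) * S.perm (u * σ * v) * S.e) * lam.splitWeb =
    mu.mergeWeb * (S.dots l * S.perm σ * S.e) * lam.splitWeb
  rw [h1]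
  calc _ = mu.mergeWeb * S.perm u * (S.dots l * S.perm σ) * (S.perm v * S.e * lam.splitWeb) := by
        simp only [mul_assoc]
    _ = _ := by
        rw [mu.mergeWeb_mul_perm hu, h2]; simp only [mul_assoc]

end TrailingComposition

namespace Supertabloid

variable {r : ℕ} {lam mu : TrailingComposition r}

open Classical in
/-- The end positions of the strands of primed entries, in increasing order. -/
noncomputable def dotList (T : Supertabloid lam mu) : List (Fin r) :=
  (List.finRange r).filter (· ∈ T.dotted)

lemma mem_dotList (T : Supertabloid lam mu) (q : Fin r) : q ∈ T.dotList ↔ q ∈ T.dotted := by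
  simp [dotList]

lemma nodup_dotList (T : Supertabloid lam mu) : T.dotList.Nodup := (List.nodup_finRange r).filter _

lemma theta_eq (T : Supertabloid lam mu) :
    T.theta = TrailingComposition.diagramWeb lam mu T.dotList T.strandPerm := by
  rw [theta, diagram, Web.sergeev_eq]
  rfl

lemma theta_mem_corner (T : Supertabloid lam mu) :
    T.theta ∈ Web.corner r mu.idWeb lam.idWeb := by
  refine ⟨T.theta, ?_⟩
  change mu.idWeb * (T.theta * lam.idWeb) = T.theta
  rw [theta_eq, TrailingComposition.diagramWeb, mul_assoc, lam.splitWeb_mul_idWeb, ← mul_assoc,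
    ← mul_assoc, mu.idWeb_mul_mergeWeb]

/-- Two dots on strands that are both split and merged can be interchanged by moving the strands,
which changes the sign. -/
lemma theta_eq_zero {T : Supertabloid lam mu} (hT : ¬ T.IsRestricted) : T.theta = 0 := by
  obtain ⟨p, q, hpq, hlam, hmu, hp, hq⟩ := exists_swap_of_not_isRestricted hT
  have hu := swap_mem_young ((mu.sameBlock_iff _ _).2 hmu)
  have hv := swap_mem_young ((lam.sameBlock_iff _ _).2 hlam)
  have h1 := TrailingComposition.diagramWeb_map lam mu hu hv T.dotList T.strandPerm
  have h2 : Equiv.swap (T.strandPerm p) (T.strandPerm q) * T.strandPerm * Equiv.swap p q =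
      T.strandPerm := by
    rw [mul_assoc, Equiv.mul_swap_eq_swap_mul, ← mul_assoc, Equiv.swap_mul_self, one_mul]
  rw [h2, TrailingComposition.diagramWeb, (Web.sergeevSystem r).dots_map_swap T.nodup_dotList
    (T.strandPerm.injective.ne hpq) ((T.mem_dotList _).2 hp) ((T.mem_dotList _).2 hq)] at h1
  have hneg : ∀ {A : Type} [Ring A] (m d p e s : A), m * (-d * p * e) * s = -(m * (d * p * e) * s) :=
    by simp
  have h3 : -T.theta = T.theta := by
    rw [theta_eq]; exact (hneg _ _ _ _ _).symm.trans h1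
  have h4 : (2 : ℂ) • T.theta = 0 := by
    rw [two_smul]
    nth_rewrite 1 [← h3]
    exact neg_add_cancel _
  exact (smul_eq_zero.1 h4).resolve_left two_ne_zero

/-- The diagram lies in the double coset of the diagram of a supertabloid, by which it is a signed
copy of `θ_T` or zero. -/
lemma diagramWeb_mem_span (l : List (Fin r)) (σ : Equiv.Perm (Fin r)) :
    TrailingComposition.diagramWeb lam mu l σ ∈
      Submodule.span ℂ (Set.range fun T : {T : Supertabloid lam mu // T.IsRestricted} =>
        T.1.theta) := by
  have hsign : ∀ (s : ℤˣ) {x : Web r} {V : Submodule ℂ (Web r)}, x ∈ V → s • x ∈ V := by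
    intro s x V hx
    rcases Int.units_eq_one_or s with rfl | rfl
    · rwa [one_smul]
    · rw [Units.neg_smul, one_smul]
      exact V.neg_mem hx
  -- distinct dots, to which the general case reduces because repeated dots cancel
  have key : ∀ l : List (Fin r), l.Nodup → TrailingComposition.diagramWeb lam mu l σ ∈
      Submodule.span ℂ (Set.range fun T : {T : Supertabloid lam mu // T.IsRestricted} =>
        T.1.theta) := by
    intro l hl
    obtain ⟨T, u, hu, v, hv, hσ, hd⟩ := exists_of_diagram lam mu {q | q ∈ l} σ
    have hl' : (l.map (u⁻¹ : Equiv.Perm (Fin r))).map u = l := by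
      rw [List.map_map, show u ∘ (u⁻¹ : Equiv.Perm (Fin r)) = id from funext u.apply_symm_apply,
        List.map_id]
    have hperm : (l.map (u⁻¹ : Equiv.Perm (Fin r))).Perm T.dotList := by
      refine (List.perm_ext_iff_of_nodup (hl.map (Equiv.injective _)) T.nodup_dotList).2 fun q => ?_
      rw [mem_dotList, ← hd, Set.mem_ofPred_eq]
      conv_rhs => rw [← hl']
      exact (List.mem_map_of_injective u.injective).symm
    obtain ⟨s, hs⟩ := (Web.sergeevSystem r).exists_sign_dots hperm (hl.map (Equiv.injective _))
    have h1 : TrailingComposition.diagramWeb lam mu l σ = s • T.theta := by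
      rw [← hl', hσ, TrailingComposition.diagramWeb_map lam mu hu hv, theta_eq,
        TrailingComposition.diagramWeb, hs, TrailingComposition.diagramWeb, smul_mul_assoc,
        smul_mul_assoc, mul_smul_comm, smul_mul_assoc]
    rw [h1]
    refine hsign s ?_
    by_cases hT : T.IsRestricted
    · exact Submodule.subset_span ⟨⟨T, hT⟩, rfl⟩
    · rw [theta_eq_zero hT]
      exact Submodule.zero_mem _
  obtain ⟨s, l', hl', h⟩ := (Web.sergeevSystem r).exists_nodup_dots l
  have h1 : TrailingComposition.diagramWeb lam mu l σ =
      s • TrailingComposition.diagramWeb lam mu l' σ := by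
    have h0 : ∀ l, (Web.sergeevSystem r).dots l * (Web.sergeevSystem r).perm σ *
        (Web.sergeevSystem r).e = (Web.sergeevSystem r).dots l * (Web.sergeevSystem r).e *
          (Web.sergeevSystem r).perm σ := fun l => by
      rw [mul_assoc, (Web.sergeevSystem r).perm_mul_e, ← mul_assoc]
    rw [TrailingComposition.diagramWeb, TrailingComposition.diagramWeb, h0, h0, h, smul_mul_assoc,
      mul_smul_comm, smul_mul_assoc]
  rw [h1]
  exact hsign s (key l' hl')

lemma mem_span_theta {x : Web r} (hx : x ∈ Web.corner r mu.idWeb lam.idWeb) :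
    x ∈ Submodule.span ℂ (Set.range fun T : {T : Supertabloid lam mu // T.IsRestricted} =>
      T.1.theta) := by
  obtain ⟨w, rfl⟩ := hx
  obtain ⟨y, hy, h⟩ := Web.exists_factorization lam.isStrands mu.isStrands w
  rw [← mu.idWeb_eq, ← lam.idWeb_eq, ← mu.mergeWeb_eq, ← lam.splitWeb_eq, mul_assoc] at h
  change mu.idWeb * (w * lam.idWeb) ∈ _
  rw [h]
  have hle : (Web.sergeevSystem r).span ≤ (Submodule.span ℂ
      (Set.range fun T : {T : Supertabloid lam mu // T.IsRestricted} => T.1.theta)).comap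
        (LinearMap.mulRight ℂ lam.splitWeb ∘ₗ LinearMap.mulLeft ℂ mu.mergeWeb) := by
    refine Submodule.span_le.2 ?_
    rintro _ ⟨⟨l, σ⟩, rfl⟩
    exact diagramWeb_mem_span l σ
  exact hle hy

end Supertabloid

/-! ### The webs of supertabloids are linearly independent -/

lemma SergeevSystem.avg_mul_mul_avg {r : ℕ} {A : Type*} [Ring A] [Algebra ℂ A]
    (S : SergeevSystem r A) (H K : Subgroup (Equiv.Perm (Fin r))) [Fintype H] [Fintype K] (x : A) :
    S.avg H * x * S.avg K = ((Nat.card H : ℂ)⁻¹ * (Nat.card K : ℂ)⁻¹) •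
      ∑ u : H, ∑ v : K, S.perm u * x * S.perm v := by
  rw [avg, avg, smul_mul_assoc, smul_mul_assoc, mul_smul_comm, smul_smul]
  congr 1
  rw [Finset.sum_mul, Finset.sum_mul]
  simp only [Finset.mul_sum]
  congr!

namespace Supertabloid

variable {r : ℕ} {lam mu : TrailingComposition r}

/-- The coefficient of the diagram of `T` at a conjugate of the diagram of `T'`. -/
lemma coeff_conj {T T' : Supertabloid lam mu} (hT : T.IsRestricted) {u v : Equiv.Perm (Fin r)}
    (hu : u ∈ young r (List.ofFn mu.parts)) (hv : v ∈ young r (List.ofFn lam.parts))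
    (h0 : Fock.coeff T.dotList.toFinset T.strandPerm ((Fock.system r).perm u *
      ((Fock.system r).dots T'.dotList * (Fock.system r).perm T'.strandPerm) *
        (Fock.system r).perm v) ≠ 0) :
    T' = T ∧ (Fock.system r).perm u *
      ((Fock.system r).dots T'.dotList * (Fock.system r).perm T'.strandPerm) *
        (Fock.system r).perm v =
      (Fock.system r).dots T.dotList * (Fock.system r).perm T.strandPerm := by
  let S := Fock.system r
  have h1 : S.perm u * (S.dots T'.dotList * S.perm T'.strandPerm) * S.perm v =
      S.dots (T'.dotList.map u) * S.perm (u * T'.strandPerm * v) := by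
    rw [map_mul, map_mul, ← mul_assoc, S.perm_mul_dots]
    simp only [mul_assoc]
  have hnd : (T'.dotList.map u).Nodup := T'.nodup_dotList.map u.injective
  have hσ : u * T'.strandPerm * v = T.strandPerm := by
    by_contra hne
    exact h0 (by rw [h1]; exact Fock.coeff_eq_zero_of_ne hne _ _)
  rw [hσ] at h1
  have hset : T.dotList.toFinset = (T'.dotList.map u).toFinset := by
    by_contra hne
    exact h0 (by rw [h1]; exact Fock.coeff_eq_zero_of_toFinset_ne hnd hne _)
  have hd : ∀ q, u q ∈ T.dotted ↔ q ∈ T'.dotted := fun q => by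
    rw [← mem_dotList, ← mem_dotList, ← List.mem_toFinset, hset, List.mem_toFinset,
      List.mem_map_of_injective u.injective]
  obtain rfl := eq_of_diagram hu hv hσ hd
  refine ⟨rfl, h1.trans ?_⟩
  congr 2
  conv_rhs => rw [← List.map_id T'.dotList]
  exact List.map_congr_left fun q hq => hT.apply_eq hu hv hσ hd ((mem_dotList _ _).1 hq)

/-- Different supertabloids belong to different double cosets of Sergeev diagrams, so that no term of
the average contributes. -/
lemma coeff_avg_of_ne {T T' : Supertabloid lam mu} (hT : T.IsRestricted) (hne : T' ≠ T) :
    Fock.coeff T.dotList.toFinset T.strandPerm ((Fock.system r).youngAvg (List.ofFn mu.parts) *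
      ((Fock.system r).dots T'.dotList * (Fock.system r).perm T'.strandPerm) *
        (Fock.system r).youngAvg (List.ofFn lam.parts)) = 0 := by
  classical
  rw [SergeevSystem.youngAvg, SergeevSystem.youngAvg, SergeevSystem.avg_mul_mul_avg, map_smul,
    map_sum]
  simp only [map_sum]
  rw [Finset.sum_eq_zero, smul_zero]
  intro u _
  refine Finset.sum_eq_zero fun v _ => ?_
  by_contra h0
  exact hne (coeff_conj hT u.2 v.2 h0).1

/-- The terms of the average that are multiples of the diagram of `T` do not cancel: the dots are
fixed one by one by `IsRestricted.apply_eq`, so that no signs appear. -/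
lemma coeff_avg_self {T : Supertabloid lam mu} (hT : T.IsRestricted) :
    Fock.coeff T.dotList.toFinset T.strandPerm ((Fock.system r).youngAvg (List.ofFn mu.parts) *
      ((Fock.system r).dots T.dotList * (Fock.system r).perm T.strandPerm) *
        (Fock.system r).youngAvg (List.ofFn lam.parts)) ≠ 0 := by
  classical
  rw [SergeevSystem.youngAvg, SergeevSystem.youngAvg, SergeevSystem.avg_mul_mul_avg, map_smul,
    map_sum]
  simp only [map_sum]
  rw [← Fintype.sum_prod_type']
  have hk := Fock.coeff_ne_zero T.nodup_dotList T.strandPerm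
  -- each nonzero term of the sum has the same value
  have hterm : ∀ x : young r (List.ofFn mu.parts) × young r (List.ofFn lam.parts),
      Fock.coeff T.dotList.toFinset T.strandPerm ((Fock.system r).perm x.1 *
        ((Fock.system r).dots T.dotList * (Fock.system r).perm T.strandPerm) *
          (Fock.system r).perm x.2) =
      if Fock.coeff T.dotList.toFinset T.strandPerm ((Fock.system r).perm x.1 *
        ((Fock.system r).dots T.dotList * (Fock.system r).perm T.strandPerm) *
          (Fock.system r).perm x.2) ≠ 0 then Fock.coeff T.dotList.toFinset T.strandPerm
            ((Fock.system r).dots T.dotList * (Fock.system r).perm T.strandPerm) else 0 := by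
    intro x
    split_ifs with h
    · rw [(coeff_conj hT x.1.2 x.2.2 h).2]
    · exact not_not.1 h
  rw [Finset.sum_congr rfl fun x _ => hterm x, ← Finset.sum_filter, Finset.sum_const, nsmul_eq_mul]
  refine smul_ne_zero (mul_ne_zero ?_ ?_) (mul_ne_zero ?_ hk)
  · exact inv_ne_zero (Nat.cast_ne_zero.2 Nat.card_pos.ne')
  · exact inv_ne_zero (Nat.cast_ne_zero.2 Nat.card_pos.ne')
  · refine Nat.cast_ne_zero.2 (Finset.card_pos.2 ⟨1, ?_⟩).ne'
    rw [Finset.mem_filter]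
    exact ⟨Finset.mem_univ _, by simpa using hk⟩

/-- The entry of the matrix of a web that belongs to two given compositions. -/
noncomputable def webEntry (lam mu : TrailingComposition r) :
    Web r →ₗ[ℂ] Module.End ℂ (Equiv.Perm (Fin r) → Finset (Fin r) → ℂ) where
  toFun w := (SergeevSystem.webRep (S := Fock.system r) rfl w).1
    (eraseComposition _ mu.sum_ofFn) (eraseComposition _ lam.sum_ofFn)
  map_add' w w' := by rw [map_add]; rfl
  map_smul' z w := by rw [map_smul, SergeevSystem.val_smul]; rfl

lemma linearIndependent_theta :
    LinearIndependent ℂ fun T : {T : Supertabloid lam mu // T.IsRestricted} => T.1.theta := by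
  obtain ⟨z, hz, h⟩ := exists_acts_theta (Fock.system r) lam mu
  have hentry : ∀ T : Supertabloid lam mu, webEntry lam mu T.theta =
      z • ((Fock.system r).youngAvg (List.ofFn mu.parts) *
      ((Fock.system r).dots T.dotList * (Fock.system r).perm T.strandPerm) *
        (Fock.system r).youngAvg (List.ofFn lam.parts)) := by
    intro T
    have := (h T).webRep_eq rfl
    change (SergeevSystem.webRep (S := Fock.system r) rfl T.theta).1 _ _ = _
    rw [this]
    exact if_pos ⟨rfl, rfl⟩
  rw [linearIndependent_iff']
  intro s g hg T hT
  have h1 := congrArg (Fock.coeff T.1.dotList.toFinset T.1.strandPerm ∘ₗ webEntry lam mu) hg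
  rw [map_sum, map_zero, Finset.sum_eq_single T] at h1
  · rw [map_smul, LinearMap.comp_apply, hentry, map_smul, smul_smul, smul_eq_mul] at h1
    have := (mul_eq_zero.1 h1).resolve_right (coeff_avg_self T.2)
    exact (mul_eq_zero.1 this).resolve_right hz
  · intro T' _ hne
    rw [map_smul, LinearMap.comp_apply, hentry, map_smul,
      coeff_avg_of_ne T.2 fun h' => hne (Subtype.ext h'), smul_zero, smul_zero]
  · exact fun h' => absurd hT h'

end Supertabloid

/-- The webs `θ_T`, for `T` a supertabloid of shape `lam` and type `mu` with each primed letter at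
most once per row, form a basis of `a_mu W a_lam`. -/
theorem theorem5p4 (r : ℕ) (hr : 0 < r) (lam mu : TrailingComposition r) :
    ∃ b : Module.Basis {T : Supertabloid lam mu // T.IsRestricted} ℂ
        (Web.corner r mu.idWeb lam.idWeb),
      ∀ T, (b T : Web r) = T.1.theta := by
  let f : {T : Supertabloid lam mu // T.IsRestricted} → Web.corner r mu.idWeb lam.idWeb :=
    fun T => ⟨T.1.theta, T.1.theta_mem_corner⟩
  have hf : LinearIndependent ℂ f :=
    LinearIndependent.of_comp (Web.corner r mu.idWeb lam.idWeb).subtype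
      Supertabloid.linearIndependent_theta
  have hspan : ⊤ ≤ Submodule.span ℂ (Set.range f) := by
    rintro ⟨x, hx⟩ -
    have h1 := Supertabloid.mem_span_theta hx
    have h2 : (Set.range fun T : {T : Supertabloid lam mu // T.IsRestricted} => T.1.theta) =
        (Web.corner r mu.idWeb lam.idWeb).subtype '' Set.range f := by
      rw [← Set.range_comp]; rfl
    rw [h2, ← Submodule.map_span] at h1
    obtain ⟨y, hy, hyx⟩ := h1
    have : y = ⟨x, hx⟩ := Subtype.ext hyx
    rwa [← this]
  exact ⟨Module.Basis.mk hf hspan, fun T => by rw [Module.Basis.mk_apply]⟩
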